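/- Let $\mathbb G_a$ be the additive group scheme. For a commutative ring $k$ let $H^*(\mathbb G_{a,k},k)=H^*(B\mathbb G_{a,k},\mathcal O)$ be the cohomology ring of the standard complex $$0\to k\to k[x_1]\to k[x_1,x_2]\to\cdots,\qquad C^n=\mathcal O(\mathbb G_{a,k}^n)=k[x_1,\dots,x_n],$$ whose differential is the alternating sum of the pullbacks along the face maps of the nerve of $\mathbb G_a$, with the cup product $(f\smile g)(x_1,\dots,x_{m+n})=f(x_1,\dots,x_m)\,g(x_{m+1},\dots,x_{m+n})$; write $H^*(B\mathbb G_a,\mathcal O)$ for the case $k=\mathbb Z$. For a prime $p$ let $\beta_p\colon H^*(\mathbb G_{a,\mathbb F_p},\mathbb F_p)\to H^{*+1}(\mathbb G_{a,\mathbb F_p},\mathbb F_p)$ be the Bockstein, i.e. the connecting homomorphism $H^*(\mathbb G_{a,\mathbb F_p},\mathbb F_p)\to H^{*+1}(B\mathbb G_a,\mathcal O)$ of $0\to C^\bullet(\mathbb G_a,\mathbb Z)\xrightarrow{\,p\,}C^\bullet(\mathbb G_a,\mathbb Z)\to C^\bullet(\mathbb G_a,\mathbb F_p)\to0$ followed by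 reduction modulo $p$. Let $v_1\in H^1(B\mathbb G_a,\mathcal O)$ be the class of the coordinate function $x$, with reduction $\overline v_1\in H^1(\mathbb G_{a,\mathbb F_p},\mathbb F_p)$, and let $v_2\in H^2(B\mathbb G_a,\mathcal O)$ be the class of $\tfrac12 d(x^2)$, whose reduction modulo $2$ lies in $\operatorname{Im}\beta_2$ and is again denoted $v_2$. Then: 1. There is an isomorphism of graded rings $$H^*(B\mathbb G_a,\mathcal O)\;\simeq\;\Bigl(\mathbb Z[v_1]\oplus\bigoplus_p\operatorname{Im}\beta_p\Bigr)\Big/\bigl(v_1^2=v_2\bigr),$$ where $v_1$ has degree $1$, $\operatorname{Im}\beta_p\subset H^*(\mathbb G_{a,\mathbb F_p},\mathbb F_p)$ is the image of the Bockstein (a graded non-unital subring, on which $\mathbb Z[v_1]$ acts from both sides through $v_1\mapsto\overline v_1$), and products of elements of $\operatorname{Im}\beta_p$ and $\operatorname{Im}\beta_q$ for $p\ne q$ are zero. The isomorphism can be chosen so that it sends $v_1$ to $v_1$ and so that, for every $p$, the element of $H^*(B\mathbb G_a,\mathcal O)$ corresponding to $b\in\operatorname{Im}\beta_p$ has reduction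 $b$ modulo $p$. 2. For every prime $p$ the $p$-primary torsion of $H^*(B\mathbb G_a,\mathcal O)$ is killed by $p$. 3. For every prime $p$ the $p$-torsion subgroup of $H^2(B\mathbb G_a,\mathcal O)$ is not finitely generated. -/

import Mathlib

open scoped DirectSum

namespace BGa

/-! ### The simplicial scheme presenting the classifying stack of the additive group -/

/-- The nerve of the additive group `(R, +)`, i.e. the `R`-points of the Cech nerve
`[n] ↦ 𝔾ₐⁿ` of the atlas `pt → B𝔾ₐ`: the `i`-th face map `Rⁿ⁺¹ → Rⁿ`, `0 ≤ i ≤ n + 1`, drops the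
first entry for `i = 0`, drops the last entry for `i = n + 1`, and adds the neighbouring entries
with (zero-based) positions `i - 1` and `i` for `1 ≤ i ≤ n`. -/
def face {R : Type*} [Add R] {n : ℕ} (i : ℕ) (g : Fin (n + 1) → R) (j : Fin n) : R :=
  if (j : ℕ) + 1 < i then g j.castSucc
  else if (j : ℕ) + 1 = i then g j.castSucc + g j.succ
  else g j.succ

/-- `𝒪(𝔾ₐⁿ) = k[x₀, …, xₙ₋₁]`, the regular functions on the `n`-th term of the Cech nerve. -/
abbrev Cochain (k : Type*) [CommRing k] (n : ℕ) : Type _ := MvPolynomial (Fin n) k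

/-- Pullback of functions along the `i`-th face map `𝔾ₐⁿ⁺¹ → 𝔾ₐⁿ`:
`(coface i f)(g) = f (face i g)`. -/
noncomputable def coface {k : Type*} [CommRing k] {n : ℕ} (i : ℕ) :
    Cochain k n →ₐ[k] Cochain k (n + 1) :=
  MvPolynomial.aeval (face i MvPolynomial.X)

/-- The differential `∑ᵢ (-1)ⁱ dⁱ : 𝒪(𝔾ₐⁿ) → 𝒪(𝔾ₐⁿ⁺¹)` of the standard complex
`C^•(𝔾ₐ, k) = 𝒪(𝔾ₐ^•)`. -/
noncomputable def diff {k : Type*} [CommRing k] (n : ℕ) : Cochain k n →+ Cochain k (n + 1) :=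
  ∑ i ∈ Finset.range (n + 2), (-1 : ℤ) ^ i • (coface (k := k) (n := n) i : _ →+ _)

/-- The cup product of cochains,
`(f ⌣ g)(x₀, …, x_{m+n-1}) = f (x₀, …, x_{m-1}) * g (x_m, …, x_{m+n-1})`. -/
noncomputable def cup {k : Type*} [CommRing k] {m n : ℕ} (f : Cochain k m) (g : Cochain k n) :
    Cochain k (m + n) :=
  MvPolynomial.rename (Fin.castAdd n) f * MvPolynomial.rename (Fin.natAdd m) g

section lemmas

variable {k : Type*} [CommRing k]

theorem mk_eq {m n : ℕ} (h : m = n) (f : Cochain k m) (g : Cochain k n)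
    (hfg : MvPolynomial.rename (Fin.cast h) f = g) :
    GradedMonoid.mk (A := Cochain k) m f = GradedMonoid.mk n g := by
  subst h
  subst hfg
  congr 1
  exact (MvPolynomial.rename_id_apply f).symm

theorem one_cup {n : ℕ} (f : Cochain k n) :
    GradedMonoid.mk (A := Cochain k) (0 + n) (cup (1 : Cochain k 0) f) = GradedMonoid.mk n f := by
  apply mk_eq (Nat.zero_add n)
  simp only [cup, map_one, one_mul, MvPolynomial.rename_rename]
  convert MvPolynomial.rename_id_apply f
  ext i; simp

theorem cup_one {n : ℕ} (f : Cochain k n) :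
    GradedMonoid.mk (A := Cochain k) (n + 0) (cup f (1 : Cochain k 0)) = GradedMonoid.mk n f := by
  apply mk_eq (Nat.add_zero n)
  simp only [cup, map_one, mul_one, MvPolynomial.rename_rename]
  exact MvPolynomial.rename_id_apply f

theorem cup_assoc {l m n : ℕ} (f : Cochain k l) (g : Cochain k m) (h : Cochain k n) :
    GradedMonoid.mk (A := Cochain k) (l + m + n) (cup (cup f g) h) =
      GradedMonoid.mk (l + (m + n)) (cup f (cup g h)) := by
  apply mk_eq (Nat.add_assoc l m n)
  simp only [cup, map_mul, MvPolynomial.rename_rename, mul_assoc]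
  congr 2
  · congr 2; ext i; simp; omega

noncomputable instance : GradedMonoid.GMul (Cochain k) where
  mul := cup

noncomputable instance : GradedMonoid.GOne (Cochain k) where
  one := (1 : MvPolynomial (Fin 0) k)

noncomputable instance : GradedMonoid.GMonoid (Cochain k) where
  one_mul a := one_cup a.2
  mul_one a := cup_one a.2
  mul_assoc a b c := cup_assoc a.2 b.2 c.2

/-- The cochains form a graded ring under the cup product. -/
noncomputable instance : DirectSum.GRing (Cochain k) where
  mul_zero _ := by simp [GradedMonoid.GMul.mul, cup]
  zero_mul _ := by simp [GradedMonoid.GMul.mul, cup]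
  mul_add _ _ _ := by simp [GradedMonoid.GMul.mul, cup, mul_add]
  add_mul _ _ _ := by simp [GradedMonoid.GMul.mul, cup, add_mul]
  natCast n := ((n : MvPolynomial (Fin 0) k))
  natCast_zero := Nat.cast_zero
  natCast_succ n := Nat.cast_succ n
  intCast n := ((n : MvPolynomial (Fin 0) k))
  intCast_ofNat n := Int.cast_natCast n
  intCast_negSucc_ofNat n := Int.cast_negSucc n

end lemmas

/-- The total standard complex `⨁ₙ 𝒪(𝔾ₐⁿ)`, a graded ring under the cup product. -/
abbrev TotalCochain (k : Type*) [CommRing k] : Type _ := ⨁ n, Cochain k n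

/-- The total differential. -/
noncomputable def totalDiff (k : Type*) [CommRing k] : TotalCochain k →+ TotalCochain k :=
  DirectSum.toAddMonoid fun n => (DirectSum.of (Cochain k) (n + 1)).comp (diff n)

section lemmas

variable {k : Type*} [CommRing k]

theorem coface_rename_castAdd {m n i : ℕ} (f : Cochain k m) (h : m + 1 + n = m + n + 1) :
    coface i (MvPolynomial.rename (Fin.castAdd n) f) =
    MvPolynomial.rename (Fin.cast h ∘ Fin.castAdd n) (coface i f) := by
  have : ((coface i).comp (MvPolynomial.rename (Fin.castAdd n)) : Cochain k m →ₐ[k] _) =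
    (MvPolynomial.rename (Fin.cast h ∘ Fin.castAdd n)).comp (coface i) := by
    ext j : 1
    simp only [coface, face, AlgHom.comp_apply, MvPolynomial.rename_X, MvPolynomial.aeval_X]
    simp only [Fin.val_castAdd]
    split_ifs <;> simp only [map_add, MvPolynomial.rename_X] <;> rfl
  exact DFunLike.congr_fun this f

theorem coface_rename_castAdd_of_lt {m n i : ℕ} (hi : m < i) (f : Cochain k m) :
    coface i (MvPolynomial.rename (Fin.castAdd n) f) =
    MvPolynomial.rename (Fin.castSucc ∘ Fin.castAdd n) f := by
  have : ((coface i).comp (MvPolynomial.rename (Fin.castAdd n)) : Cochain k m →ₐ[k] _) =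
    (MvPolynomial.rename (Fin.castSucc ∘ Fin.castAdd n)) := by
    ext j : 1
    simp only [coface, face, AlgHom.comp_apply, MvPolynomial.rename_X, MvPolynomial.aeval_X]
    simp only [Fin.val_castAdd]
    rw [if_pos (by omega)]; rfl
  exact DFunLike.congr_fun this f

theorem coface_rename_natAdd {m n j : ℕ} (g : Cochain k n) :
    coface (m + j) (MvPolynomial.rename (Fin.natAdd m) g) =
    MvPolynomial.rename (Fin.natAdd m) (coface j g) := by
  have : ((coface (m+j)).comp (MvPolynomial.rename (Fin.natAdd m)) : Cochain k n →ₐ[k] _) =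
    (MvPolynomial.rename (Fin.natAdd m)).comp (coface j) := by
    ext a : 1
    simp only [coface, face, AlgHom.comp_apply, MvPolynomial.rename_X, MvPolynomial.aeval_X]
    simp only [Fin.val_natAdd, show m + (a:ℕ) + 1 < m + j ↔ (a:ℕ) + 1 < j by omega,
      show m + (a:ℕ) + 1 = m + j ↔ (a:ℕ) + 1 = j by omega]
    split_ifs <;> simp only [map_add, MvPolynomial.rename_X] <;> rfl
  exact DFunLike.congr_fun this g

theorem diff_apply {n : ℕ} (f : Cochain k n) :
    diff n f = ∑ i ∈ Finset.range (n + 2), (-1 : ℤ) ^ i • coface i f := by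
  simp [diff, AddMonoidHom.finsetSum_apply]

theorem diff_cup {m n : ℕ} (f : Cochain k m) (g : Cochain k n) (h : m + 1 + n = m + n + 1) :
    diff (m + n) (cup f g) =
      MvPolynomial.rename (Fin.cast h) (cup (diff m f) g) +
        (-1 : ℤ) ^ m • (cup f (diff n g) : Cochain k (m + (n + 1))) := by
  have h1 : ∀ i, MvPolynomial.rename (Fin.cast h) (cup (coface i f) g) =
      coface i (MvPolynomial.rename (Fin.castAdd n) f) *
        MvPolynomial.rename (Fin.natAdd m ∘ Fin.succ) g := by
    intro i
    simp only [cup, map_mul, MvPolynomial.rename_rename, coface_rename_castAdd f h]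
    congr 2
    congr 1
    ext a; simp; omega
  have h2 : ∀ j, (cup f (coface j g) : Cochain k (m + (n + 1))) =
      MvPolynomial.rename (Fin.castSucc ∘ Fin.castAdd n) f *
        coface (m + j) (MvPolynomial.rename (Fin.natAdd m) g) := by
    intro j
    simp only [coface_rename_natAdd]
    rfl
  have h3 : coface 0 g = MvPolynomial.rename Fin.succ g := by
    have : (coface 0 : Cochain k n →ₐ[k] _) = MvPolynomial.rename Fin.succ := by
      ext a : 1
      simp [coface, face]
    rw [this]
  have h4 : ∀ i, coface i (cup f g) = coface i (MvPolynomial.rename (Fin.castAdd n) f) *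
      coface i (MvPolynomial.rename (Fin.natAdd m) g) := fun i => by simp [cup]
  have h5 : ∀ i ∈ Finset.range (m + 1), coface i (MvPolynomial.rename (Fin.natAdd m) g) =
      MvPolynomial.rename (Fin.natAdd m ∘ Fin.succ) g := by
    intro i hi
    have hi : i < m + 1 := by simpa using hi
    have : (coface i).comp (MvPolynomial.rename (Fin.natAdd m) : Cochain k n →ₐ[k] _) =
        MvPolynomial.rename (Fin.natAdd m ∘ Fin.succ) := by
      ext a : 1
      simp only [coface, face, AlgHom.comp_apply, MvPolynomial.rename_X, MvPolynomial.aeval_X,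
        Fin.val_natAdd]
      rw [if_neg (by omega), if_neg (by omega)]
      rfl
    exact DFunLike.congr_fun this g
  have e1 : ∀ x : ℕ → Cochain k (m + 1),
      (cup (∑ i ∈ Finset.range (m + 2), (-1 : ℤ) ^ i • x i) g : Cochain k (m + 1 + n)) =
        ∑ i ∈ Finset.range (m + 2), (-1 : ℤ) ^ i • cup (x i) g := by
    intro x; simp only [cup, map_sum, map_zsmul, Finset.sum_mul, smul_mul_assoc]
  have e2 : ∀ x : ℕ → Cochain k (n + 1),
      (cup f (∑ i ∈ Finset.range (n + 2), (-1 : ℤ) ^ i • x i) : Cochain k (m + (n + 1))) =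
        ∑ i ∈ Finset.range (n + 2), (-1 : ℤ) ^ i • cup f (x i) := by
    intro x; simp only [cup, map_sum, map_zsmul, Finset.mul_sum, mul_smul_comm]
  rw [diff_apply, diff_apply, diff_apply, e1, e2, map_sum]
  simp only [map_zsmul, h1, h2, h4]
  rw [show m + n + 2 = (m + 1) + (n + 1) by ring, Finset.sum_range_add,
    Finset.sum_range_succ _ (m + 1), Finset.sum_range_succ' _ (n + 1)]
  rw [smul_add, Finset.smul_sum]
  have t1 : ∑ x ∈ Finset.range (m + 1), (-1 : ℤ) ^ x •
        (coface x (MvPolynomial.rename (Fin.castAdd n) f) *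
          coface x (MvPolynomial.rename (Fin.natAdd m) g)) =
      ∑ x ∈ Finset.range (m + 1), (-1 : ℤ) ^ x •
        (coface x (MvPolynomial.rename (Fin.castAdd n) f) *
          MvPolynomial.rename (Fin.natAdd m ∘ Fin.succ) g) :=
    Finset.sum_congr rfl fun i hi => by rw [h5 i hi]
  have t2 : ∑ x ∈ Finset.range (n + 1), (-1 : ℤ) ^ (m + 1 + x) •
        (coface (m + 1 + x) (MvPolynomial.rename (Fin.castAdd n) f) *
          coface (m + 1 + x) (MvPolynomial.rename (Fin.natAdd m) g)) =
      ∑ x ∈ Finset.range (n + 1), (-1 : ℤ) ^ m • (-1 : ℤ) ^ (x + 1) •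
        (MvPolynomial.rename (Fin.castSucc ∘ Fin.castAdd n) f *
          coface (m + (x + 1)) (MvPolynomial.rename (Fin.natAdd m) g)) := by
    refine Finset.sum_congr rfl fun i _ => ?_
    rw [smul_smul, ← pow_add, coface_rename_castAdd_of_lt (by omega),
      show m + 1 + i = m + (i + 1) by ring]
  have t3 : (-1 : ℤ) ^ (m + 1) • (coface (m + 1) (MvPolynomial.rename (Fin.castAdd n) f) *
          MvPolynomial.rename (Fin.natAdd m ∘ Fin.succ) g) +
      (-1 : ℤ) ^ m • (-1 : ℤ) ^ 0 • (MvPolynomial.rename (Fin.castSucc ∘ Fin.castAdd n) f *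
          coface (m + 0) (MvPolynomial.rename (Fin.natAdd m) g)) = 0 := by
    rw [coface_rename_natAdd, h3, MvPolynomial.rename_rename,
      coface_rename_castAdd_of_lt (by omega), pow_succ, pow_zero, one_smul, mul_neg_one, neg_smul,
      neg_add_eq_zero]
  rw [t1, t2]
  linear_combination (exp := 1) -t3

theorem totalDiff_of {n : ℕ} (f : Cochain k n) :
    totalDiff k (DirectSum.of (Cochain k) n f) = DirectSum.of (Cochain k) (n + 1) (diff n f) := by
  simp [totalDiff]

theorem of_mul_of_cup {m n : ℕ} (f : Cochain k m) (g : Cochain k n) :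
    DirectSum.of (Cochain k) m f * DirectSum.of (Cochain k) n g =
      DirectSum.of (Cochain k) (m + n) (cup f g) :=
  DirectSum.of_mul_of f g

/-- The grading involution, `(-1)ⁿ` on cochains of degree `n`. -/
noncomputable def sgn (k : Type*) [CommRing k] : TotalCochain k →+ TotalCochain k :=
  DirectSum.map fun n => (-1 : ℤ) ^ n • AddMonoidHom.id _

theorem sgn_of {n : ℕ} (f : Cochain k n) :
    sgn k (DirectSum.of (Cochain k) n f) = (-1 : ℤ) ^ n • DirectSum.of (Cochain k) n f := by
  rw [sgn, DirectSum.map_of, ← map_zsmul]; rfl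

theorem totalDiff_mul (a b : TotalCochain k) :
    totalDiff k (a * b) = totalDiff k a * b + sgn k a * totalDiff k b := by
  induction a using DirectSum.induction_on with
  | zero => simp
  | add x y hx hy => simp only [add_mul, map_add, hx, hy]; abel
  | of m f =>
    induction b using DirectSum.induction_on with
    | zero => simp
    | add x y hx hy => simp only [mul_add, map_add, hx, hy]; abel
    | of n g =>
      have h : m + 1 + n = m + n + 1 := by ring
      rw [of_mul_of_cup, totalDiff_of, totalDiff_of, totalDiff_of, sgn_of, smul_mul_assoc, of_mul_of_cup,
        of_mul_of_cup, diff_cup f g h, map_add, ← map_zsmul]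
      congr 1
      exact (DirectSum.of_eq_of_gradedMonoid_eq (mk_eq h _ _ rfl)).symm

theorem coface_coface {n i j : ℕ} (h : i ≤ j) (f : Cochain k n) :
    coface i (coface j f) = coface (j + 1) (coface i f) := by
  have : (coface i).comp (coface j : Cochain k n →ₐ[k] _) = (coface (j + 1)).comp (coface i) := by
    ext a : 1
    simp only [coface, face, AlgHom.comp_apply, MvPolynomial.aeval_X]
    split_ifs <;> simp only [map_add, MvPolynomial.aeval_X, face, Fin.val_castSucc, Fin.val_succ] <;>
      split_ifs <;> first | omega | simp only [Fin.succ_castSucc, add_assoc]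
  exact DFunLike.congr_fun this f

theorem diff_diff {n : ℕ} (f : Cochain k n) : diff (n + 1) (diff n f) = 0 := by
  simp only [diff_apply, map_sum, map_zsmul, Finset.smul_sum, smul_smul, ← pow_add]
  rw [← Finset.sum_product']
  refine Finset.sum_involution
    (fun q _ => if q.2 ≤ q.1 then (q.2, q.1 + 1) else (q.2 - 1, q.1)) ?_ ?_ ?_ ?_
  · rintro ⟨j, i⟩ -
    dsimp only
    split_ifs with h
    · dsimp only
      rw [coface_coface h, show i + (j + 1) = (j + i) + 1 by ring, pow_succ, mul_neg_one,
        neg_smul, add_neg_cancel]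
    · obtain ⟨l, rfl⟩ : ∃ l, i = l + 1 := ⟨i - 1, by omega⟩
      dsimp only
      rw [Nat.add_sub_cancel, coface_coface (by omega : j ≤ l),
        show j + (l + 1) = (l + j) + 1 by ring, pow_succ, mul_neg_one, neg_smul, neg_add_cancel]
  · rintro ⟨j, i⟩ - -
    dsimp only
    split_ifs with h <;> simp only [ne_eq, Prod.mk.injEq, not_and] <;> omega
  · rintro ⟨j, i⟩ hq
    simp only [Finset.mem_product, Finset.mem_range] at hq ⊢
    split_ifs <;> dsimp only <;> omega
  · rintro ⟨j, i⟩ hq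
    dsimp only
    split_ifs with h1 h2 h2 <;> dsimp only at h2 ⊢ <;>
      first | omega | (apply Prod.ext <;> dsimp only; omega)

theorem totalDiff_totalDiff (a : TotalCochain k) : totalDiff k (totalDiff k a) = 0 := by
  induction a using DirectSum.induction_on with
  | zero => simp
  | add x y hx hy => simp only [map_add, hx, hy, add_zero]
  | of m f => rw [totalDiff_of, totalDiff_of, diff_diff, map_zero]

theorem sgn_sgn (a : TotalCochain k) : sgn k (sgn k a) = a := by
  induction a using DirectSum.induction_on with
  | zero => simp
  | add x y hx hy => simp only [map_add, hx, hy]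
  | of m f => rw [sgn_of, map_zsmul, sgn_of, smul_smul, ← mul_pow]; simp

theorem totalDiff_sgn (a : TotalCochain k) : totalDiff k (sgn k a) = -sgn k (totalDiff k a) := by
  induction a using DirectSum.induction_on with
  | zero => simp
  | add x y hx hy => simp only [map_add, hx, hy]; abel
  | of m f => rw [sgn_of, map_zsmul, totalDiff_of, sgn_of, pow_succ]; simp

theorem totalDiff_one : totalDiff k 1 = 0 := by
  have h := totalDiff_mul (1 : TotalCochain k) 1
  rw [mul_one, mul_one, DirectSum.one_def, sgn_of, pow_zero, one_smul, ← DirectSum.one_def, one_mul] at h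
  simpa using h

end lemmas

/-! ### Cohomology -/

/-- The ring of cocycles of the standard complex. -/
noncomputable def cocycles (k : Type*) [CommRing k] : Subring (TotalCochain k) where
  carrier := {z | totalDiff k z = 0}
  mul_mem' {a b} ha hb := by
    simp only [Set.mem_ofPred_eq] at *
    rw [totalDiff_mul, ha, hb, zero_mul, mul_zero, add_zero]
  one_mem' := totalDiff_one
  add_mem' {a b} ha hb := by simp only [Set.mem_ofPred_eq] at *; rw [map_add, ha, hb, add_zero]
  zero_mem' := map_zero _
  neg_mem' {a} ha := by simp only [Set.mem_ofPred_eq] at *; rw [map_neg, ha, neg_zero]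

/-- The (two-sided) ideal of coboundaries in the ring of cocycles. -/
noncomputable def coboundaries (k : Type*) [CommRing k] : Ideal (cocycles k) where
  carrier := {z | ∃ c : TotalCochain k, totalDiff k c = z}
  add_mem' := by
    rintro _ _ ⟨c, hc⟩ ⟨c', hc'⟩
    exact ⟨c + c', by rw [map_add, hc, hc']; rfl⟩
  zero_mem' := ⟨0, map_zero _⟩
  smul_mem' := by
    rintro ⟨a, ha⟩ z ⟨c, hc⟩
    have ha : totalDiff k a = 0 := ha
    refine ⟨sgn k a * c, ?_⟩
    rw [totalDiff_mul, totalDiff_sgn, ha, sgn_sgn, hc]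
    simp

instance (k : Type*) [CommRing k] : (coboundaries k).IsTwoSided where
  mul_mem_of_left := by
    rintro z ⟨b, hb⟩ ⟨c, hc⟩
    have hb : totalDiff k b = 0 := hb
    refine ⟨c * b, ?_⟩
    rw [totalDiff_mul, hb, hc]
    simp

/-- The cohomology ring `H^*(B𝔾ₐ, 𝒪) = H^*(𝔾ₐ, k)` of the classifying stack of the additive group
over `k`, with the cup product. By flat descent along the atlas `pt → B𝔾ₐ`, whose Cech nerve consists
of the affine schemes `𝔾ₐⁿ`, the complex `RΓ(B𝔾ₐ, 𝒪)` is the totalization of the cosimplicial ring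
`𝒪(𝔾ₐ^•)`, i.e. the standard complex computing the cohomology of the algebraic group `𝔾ₐ` with
coefficients in the trivial module `k`. -/
def Cohomology (k : Type*) [CommRing k] : Type _ := cocycles k ⧸ coboundaries k

noncomputable instance (k : Type*) [CommRing k] : Ring (Cohomology k) :=
  Ideal.Quotient.ring (coboundaries k)

/-- The cohomology class of a cocycle. -/
noncomputable def toClass (k : Type*) [CommRing k] : cocycles k →+* Cohomology k :=
  Ideal.Quotient.mk (coboundaries k)

theorem toClass_surjective {k : Type*} [CommRing k] : Function.Surjective (toClass k) :=
  Ideal.Quotient.mk_surjective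

/-- The cohomology group `Hⁿ(B𝔾ₐ, 𝒪)`, as a subgroup of the cohomology ring: the classes of the
cocycles in `𝒪(𝔾ₐⁿ)`. -/
noncomputable def cohomologyDegree (k : Type*) [CommRing k] (n : ℕ) : AddSubgroup (Cohomology k) :=
  ((DirectSum.of (Cochain k) n).range.comap (cocycles k).subtype.toAddMonoidHom).map
    (toClass k).toAddMonoidHom

/-! ### Reduction modulo `p` and the Bockstein -/

/-- Base change of cochains along a ring homomorphism, coefficientwise. -/
noncomputable def mapTotalCochain {k l : Type*} [CommRing k] [CommRing l] (φ : k →+* l) :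
    TotalCochain k →+* TotalCochain l :=
  DirectSum.toSemiring
    (fun n => (DirectSum.of (Cochain l) n).comp (MvPolynomial.map φ).toAddMonoidHom)
    (by
      change DirectSum.of (Cochain l) 0 (MvPolynomial.map φ 1) = 1
      rw [map_one]; rfl)
    (by
      intro m n f g
      change DirectSum.of (Cochain l) (m + n) (MvPolynomial.map φ (cup f g)) =
        DirectSum.of (Cochain l) m (MvPolynomial.map φ f) *
          DirectSum.of (Cochain l) n (MvPolynomial.map φ g)
      rw [of_mul_of_cup]
      simp only [cup, map_mul, MvPolynomial.map_rename])

section lemmas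

variable {k l : Type*} [CommRing k] [CommRing l] (φ : k →+* l)

theorem mapTotalCochain_of {n : ℕ} (f : Cochain k n) :
    mapTotalCochain φ (DirectSum.of (Cochain k) n f) =
      DirectSum.of (Cochain l) n (MvPolynomial.map φ f) := by
  simp [mapTotalCochain]

theorem map_coface {n i : ℕ} (f : Cochain k n) :
    MvPolynomial.map φ (coface i f) = coface i (MvPolynomial.map φ f) := by
  have : (MvPolynomial.map φ).comp (coface i : Cochain k n →ₐ[k] _).toRingHom =
      (coface i : Cochain l n →ₐ[l] _).toRingHom.comp (MvPolynomial.map φ) := by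
    ext a : 2
    · simp [coface]
    · simp only [coface, face, RingHom.comp_apply, AlgHom.toRingHom_eq_coe, RingHom.coe_coe,
        MvPolynomial.aeval_X, MvPolynomial.map_X]
      split_ifs <;> simp
  exact DFunLike.congr_fun this f

theorem mapTotalCochain_totalDiff (a : TotalCochain k) :
    mapTotalCochain φ (totalDiff k a) = totalDiff l (mapTotalCochain φ a) := by
  induction a using DirectSum.induction_on with
  | zero => simp
  | add x y hx hy => simp only [map_add, hx, hy]
  | of m f =>
    rw [totalDiff_of, mapTotalCochain_of, mapTotalCochain_of, totalDiff_of, diff_apply, diff_apply]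
    simp only [map_sum, map_zsmul, map_coface]

end lemmas

/-- Base change of cocycles along a ring homomorphism. -/
noncomputable def mapCocycles {k l : Type*} [CommRing k] [CommRing l] (φ : k →+* l) :
    cocycles k →+* cocycles l :=
  (mapTotalCochain φ).restrict (cocycles k) (cocycles l) fun a (ha : totalDiff k a = 0) => by
    change totalDiff l _ = 0
    rw [← mapTotalCochain_totalDiff, ha, map_zero]

/-- The base change map `H^*(B𝔾ₐ, 𝒪) → H^*(B𝔾ₐ, 𝒪)` from `k` to `l`. -/
noncomputable def mapCohomology {k l : Type*} [CommRing k] [CommRing l] (φ : k →+* l) :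
    Cohomology k →+* Cohomology l :=
  Ideal.quotientMap (coboundaries l) (mapCocycles φ) (by
    rintro z ⟨c, hc⟩
    refine ⟨mapTotalCochain φ c, ?_⟩
    rw [← mapTotalCochain_totalDiff, hc]
    rfl)

/-- The reduction map `H^*(𝔾ₐ, ℤ) → H^*(𝔾ₐ, 𝔽_p)`. -/
noncomputable abbrev reduction (p : Nat.Primes) : Cohomology ℤ →+* Cohomology (ZMod p) :=
  mapCohomology (Int.castRingHom (ZMod p))

section lemmas

variable (p : Nat.Primes)

theorem exists_lift (a : TotalCochain (ZMod p)) :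
    ∃ t, mapTotalCochain (Int.castRingHom (ZMod p)) t = a := by
  induction a using DirectSum.induction_on with
  | zero => exact ⟨0, map_zero _⟩
  | add x y hx hy =>
    obtain ⟨t, rfl⟩ := hx
    obtain ⟨u, rfl⟩ := hy
    exact ⟨t + u, map_add _ _ _⟩
  | of m f =>
    obtain ⟨g, rfl⟩ := MvPolynomial.map_surjective (σ := Fin m) (Int.castRingHom (ZMod p))
      (ZMod.ringHom_surjective _) f
    exact ⟨DirectSum.of (Cochain ℤ) m g, mapTotalCochain_of _ _⟩

theorem mapTotalCochain_apply {k l : Type*} [CommRing k] [CommRing l] (φ : k →+* l)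
    (a : TotalCochain k) (n : ℕ) : mapTotalCochain φ a n = MvPolynomial.map φ (a n) := by
  induction a using DirectSum.induction_on with
  | zero => simp
  | add x y hx hy => simp only [map_add, DirectSum.add_apply, hx, hy]
  | of m f =>
    rw [mapTotalCochain_of]
    by_cases h : m = n
    · subst h; rw [DirectSum.of_eq_same, DirectSum.of_eq_same]
    · rw [DirectSum.of_eq_of_ne _ _ _ (Ne.symm h), DirectSum.of_eq_of_ne _ _ _ (Ne.symm h), map_zero]

theorem exists_eq_nsmul {t : TotalCochain ℤ}
    (ht : mapTotalCochain (Int.castRingHom (ZMod p)) t = 0) : ∃ s, t = (p : ℕ) • s := by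
  have h : ∀ n, ∃ g : Cochain ℤ n, t n = (p : ℕ) • g := by
    intro n
    have := congrArg (fun a : TotalCochain (ZMod p) => a n) ht
    simp only [mapTotalCochain_apply, DirectSum.zero_apply] at this
    have hd := (MvPolynomial.C_dvd_iff_zmod (p : ℕ) (t n)).2 this
    obtain ⟨g, hg⟩ := hd
    exact ⟨g, by rw [hg, nsmul_eq_mul]; simp⟩
  choose g hg using h
  classical
  refine ⟨∑ n ∈ DFinsupp.support t, DirectSum.of (Cochain ℤ) n (g n), ?_⟩
  rw [Finset.smul_sum]
  conv_lhs => rw [← DirectSum.sum_support_of t]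
  exact Finset.sum_congr rfl fun n _ => by rw [← map_nsmul, ← hg]

theorem map_nsmul_eq_zero (s : TotalCochain ℤ) :
    mapTotalCochain (Int.castRingHom (ZMod p)) ((p : ℕ) • s) = 0 := by
  refine DFinsupp.ext fun n => ?_
  have h : ((p : ℕ) : Cochain (ZMod p) n) = 0 := by
    rw [← map_natCast (MvPolynomial.C (σ := Fin n) (R := ZMod p)), ZMod.natCast_self, map_zero]
  change mapTotalCochain (Int.castRingHom (ZMod p)) ((p : ℕ) • s) n = 0
  rw [mapTotalCochain_apply, DirectSum.smul_apply, map_nsmul, nsmul_eq_mul, h, zero_mul]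

theorem nsmul_injective {s t : TotalCochain ℤ} (h : (p : ℕ) • s = (p : ℕ) • t) : s = t := by
  refine DFinsupp.ext fun n => ?_
  have := congrArg (fun a : TotalCochain ℤ => a n) h
  simp only [DirectSum.smul_apply] at this
  exact smul_right_injective _ p.2.ne_zero this

theorem exists_connecting (z : cocycles (ZMod p)) :
    ∃ (b : cocycles ℤ) (t : TotalCochain ℤ),
      mapTotalCochain (Int.castRingHom (ZMod p)) t = z ∧
        totalDiff ℤ t = (p : ℕ) • (b : TotalCochain ℤ) := by
  obtain ⟨t, ht⟩ := exists_lift p z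
  have h : mapTotalCochain (Int.castRingHom (ZMod p)) (totalDiff ℤ t) = 0 := by
    rw [mapTotalCochain_totalDiff, ht]; exact z.2
  obtain ⟨b, hb⟩ := exists_eq_nsmul p h
  refine ⟨⟨b, ?_⟩, t, ht, hb⟩
  apply nsmul_injective p
  rw [← map_nsmul, ← hb, totalDiff_totalDiff, smul_zero]

theorem connecting_unique {b b' : cocycles ℤ} {t t' : TotalCochain ℤ} {c : TotalCochain (ZMod p)}
    (h : mapTotalCochain (Int.castRingHom (ZMod p)) t - mapTotalCochain (Int.castRingHom (ZMod p)) t'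
      = totalDiff _ c)
    (hb : totalDiff ℤ t = (p : ℕ) • (b : TotalCochain ℤ))
    (hb' : totalDiff ℤ t' = (p : ℕ) • (b' : TotalCochain ℤ)) :
    toClass ℤ b = toClass ℤ b' := by
  obtain ⟨u, rfl⟩ := exists_lift p c
  obtain ⟨s, hs⟩ := exists_eq_nsmul p (t := t - t' - totalDiff ℤ u) (by
    rw [map_sub, map_sub, h, mapTotalCochain_totalDiff, sub_self])
  refine (Ideal.Quotient.eq (I := coboundaries ℤ)).2 ⟨s, nsmul_injective p ?_⟩
  rw [← map_nsmul, ← hs, map_sub, map_sub, totalDiff_totalDiff, hb, hb', sub_zero]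
  exact (smul_sub _ _ _).symm

end lemmas

/-- The connecting homomorphism `δ_p : H^*(𝔾ₐ, 𝔽_p) → H^{*+1}(𝔾ₐ, ℤ)` of the short exact sequence
`0 → C^•(𝔾ₐ, ℤ) → C^•(𝔾ₐ, ℤ) → C^•(𝔾ₐ, 𝔽_p) → 0` (multiplication by `p`, reduction): the class of a
cocycle `z` goes to the class of `b`, where `d t = p b` for a lift `t` of `z`. -/
noncomputable def connecting (p : Nat.Primes) : Cohomology (ZMod p) →+ Cohomology ℤ :=
  QuotientAddGroup.lift (coboundaries (ZMod p)).toAddSubgroup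
    (AddMonoidHom.mk' (fun z => toClass ℤ (exists_connecting p z).choose) (by
      intro x y
      obtain ⟨t, ht, hb⟩ := (exists_connecting p x).choose_spec
      obtain ⟨t', ht', hb'⟩ := (exists_connecting p y).choose_spec
      obtain ⟨u, hu, hc⟩ := (exists_connecting p (x + y)).choose_spec
      rw [← map_add]
      refine connecting_unique p (t := u) (t' := t + t') (c := 0) ?_ hc ?_
      · rw [hu, map_add, ht, ht', map_zero]; simp
      · rw [map_add, hb, hb']; simp))
    (by
      rintro z ⟨c, hc⟩
      obtain ⟨t, ht, hb⟩ := (exists_connecting p z).choose_spec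
      change toClass ℤ _ = 0
      rw [← map_zero (toClass ℤ)]
      refine connecting_unique p (t := t) (t' := 0) (c := c) ?_ hb ?_
      · rw [ht, map_zero, hc, sub_zero]
      · simp)

/-- The Bockstein `β_p : H^*(𝔾ₐ, 𝔽_p) → H^{*+1}(𝔾ₐ, 𝔽_p)`, the reduction modulo `p` of the
connecting homomorphism `δ_p`. -/
noncomputable def bockstein (p : Nat.Primes) : Cohomology (ZMod p) →+ Cohomology (ZMod p) :=
  (reduction p).toAddMonoidHom.comp (connecting p)

section lemmas

variable (p : Nat.Primes)

theorem connecting_eq {z : cocycles (ZMod p)} {b : cocycles ℤ} {t : TotalCochain ℤ}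
    (ht : mapTotalCochain (Int.castRingHom (ZMod p)) t = z)
    (hb : totalDiff ℤ t = (p : ℕ) • (b : TotalCochain ℤ)) :
    connecting p (toClass _ z) = toClass ℤ b := by
  obtain ⟨t', ht', hb'⟩ := (exists_connecting p z).choose_spec
  refine connecting_unique p (c := 0) ?_ hb' hb
  rw [ht, ht', map_zero, sub_self]

theorem reduction_mk (y : cocycles ℤ) :
    reduction p (toClass ℤ y) = toClass _ (mapCocycles (Int.castRingHom (ZMod p)) y) := rfl

theorem bockstein_mul_reduction (x : Cohomology (ZMod p)) (y : Cohomology ℤ) :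
    bockstein p x * reduction p y = bockstein p (x * reduction p y) := by
  obtain ⟨z, rfl⟩ := toClass_surjective x
  obtain ⟨y, rfl⟩ := toClass_surjective y
  obtain ⟨b, t, ht, hb⟩ := exists_connecting p z
  have hy : totalDiff ℤ y = 0 := y.2
  have h : connecting p (toClass _ z * reduction p (toClass ℤ y)) = toClass ℤ (b * y) := by
    rw [reduction_mk, ← map_mul]
    refine connecting_eq p (t := t * y) ?_ ?_
    · rw [map_mul, ht]; rfl
    · rw [totalDiff_mul, hy, hb, mul_zero, add_zero, smul_mul_assoc]; rfl
  have e : bockstein p (toClass _ z) = reduction p (toClass ℤ b) :=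
    congrArg (reduction p) (connecting_eq p ht hb)
  rw [e, ← map_mul, ← map_mul]
  exact (congrArg (reduction p) h).symm

theorem reduction_mul_bockstein (x : Cohomology (ZMod p)) (y : Cohomology ℤ) :
    ∃ x', reduction p y * bockstein p x = bockstein p x' := by
  obtain ⟨z, rfl⟩ := toClass_surjective x
  obtain ⟨y, rfl⟩ := toClass_surjective y
  obtain ⟨b, t, ht, hb⟩ := exists_connecting p z
  have hy : totalDiff ℤ y = 0 := y.2
  let w : cocycles ℤ := ⟨sgn ℤ y, by
    change totalDiff ℤ _ = 0
    rw [totalDiff_sgn, hy, map_zero, neg_zero]⟩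
  refine ⟨reduction p (toClass ℤ w) * toClass _ z, ?_⟩
  have h : connecting p (reduction p (toClass ℤ w) * toClass _ z) = toClass ℤ (y * b) := by
    rw [reduction_mk, ← map_mul]
    refine connecting_eq p (t := sgn ℤ y * t) ?_ ?_
    · rw [map_mul, ht]; rfl
    · rw [totalDiff_mul, totalDiff_sgn, hy, sgn_sgn, hb, map_zero, neg_zero, zero_mul, zero_add,
        mul_smul_comm]
      rfl
  have e : bockstein p (toClass _ z) = reduction p (toClass ℤ b) :=
    congrArg (reduction p) (connecting_eq p ht hb)
  rw [e, ← map_mul, ← map_mul]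
  exact (congrArg (reduction p) h).symm

end lemmas

/-- The image of the Bockstein, a non-unital subring of `H^*(𝔾ₐ, 𝔽_p)`. -/
noncomputable def imBockstein (p : Nat.Primes) : NonUnitalSubring (Cohomology (ZMod p)) where
  __ := (bockstein p).range
  mul_mem' := by
    rintro _ _ ⟨x, rfl⟩ ⟨y, rfl⟩
    exact ⟨_, (bockstein_mul_reduction p x (connecting p y)).symm⟩

theorem mem_imBockstein {p : Nat.Primes} {y : Cohomology (ZMod p)} :
    y ∈ imBockstein p ↔ ∃ x, bockstein p x = y := Iff.rfl

/-! ### The classes `v₁` and `v₂` -/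

/-- The class `v₁ ∈ H¹(𝔾ₐ, ℤ)` of the coordinate function `x` on `𝔾ₐ`. -/
noncomputable def v₁ : Cohomology ℤ :=
  toClass ℤ ⟨DirectSum.of (Cochain ℤ) 1 (MvPolynomial.X 0), by
    change totalDiff ℤ _ = 0
    rw [totalDiff_of, diff_apply]
    simp [Finset.sum_range_succ, coface, face]⟩

/-- The cochain `Φ₂ / 2 ∈ ℤ[y, z]` with `Φ₂ = d (x²) = y² - (y + z)² + z²`. -/
noncomputable def halfPhi₂ : TotalCochain ℤ :=
  DirectSum.of (Cochain ℤ) 2 (-(MvPolynomial.X 0 * MvPolynomial.X 1))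

theorem totalDiff_sq : totalDiff ℤ (DirectSum.of (Cochain ℤ) 1 (MvPolynomial.X 0 ^ 2)) =
    2 • halfPhi₂ := by
  rw [totalDiff_of, halfPhi₂, ← map_nsmul, diff_apply]
  congr 1
  simp [Finset.sum_range_succ, coface, face]
  ring

/-- The class `v₂ = [Φ₂ / 2] ∈ H²(𝔾ₐ, ℤ)`, where `Φ₂ = d (x²)`. -/
noncomputable def v₂ : Cohomology ℤ :=
  toClass ℤ ⟨halfPhi₂, nsmul_injective ⟨2, Nat.prime_two⟩ (by
    change 2 • totalDiff ℤ halfPhi₂ = 2 • 0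
    rw [← map_nsmul, ← totalDiff_sq, totalDiff_totalDiff, smul_zero])⟩

/-- The prime `2`. -/
def primeTwo : Nat.Primes := ⟨2, Nat.prime_two⟩

theorem reduction_v₂_mem :
    reduction primeTwo v₂ ∈ imBockstein primeTwo := by
  let p := primeTwo
  let t : TotalCochain ℤ := DirectSum.of (Cochain ℤ) 1 (MvPolynomial.X 0 ^ 2)
  let z : cocycles (ZMod p) := ⟨mapTotalCochain (Int.castRingHom (ZMod p)) t, by
    change totalDiff _ _ = 0
    rw [← mapTotalCochain_totalDiff, totalDiff_sq]
    exact map_nsmul_eq_zero p halfPhi₂⟩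
  refine ⟨toClass _ z, ?_⟩
  exact congrArg (reduction p) (connecting_eq p (z := z) (t := t) rfl totalDiff_sq)

/-! ### The right hand side -/

/-- The subring of integral polynomials in `w₁ = v̄₁` acts on `Im β_p` from the left. -/
theorem aeval_mul_mem {p : Nat.Primes} (f : Polynomial ℤ) {b : Cohomology (ZMod p)}
    (hb : b ∈ imBockstein p) : Polynomial.aeval (reduction p v₁) f * b ∈ imBockstein p := by
  obtain ⟨x, rfl⟩ := hb
  have : Polynomial.aeval (reduction p v₁) f = reduction p (Polynomial.aeval v₁ f) :=
    Polynomial.aeval_algHom_apply (reduction p).toIntAlgHom v₁ f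
  obtain ⟨x', hx'⟩ := reduction_mul_bockstein p x (Polynomial.aeval v₁ f)
  exact ⟨x', by rw [this]; exact hx'.symm⟩

/-- The subring of integral polynomials in `w₁ = v̄₁` acts on `Im β_p` from the right. -/
theorem mul_aeval_mem {p : Nat.Primes} (f : Polynomial ℤ) {b : Cohomology (ZMod p)}
    (hb : b ∈ imBockstein p) : b * Polynomial.aeval (reduction p v₁) f ∈ imBockstein p := by
  obtain ⟨x, rfl⟩ := hb
  have : Polynomial.aeval (reduction p v₁) f = reduction p (Polynomial.aeval v₁ f) :=
    Polynomial.aeval_algHom_apply (reduction p).toIntAlgHom v₁ f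
  exact ⟨_, by rw [this]; exact (bockstein_mul_reduction p x _).symm⟩

noncomputable instance (p : Nat.Primes) : NonUnitalRing (imBockstein p) :=
  NonUnitalSubringClass.toNonUnitalRing (imBockstein p)

noncomputable instance (p : Nat.Primes) : AddCommGroup (imBockstein p) :=
  NonUnitalNonAssocRing.toAddCommGroup

noncomputable instance (p : Nat.Primes) : AddCommMonoid (imBockstein p) :=
  AddCommGroup.toAddCommMonoid

/-- The abelian group `ℤ[v₁] ⊕ ⨁_p Im β_p`. -/
def PreRing : Type := Polynomial ℤ × ⨁ p : Nat.Primes, imBockstein p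

noncomputable instance : AddCommGroup PreRing :=
  Prod.instAddCommGroup

/-- The multiplication of `ℤ[v₁] ⊕ ⨁_p Im β_p`:
`(f, a) (g, b) = (f g, f(w₁) b + a g(w₁) + a b)`, where in the component at `p` the product is that
of `H^*(𝔾ₐ, 𝔽_p)` and `w₁ = v̄₁` is the reduction of `v₁`. -/
noncomputable instance : Mul PreRing where
  mul x y :=
    (x.1 * y.1,
      DFinsupp.mapRange
        (fun p (b : imBockstein p) =>
          (⟨Polynomial.aeval (reduction p v₁) x.1 * b, aeval_mul_mem x.1 b.2⟩ : imBockstein p))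
        (fun _ => Subtype.ext (mul_zero _)) y.2 +
      DFinsupp.mapRange
        (fun p (a : imBockstein p) =>
          (⟨a * Polynomial.aeval (reduction p v₁) y.1, mul_aeval_mem y.1 a.2⟩ : imBockstein p))
        (fun _ => Subtype.ext (zero_mul _)) x.2 +
      DFinsupp.zipWith (fun p (a b : imBockstein p) => a * b) (fun _ => mul_zero _) x.2 y.2)

noncomputable instance : One PreRing where
  one := ((1 : Polynomial ℤ), 0)

namespace PreRing

theorem ext_components {x y : PreRing} (h1 : x.1 = y.1)
    (h2 : ∀ p : Nat.Primes, (x.2 p : Cohomology (ZMod p)) = y.2 p) : x = y :=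
  Prod.ext h1 (DFinsupp.ext fun p => Subtype.ext (h2 p))

theorem add_fst (x y : PreRing) : (x + y).1 = x.1 + y.1 := rfl
theorem add_snd (x y : PreRing) (p : Nat.Primes) :
    ((x + y).2 p : Cohomology (ZMod p)) = x.2 p + y.2 p := rfl
theorem zero_fst : (0 : PreRing).1 = 0 := rfl
theorem zero_snd (p : Nat.Primes) : ((0 : PreRing).2 p : Cohomology (ZMod p)) = 0 := rfl
theorem one_fst : (1 : PreRing).1 = 1 := rfl
theorem one_snd (p : Nat.Primes) : ((1 : PreRing).2 p : Cohomology (ZMod p)) = 0 := rfl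
theorem mul_fst (x y : PreRing) : (x * y).1 = x.1 * y.1 := rfl
theorem mul_snd (x y : PreRing) (p : Nat.Primes) :
    ((x * y).2 p : Cohomology (ZMod p)) =
      Polynomial.aeval (reduction p v₁) x.1 * y.2 p +
        x.2 p * Polynomial.aeval (reduction p v₁) y.1 + x.2 p * y.2 p := rfl

end PreRing

open PreRing in
noncomputable instance : Ring PreRing where
  __ := (inferInstance : AddCommGroup PreRing)
  left_distrib x y z := by
    apply ext_components
    · simp only [add_fst, mul_fst, mul_add]
    · intro p; simp only [add_fst, add_snd, mul_snd, mul_add, map_add]; abel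
  right_distrib x y z := by
    apply ext_components
    · simp only [add_fst, mul_fst, add_mul]
    · intro p; simp only [add_fst, add_snd, mul_snd, add_mul, map_add]; abel
  zero_mul x := by
    apply ext_components
    · simp only [zero_fst, mul_fst, zero_mul]
    · intro p; simp only [zero_fst, zero_snd, mul_snd, map_zero, zero_mul, add_zero]
  mul_zero x := by
    apply ext_components
    · simp only [zero_fst, mul_fst, mul_zero]
    · intro p; simp only [zero_fst, zero_snd, mul_snd, map_zero, mul_zero, add_zero]
  mul_assoc x y z := by
    apply ext_components
    · simp only [mul_fst, mul_assoc]
    · intro p; simp only [mul_fst, mul_snd, mul_add, add_mul, map_mul, mul_assoc]; abel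
  one_mul x := by
    apply ext_components
    · simp only [one_fst, mul_fst, one_mul]
    · intro p; simp only [one_fst, one_snd, mul_snd, map_one, one_mul, zero_mul, add_zero]
  mul_one x := by
    apply ext_components
    · simp only [one_fst, mul_fst, mul_one]
    · intro p; simp only [one_fst, one_snd, mul_snd, map_one, mul_one, mul_zero, add_zero, zero_add]
  neg_add_cancel := neg_add_cancel
  zsmul := fun n x => n • x

/-- The generator `v₁` of `ℤ[v₁] ⊕ ⨁_p Im β_p`. -/
noncomputable def PreRing.genV₁ : PreRing := (Polynomial.X, 0)

/-- The inclusion of `Im β_p` into `ℤ[v₁] ⊕ ⨁_p Im β_p`. -/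
noncomputable def PreRing.ofImBockstein (p : Nat.Primes) (b : imBockstein p) : PreRing :=
  (0, DirectSum.of (fun p : Nat.Primes => imBockstein p) p b)

/-- The degree `n` part of `ℤ[v₁] ⊕ ⨁_p Im β_p`, where `v₁` has degree `1` and `Im β_p` is graded as
a subgroup of `H^*(𝔾ₐ, 𝔽_p)`. -/
noncomputable def PreRing.degree (n : ℕ) : AddSubgroup PreRing where
  carrier := {x | (∃ c : ℤ, x.1 = Polynomial.monomial n c) ∧
    ∀ p : Nat.Primes, (x.2 p : Cohomology (ZMod p)) ∈ cohomologyDegree (ZMod p) n}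
  add_mem' := by
    rintro x y ⟨⟨c, hc⟩, hx⟩ ⟨⟨d, hd⟩, hy⟩
    exact ⟨⟨c + d, by rw [PreRing.add_fst, hc, hd, map_add]⟩, fun p => add_mem (hx p) (hy p)⟩
  zero_mem' := ⟨⟨0, (map_zero _).symm⟩, fun p => zero_mem _⟩
  neg_mem' := by
    rintro x ⟨⟨c, hc⟩, hx⟩
    exact ⟨⟨-c, by rw [map_neg, ← hc]; rfl⟩, fun p => neg_mem (hx p)⟩

/-- The element `v₂` of `ℤ[v₁] ⊕ ⨁_p Im β_p`, lying in `Im β₂`: the reduction of `v₂` modulo `2`. -/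
noncomputable def PreRing.genV₂ : PreRing :=
  PreRing.ofImBockstein primeTwo ⟨reduction primeTwo v₂, reduction_v₂_mem⟩

/-- The relation `v₁² = v₂`. -/
def PreRing.Rel (x y : PreRing) : Prop :=
  x = PreRing.genV₁ ^ 2 ∧ y = PreRing.genV₂

/-- The graded ring `(ℤ[v₁] ⊕ ⨁_p Im β_p) / (v₁² = v₂)`. -/
abbrev Target : Type := RingQuot PreRing.Rel

/-- The quotient map `ℤ[v₁] ⊕ ⨁_p Im β_p → (ℤ[v₁] ⊕ ⨁_p Im β_p) / (v₁² = v₂)`. -/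
noncomputable abbrev Target.mk : PreRing →+* Target := RingQuot.mkRingHom PreRing.Rel

/-- The degree `n` part of `(ℤ[v₁] ⊕ ⨁_p Im β_p) / (v₁² = v₂)`. -/
noncomputable def Target.degree (n : ℕ) : AddSubgroup Target :=
  (PreRing.degree n).map Target.mk.toAddMonoidHom

end BGa

/-! The heart of the matter is that cocycles of degree at least 2 are torsion of a very mild kind:
for every prime `p` such a class is killed by `M * p` for some integer `M` prime to `p`. Granting
this, the cohomology is ℤ in degree 0, ℤ·v₁ in degree 1, and torsion with elementary `p`-primary
parts above. The rest is the Bockstein sequence.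

To prove the torsion bound, the functions on 𝔾ₐ are viewed as a module over the divided power
algebra, γ_m acting by the divided derivative ∂₀^m / m!. Put t_k = γ_{p^k}. These commute and
satisfy t_k^p = c_k t_{k+1} with c_k = p u_k and u_k prime to p (`exists_primeCoeff_eq`). For such
relations there is a Tate complex with exterior generators λ_k for the t_k, polynomial generators
F_k for the relations, and dual differential D = ∑ t_k λ_k + ∑ F_k (t_k^{p-1} ι_k - c_k ι_{k+1}),
ι_k being contraction (`tateDiff_mul_self`). With coefficients in 𝒪(𝔾ₐ^{n+1}) it resolves the
functions independent of the first variable x₀, up to integers prime to `p`: modulo `p` the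
constants c_k vanish and the complex can be contracted one base-`p` digit of the exponent of x₀ at a
time (`exists_eq_resDiff_add_modP`). In a fixed weight everything is finitely generated, so Nakayama
lifts this to ℤ (`exists_smul_eq_resDiff_add`).

D commutes with the shifted coboundary, which omits the zeroth coface and is contractible onto the
constants. The double complex therefore compares the standard complex, via the rows of D, with the
complex of constant families, on which all t_k vanish and D becomes -p δ, where δ = ∑ u_k F_k
ι_{k+1}. Up to integers prime to `p`, δ is a Koszul differential whose cohomology is spanned by 1
and λ₀, of weights 0 and 1 (`exists_smul_eq_constDiff`). In weight at least 2, p δ κ = 0 thus gives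
δ κ = 0, then M κ = δ σ, and M p κ is a boundary. The zigzag `exists_smul_eq_resDiff_add_augment`
transports this to 𝔾ₐ. Weights 0 and 1 are treated by hand.

For the ring structure, elementary torsion makes reduction modulo `p` injective on the classes
killed by `p`, with image Im β_p (`eq_of_reduction_eq`), and a torsion class is determined by all
its reductions (`eq_zero_of_reduction`). Multiplicativity of the comparison map can hence be checked
modulo each prime. The relation v₁² = v₂ leaves the normal form a + b v₁ + torsion on both sides.

Finally the classes of d(x^{p^r}) / p for r ≥ 1 are pairwise distinct and killed by `p`, because the
only additive integral polynomials in one variable are the multiples of x. -/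

namespace BGa

/-! ### The operators of the Tate resolution -/

/-- The index set of the monomial basis of `Λ[λ₀, λ₁, …] ⊗ ℤ[F₀, F₁, …]`. -/
abbrev TateIndex : Type := Finset ℕ × (ℕ →₀ ℕ)

namespace Tate

section operators

variable {P P' : Type*} [AddCommGroup P] [AddCommGroup P']

/-- An additive map, applied to coefficients. -/
def mapCoeff (g : P →+ P') : (TateIndex → P) →+ (TateIndex → P') where
  toFun m j := g (m j)
  map_zero' := by ext; simp
  map_add' _ _ := by ext; simp

@[simp]
theorem mapCoeff_apply (g : P →+ P') (m : TateIndex → P) (j : TateIndex) :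
    mapCoeff g m j = g (m j) := rfl

/-- An endomorphism of the coefficients, as an operator on coefficient families. -/
def coeffOp : Module.End ℤ P →+* Module.End ℤ (TateIndex → P) where
  toFun t := t.compLeft TateIndex
  map_one' := rfl
  map_mul' _ _ := rfl
  map_zero' := rfl
  map_add' _ _ := rfl

@[simp]
theorem coeffOp_apply (t : Module.End ℤ P) (m : TateIndex → P) (j : TateIndex) :
    coeffOp t m j = t (m j) := rfl

/-- The Koszul sign of the position `k` in `I`. -/
def sign (k : ℕ) (I : Finset ℕ) : ℤ := (-1) ^ (I.filter (· < k)).card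

theorem sign_mul_self (k : ℕ) (I : Finset ℕ) : sign k I * sign k I = 1 := by
  rw [sign, ← mul_pow]; simp

theorem sign_symmDiff_of_le {k l : ℕ} (h : k ≤ l) (I : Finset ℕ) :
    sign k (symmDiff I {l}) = sign k I := by
  have : (symmDiff I {l}).filter (· < k) = I.filter (· < k) := by
    ext x
    simp only [Finset.mem_filter, Finset.mem_symmDiff, Finset.mem_singleton]
    grind
  rw [sign, this, sign]

/-- The sign counts elements strictly below its position, so toggling a smaller index changes the
count by one. This asymmetry produces the anticommutation of the toggles. -/
theorem sign_symmDiff_of_lt {k l : ℕ} (h : k < l) (I : Finset ℕ) :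
    sign l (symmDiff I {k}) = -sign l I := by
  by_cases hk : k ∈ I
  · have : I.filter (· < l) = insert k ((symmDiff I {k}).filter (· < l)) := by
      ext x
      simp only [Finset.mem_filter, Finset.mem_symmDiff, Finset.mem_singleton, Finset.mem_insert]
      grind
    rw [sign, sign, this, Finset.card_insert_of_notMem, pow_succ]
    · simp
    · simp [Finset.mem_symmDiff, hk]
  · have : (symmDiff I {k}).filter (· < l) = insert k (I.filter (· < l)) := by
      ext x
      simp only [Finset.mem_filter, Finset.mem_symmDiff, Finset.mem_singleton, Finset.mem_insert]
      grind
    rw [sign, sign, this, Finset.card_insert_of_notMem, pow_succ]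
    · simp
    · simp [hk]

/-- The signed operator toggling the `k`-th exterior generator. -/
def toggle (k : ℕ) : Module.End ℤ (TateIndex → P) where
  toFun m j := sign k j.1 • m (symmDiff j.1 {k}, j.2)
  map_add' _ _ := by ext; simp
  map_smul' c m := by ext j; exact smul_comm (sign k j.1) c (m _)

/-- The projection onto the monomials divisible by the `k`-th exterior generator. -/
def occupied (k : ℕ) : Module.End ℤ (TateIndex → P) where
  toFun m j := if k ∈ j.1 then m j else 0
  map_add' _ _ := by ext; simp; split_ifs <;> simp
  map_smul' _ _ := by ext; simp

theorem toggle_apply (k : ℕ) (m : TateIndex → P) (j : TateIndex) :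
    (toggle k : Module.End ℤ (TateIndex → P)) m j = sign k j.1 • m (symmDiff j.1 {k}, j.2) := rfl

theorem occupied_apply (k : ℕ) (m : TateIndex → P) (j : TateIndex) :
    (occupied k : Module.End ℤ (TateIndex → P)) m j = if k ∈ j.1 then m j else 0 := rfl

theorem toggle_mul_self (k : ℕ) : toggle k * toggle k = (1 : Module.End ℤ (TateIndex → P)) := by
  ext m j
  simp only [Module.End.mul_apply, toggle_apply, sign_symmDiff_of_le le_rfl, smul_smul,
    sign_mul_self, one_smul, symmDiff_symmDiff_cancel_right, Module.End.one_apply]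

/-- The toggles are Clifford generators: the smaller index flips the sign attached to the larger one
and not conversely. Both λ_k and ι_k are cut out of them by projections, so their relations follow
from this one. -/
theorem toggle_mul_toggle {k l : ℕ} (h : k ≠ l) :
    toggle k * toggle l = -(toggle l * toggle k : Module.End ℤ (TateIndex → P)) := by
  ext m j
  simp only [Module.End.mul_apply, toggle_apply, smul_smul, LinearMap.neg_apply, Pi.neg_apply,
    symmDiff_right_comm j.1 {k} {l}]
  rcases lt_or_gt_of_ne h with h | h
  · rw [sign_symmDiff_of_lt h, sign_symmDiff_of_le h.le, ← neg_smul]; congr 1; ring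
  · rw [sign_symmDiff_of_lt h, sign_symmDiff_of_le h.le, ← neg_smul]; congr 1; ring

theorem toggle_mul_occupied_self (k : ℕ) :
    toggle k * occupied k = ((1 - occupied k) * toggle k : Module.End ℤ (TateIndex → P)) := by
  ext m j
  simp only [Module.End.mul_apply, toggle_apply, occupied_apply, LinearMap.sub_apply,
    Module.End.one_apply, Pi.sub_apply]
  by_cases h : k ∈ j.1 <;> simp [h, Finset.mem_symmDiff]

theorem toggle_mul_one_sub_occupied (k : ℕ) :
    toggle k * (1 - occupied k) = (occupied k * toggle k : Module.End ℤ (TateIndex → P)) := by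
  rw [mul_sub, mul_one, toggle_mul_occupied_self, sub_mul, one_mul, sub_sub_cancel]

theorem toggle_mul_occupied {k l : ℕ} (h : k ≠ l) :
    toggle k * occupied l = (occupied l * toggle k : Module.End ℤ (TateIndex → P)) := by
  ext m j
  simp only [Module.End.mul_apply, toggle_apply, occupied_apply]
  by_cases hl : l ∈ j.1 <;> simp [hl, Finset.mem_symmDiff, h.symm]

theorem occupied_mul_self (k : ℕ) :
    occupied k * occupied k = (occupied k : Module.End ℤ (TateIndex → P)) := by
  ext m j
  simp only [Module.End.mul_apply, occupied_apply]
  split_ifs <;> rfl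

theorem occupied_comm (k l : ℕ) :
    occupied k * occupied l = (occupied l * occupied k : Module.End ℤ (TateIndex → P)) := by
  ext m j
  simp only [Module.End.mul_apply, occupied_apply]
  split_ifs <;> rfl

/-- Exterior multiplication by the `k`-th generator `λ_k`. -/
def lam (k : ℕ) : Module.End ℤ (TateIndex → P) := occupied k * toggle k

/-- Contraction with the `k`-th generator `λ_k`. -/
def iota (k : ℕ) : Module.End ℤ (TateIndex → P) := (1 - occupied k) * toggle k

theorem lam_mul_self (k : ℕ) : lam k * lam k = (0 : Module.End ℤ (TateIndex → P)) := by
  rw [lam, mul_assoc, ← mul_assoc (toggle k), toggle_mul_occupied_self, mul_assoc, toggle_mul_self,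
    mul_one, mul_sub, mul_one, occupied_mul_self, sub_self]

theorem iota_mul_self (k : ℕ) : iota k * iota k = (0 : Module.End ℤ (TateIndex → P)) := by
  rw [iota, mul_assoc, ← mul_assoc (toggle k), toggle_mul_one_sub_occupied, mul_assoc,
    toggle_mul_self, mul_one, sub_mul, one_mul, occupied_mul_self, sub_self]

theorem iota_mul_lam_self (k : ℕ) :
    iota k * lam k = (1 - occupied k : Module.End ℤ (TateIndex → P)) := by
  rw [iota, lam, mul_assoc, ← mul_assoc (toggle k), toggle_mul_occupied_self, mul_assoc,
    toggle_mul_self, mul_one, sub_mul, one_mul, mul_sub, mul_one, occupied_mul_self, sub_self,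
    sub_zero]

theorem lam_mul_iota_self (k : ℕ) :
    lam k * iota k = (occupied k : Module.End ℤ (TateIndex → P)) := by
  rw [iota, lam, mul_assoc, ← mul_assoc (toggle k), toggle_mul_one_sub_occupied, mul_assoc,
    toggle_mul_self, mul_one, occupied_mul_self]

theorem lam_mul_lam {k l : ℕ} (h : k ≠ l) :
    lam k * lam l = -(lam l * lam k : Module.End ℤ (TateIndex → P)) := by
  rw [lam, lam, mul_assoc, ← mul_assoc (toggle k), toggle_mul_occupied h, mul_assoc (occupied l),
    toggle_mul_toggle h, mul_assoc (occupied l), ← mul_assoc (toggle l), toggle_mul_occupied h.symm,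
    ← mul_assoc, occupied_comm, mul_neg, mul_assoc, mul_assoc]

theorem iota_mul_lam {k l : ℕ} (h : k ≠ l) :
    iota k * lam l = -(lam l * iota k : Module.End ℤ (TateIndex → P)) := by
  have h1 := toggle_mul_occupied (P := P) h
  have h2 := toggle_mul_occupied (P := P) h.symm
  rw [lam, iota]
  calc (1 - occupied k : Module.End ℤ (TateIndex → P)) * toggle k * (occupied l * toggle l)
      = (1 - occupied k) * (toggle k * occupied l) * toggle l := by noncomm_ring
    _ = (1 - occupied k) * occupied l * (toggle k * toggle l) := by rw [h1]; noncomm_ring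
    _ = -((occupied l - occupied k * occupied l) * (toggle l * toggle k)) := by
        rw [toggle_mul_toggle h]; noncomm_ring
    _ = -(occupied l * (toggle l - occupied k * toggle l) * toggle k) := by
        rw [occupied_comm]; noncomm_ring
    _ = -(occupied l * toggle l * ((1 - occupied k) * toggle k)) := by
        rw [← h2]; noncomm_ring

/-- Since ι = toggle - λ, expanding reduces the relation to those already known for two toggles, two
λ's, and one of each. -/
theorem iota_mul_iota {k l : ℕ} (h : k ≠ l) :
    iota k * iota l = -(iota l * iota k : Module.End ℤ (TateIndex → P)) := by
  have e : ∀ i, (iota i : Module.End ℤ (TateIndex → P)) = toggle i - lam i := fun i => by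
    rw [iota, lam, sub_mul, one_mul]
  have h1 : toggle k * toggle l = -(toggle l * toggle k : Module.End ℤ (TateIndex → P)) :=
    toggle_mul_toggle h
  have h2 := iota_mul_lam (P := P) h
  have h3 := iota_mul_lam (P := P) h.symm
  rw [e, e] at *
  have h4 := lam_mul_lam (P := P) h
  rw [sub_mul, mul_sub] at h2 h3
  rw [sub_mul, mul_sub, mul_sub, sub_mul, mul_sub, mul_sub, h1]
  have h2' := eq_add_of_sub_eq h2
  have h3' := eq_add_of_sub_eq h3
  rw [h2', h3', h4]
  noncomm_ring

/-- Multiplication by the `k`-th polynomial generator `F_k`. -/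
noncomputable def raise (k : ℕ) : Module.End ℤ (TateIndex → P) where
  toFun m j := if j.2 k = 0 then 0 else m (j.1, j.2 - Finsupp.single k 1)
  map_add' _ _ := by ext; simp; split_ifs <;> simp
  map_smul' _ _ := by ext; simp

/-- Division by the `k`-th polynomial generator `F_k`. -/
noncomputable def lower (k : ℕ) : Module.End ℤ (TateIndex → P) where
  toFun m j := m (j.1, j.2 + Finsupp.single k 1)
  map_add' _ _ := rfl
  map_smul' _ _ := rfl

/-- The projection onto the monomials not divisible by `F_k`. -/
def vacant (k : ℕ) : Module.End ℤ (TateIndex → P) where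
  toFun m j := if j.2 k = 0 then m j else 0
  map_add' _ _ := by ext; simp; split_ifs <;> simp
  map_smul' _ _ := by ext; simp

theorem raise_apply (k : ℕ) (m : TateIndex → P) (j : TateIndex) :
    (raise k : Module.End ℤ (TateIndex → P)) m j = if j.2 k = 0 then 0 else m (j.1, j.2 - Finsupp.single k 1) := rfl

theorem lower_apply (k : ℕ) (m : TateIndex → P) (j : TateIndex) :
    (lower k : Module.End ℤ (TateIndex → P)) m j = m (j.1, j.2 + Finsupp.single k 1) := rfl

theorem vacant_apply (k : ℕ) (m : TateIndex → P) (j : TateIndex) :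
    (vacant k : Module.End ℤ (TateIndex → P)) m j = if j.2 k = 0 then m j else 0 := rfl

theorem lower_mul_raise (k : ℕ) : lower k * raise k = (1 : Module.End ℤ (TateIndex → P)) := by
  ext m j
  simp [lower_apply, raise_apply]

/-- F_k is injective but not surjective; the defect of the composite is the projection onto
monomials without F_k, and this is what the contractions below leave behind. -/
theorem raise_mul_lower (k : ℕ) :
    raise k * lower k = (1 - vacant k : Module.End ℤ (TateIndex → P)) := by
  ext m j
  simp only [Module.End.mul_apply, lower_apply, raise_apply, LinearMap.sub_apply,
    Module.End.one_apply, Pi.sub_apply, vacant_apply]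
  split_ifs with h
  · simp
  · rw [tsub_add_cancel_of_le, sub_zero]
    rw [Finsupp.single_le_iff]; omega

theorem raise_comm (k l : ℕ) :
    raise k * raise l = (raise l * raise k : Module.End ℤ (TateIndex → P)) := by
  ext m j
  rcases eq_or_ne k l with rfl | h
  · rfl
  simp only [Module.End.mul_apply, raise_apply, Finsupp.tsub_apply, Finsupp.single_eq_of_ne h,
    Finsupp.single_eq_of_ne h.symm, tsub_zero, tsub_right_comm (b := Finsupp.single k 1)]
  split_ifs <;> rfl

theorem raise_mul_lower_of_ne {k l : ℕ} (h : k ≠ l) :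
    raise k * lower l = (lower l * raise k : Module.End ℤ (TateIndex → P)) := by
  ext m j
  simp only [Module.End.mul_apply, raise_apply, lower_apply, Finsupp.add_apply,
    Finsupp.single_eq_of_ne h, add_zero]
  split_ifs with h0
  · rfl
  · rw [tsub_add_eq_add_tsub]
    rw [Finsupp.single_le_iff]; omega

end operators

end Tate

end BGa

namespace BGa

/-! ### Anticommutators -/

/-- The anticommutator in a ring. -/
def anticomm {R : Type*} [Ring R] : R →+ R →+ R := AddMonoidHom.mul + AddMonoidHom.mul.flip

section anticomm

variable {R : Type*} [Ring R]

theorem anticomm_apply (x y : R) : anticomm x y = x * y + y * x := rfl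

theorem anticomm_symm (x y : R) : anticomm x y = anticomm y x := add_comm _ _

theorem anticomm_mul_left {A x y : R} (h : Commute A y) : anticomm (A * x) y = A * anticomm x y := by
  rw [anticomm_apply, anticomm_apply, mul_add, mul_assoc, ← mul_assoc y, ← h.eq, mul_assoc]

theorem anticomm_mul_right {B x y : R} (h : Commute B x) : anticomm x (B * y) = B * anticomm x y := by
  rw [anticomm_symm, anticomm_mul_left h, anticomm_symm]

/-- Vanishing of the squares is a separate hypothesis because the anticommutator of an element with
itself only controls twice its square. -/
theorem sum_mul_sum_eq_zero (s : Finset ℕ) (a : ℕ → R) (h : ∀ i ∈ s, a i * a i = 0)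
    (h' : ∀ i j, i ≠ j → anticomm (a i) (a j) = 0) : (∑ i ∈ s, a i) * ∑ i ∈ s, a i = 0 := by
  induction s using Finset.induction_on with
  | empty => simp
  | insert i s hi ih =>
    have e : anticomm (a i) (∑ j ∈ s, a j) = 0 := by
      rw [map_sum]
      exact Finset.sum_eq_zero fun j hj => h' i j fun hij => hi (hij ▸ hj)
    rw [anticomm_apply] at e
    have e1 := h i (Finset.mem_insert_self _ _)
    have e2 := ih fun j hj => h j (Finset.mem_insert_of_mem hj)
    rw [Finset.sum_insert hi, add_mul, mul_add, mul_add, e1, e2, zero_add, add_zero, e]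

end anticomm

namespace Tate

/-! ### Commutation of the coefficient, exterior and polynomial operators -/

section commute

variable {P : Type*} [AddCommGroup P]

theorem commute_coeffOp_toggle (t : Module.End ℤ P) (k : ℕ) : Commute (coeffOp t) (toggle k) := by
  ext m j
  simp [toggle_apply]

theorem commute_coeffOp_occupied (t : Module.End ℤ P) (k : ℕ) :
    Commute (coeffOp t) (occupied k) := by
  ext m j
  simp only [Module.End.mul_apply, occupied_apply, coeffOp_apply]
  split_ifs <;> simp

theorem commute_coeffOp_lam (t : Module.End ℤ P) (k : ℕ) : Commute (coeffOp t) (lam k) :=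
  (commute_coeffOp_occupied t k).mul_right (commute_coeffOp_toggle t k)

theorem commute_coeffOp_iota (t : Module.End ℤ P) (k : ℕ) : Commute (coeffOp t) (iota k) :=
  ((Commute.one_right _).sub_right (commute_coeffOp_occupied t k)).mul_right
    (commute_coeffOp_toggle t k)

theorem commute_coeffOp_raise (t : Module.End ℤ P) (k : ℕ) : Commute (coeffOp t) (raise k) := by
  ext m j
  simp only [Module.End.mul_apply, raise_apply, coeffOp_apply]
  split_ifs <;> simp

theorem commute_coeffOp_lower (t : Module.End ℤ P) (k : ℕ) : Commute (coeffOp t) (lower k) := rfl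

theorem commute_raise_toggle (k l : ℕ) :
    Commute (raise k : Module.End ℤ (TateIndex → P)) (toggle l) := by
  ext m j
  simp only [Module.End.mul_apply, raise_apply, toggle_apply]
  split_ifs <;> simp

theorem commute_raise_occupied (k l : ℕ) :
    Commute (raise k : Module.End ℤ (TateIndex → P)) (occupied l) := by
  ext m j
  simp only [Module.End.mul_apply, raise_apply, occupied_apply]
  split_ifs <;> simp

theorem commute_lower_toggle (k l : ℕ) :
    Commute (lower k : Module.End ℤ (TateIndex → P)) (toggle l) := rfl

theorem commute_lower_occupied (k l : ℕ) :
    Commute (lower k : Module.End ℤ (TateIndex → P)) (occupied l) := rfl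

theorem commute_raise_lam (k l : ℕ) :
    Commute (raise k : Module.End ℤ (TateIndex → P)) (lam l) :=
  (commute_raise_occupied k l).mul_right (commute_raise_toggle k l)

theorem commute_raise_iota (k l : ℕ) :
    Commute (raise k : Module.End ℤ (TateIndex → P)) (iota l) :=
  ((Commute.one_right _).sub_right (commute_raise_occupied k l)).mul_right
    (commute_raise_toggle k l)

theorem commute_lower_lam (k l : ℕ) :
    Commute (lower k : Module.End ℤ (TateIndex → P)) (lam l) :=
  (commute_lower_occupied k l).mul_right (commute_lower_toggle k l)

theorem commute_lower_iota (k l : ℕ) :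
    Commute (lower k : Module.End ℤ (TateIndex → P)) (iota l) :=
  ((Commute.one_right _).sub_right (commute_lower_occupied k l)).mul_right
    (commute_lower_toggle k l)

theorem anticomm_lam_lam (k l : ℕ) :
    anticomm (lam k : Module.End ℤ (TateIndex → P)) (lam l) = 0 := by
  rcases eq_or_ne k l with rfl | h
  · rw [anticomm_apply, lam_mul_self, add_zero]
  · rw [anticomm_apply, lam_mul_lam h, neg_add_cancel]

theorem anticomm_iota_iota (k l : ℕ) :
    anticomm (iota k : Module.End ℤ (TateIndex → P)) (iota l) = 0 := by
  rcases eq_or_ne k l with rfl | h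
  · rw [anticomm_apply, iota_mul_self, add_zero]
  · rw [anticomm_apply, iota_mul_iota h, neg_add_cancel]

theorem anticomm_iota_lam (k l : ℕ) :
    anticomm (iota k : Module.End ℤ (TateIndex → P)) (lam l) = if k = l then 1 else 0 := by
  split_ifs with h
  · rw [h, anticomm_apply, iota_mul_lam_self, lam_mul_iota_self, sub_add_cancel]
  · rw [anticomm_apply, iota_mul_lam h, neg_add_cancel]

end commute

/-! ### The Tate differential squares to zero -/

section differential

variable {P : Type*} [AddCommGroup P] (t : ℕ → Module.End ℤ P) (e : ℕ) (c : ℕ → ℤ) (N : ℕ)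

/-- The Koszul part of the Tate differential. -/
def koszulTerm (k : ℕ) : Module.End ℤ (TateIndex → P) := coeffOp (t k) * lam k

/-- The part of the Tate differential involving the polynomial generators. -/
noncomputable def tateTerm (k : ℕ) : Module.End ℤ (TateIndex → P) :=
  raise k * (coeffOp (t k ^ e) * iota k - c k • iota (k + 1))

/-- The differential of the (dual) Tate resolution for the relations `t_k ^ (e + 1) = c_k t_{k+1}`
between commuting operators `t₀, t₁, …, t_N`. -/
noncomputable def tateDiff : Module.End ℤ (TateIndex → P) :=
  ∑ k ∈ Finset.range (N + 1), koszulTerm t k + ∑ k ∈ Finset.range N, tateTerm t e c k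

variable {t e c N}

theorem anticomm_coeffOp_mul (a b : Module.End ℤ P) (hab : Commute a b)
    (x y : Module.End ℤ (TateIndex → P)) (hx : ∀ t, Commute (coeffOp t) x)
    (hy : ∀ t, Commute (coeffOp t) y) :
    anticomm (coeffOp a * x) (coeffOp b * y) = coeffOp (a * b) * anticomm x y := by
  rw [anticomm_mul_left ((hab.map coeffOp).mul_right (hy a)), anticomm_mul_right (hx b), map_mul,
    mul_assoc]

theorem anticomm_tateTerm (k : ℕ) (x : Module.End ℤ (TateIndex → P)) (h : Commute (raise k) x) :
    anticomm (tateTerm t e c k) x = raise k * (anticomm (coeffOp (t k ^ e) * iota k) x -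
      c k • anticomm (iota (k + 1)) x) := by
  rw [tateTerm, anticomm_mul_left h, map_sub, map_zsmul]
  rfl

theorem koszulTerm_mul_self (k : ℕ) : koszulTerm t k * koszulTerm t k = 0 := by
  rw [koszulTerm, mul_assoc, ← mul_assoc (lam k), ← (commute_coeffOp_lam _ _).eq, mul_assoc,
    lam_mul_self, mul_zero, mul_zero]

theorem anticomm_koszulTerm (ht : ∀ k l, Commute (t k) (t l)) (k l : ℕ) :
    anticomm (koszulTerm t k) (koszulTerm t l) = 0 := by
  rw [koszulTerm, koszulTerm, anticomm_coeffOp_mul _ _ (ht k l) _ _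
    (fun _ => commute_coeffOp_lam _ _) (fun _ => commute_coeffOp_lam _ _), anticomm_lam_lam,
    mul_zero]

theorem commute_raise_tateTerm (k l : ℕ) : Commute (raise k) (tateTerm t e c l) :=
  Commute.mul_right (raise_comm k l)
    (((commute_coeffOp_raise _ _).symm.mul_right (commute_raise_iota _ _)).sub_right
      ((commute_raise_iota _ _).smul_right _))

theorem commute_raise_koszulTerm (k l : ℕ) : Commute (raise k) (koszulTerm t l) :=
  (commute_coeffOp_raise _ _).symm.mul_right (commute_raise_lam _ _)

theorem anticomm_tateTerm_iota (k l : ℕ) : anticomm (tateTerm t e c k) (iota l) = 0 := by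
  rw [anticomm_tateTerm _ _ (commute_raise_iota _ _), anticomm_mul_left (commute_coeffOp_iota _ _),
    anticomm_iota_iota, anticomm_iota_iota, mul_zero, smul_zero, sub_zero, mul_zero]

theorem anticomm_tateTerm_coeffOp_mul_iota (k l : ℕ)
    (a : Module.End ℤ P) (ha : Commute (t k) a) :
    anticomm (tateTerm t e c k) (coeffOp a * iota l) = 0 := by
  rw [anticomm_mul_right, anticomm_tateTerm_iota, mul_zero]
  exact (commute_coeffOp_raise _ _).mul_right
    ((((ha.pow_left e).symm.map coeffOp).mul_right (commute_coeffOp_iota _ _)).sub_right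
      ((commute_coeffOp_iota _ _).smul_right _))

theorem anticomm_tateTerm_tateTerm (ht : ∀ k l, Commute (t k) (t l)) (k l : ℕ) :
    anticomm (tateTerm t e c k) (tateTerm t e c l) = 0 := by
  rw [anticomm_symm, anticomm_tateTerm _ _ (commute_raise_tateTerm _ _),
    anticomm_symm, anticomm_tateTerm_coeffOp_mul_iota _ _ _ ((ht k l).pow_right e),
    anticomm_symm, anticomm_tateTerm_iota, smul_zero, sub_zero, mul_zero]

theorem tateTerm_mul_self (k : ℕ) :
    tateTerm t e c k * tateTerm t e c k = 0 := by
  have h : ∀ a b : Module.End ℤ (TateIndex → P), a * a = 0 → b * b = 0 → anticomm a b = 0 →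
      (a - b) * (a - b) = 0 := by
    intro a b ha hb hab
    rw [anticomm_apply] at hab
    rw [sub_mul, mul_sub, mul_sub, ha, hb, zero_sub, sub_zero, ← neg_add', neg_eq_zero, hab]
  have hc : Commute (raise k : Module.End ℤ (TateIndex → P))
      (coeffOp (t k ^ e) * iota k - c k • iota (k + 1)) :=
    ((commute_coeffOp_raise _ _).symm.mul_right (commute_raise_iota _ _)).sub_right
      ((commute_raise_iota _ _).smul_right _)
  rw [tateTerm, mul_assoc, ← mul_assoc (_ - _), ← hc.eq, mul_assoc, h, mul_zero, mul_zero]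
  · rw [mul_assoc, ← mul_assoc (iota k), ← (commute_coeffOp_iota _ _).eq, mul_assoc,
      iota_mul_self, mul_zero, mul_zero]
  · rw [smul_mul_assoc, mul_smul_comm, iota_mul_self, smul_zero, smul_zero]
  · rw [map_zsmul, anticomm_mul_left (commute_coeffOp_iota _ _), anticomm_iota_iota, mul_zero,
      smul_zero]

/-- The relation ι_k λ_l + λ_l ι_k = δ_{kl} leaves only the two values l = k and l = k + 1, whose
contributions are the two sides of the relation between t_k and t_{k+1}. -/
theorem anticomm_tateTerm_koszulTerm (ht : ∀ k l, Commute (t k) (t l)) (k l : ℕ) :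
    anticomm (tateTerm t e c k) (koszulTerm t l) = raise k * ((if k = l then coeffOp (t k ^ e * t l)
      else 0) - if k + 1 = l then c k • coeffOp (t l) else 0) := by
  rw [anticomm_tateTerm _ _ (commute_raise_koszulTerm _ _), koszulTerm,
    anticomm_coeffOp_mul _ _ ((ht k l).pow_left e) _ _ (fun _ => commute_coeffOp_iota _ _)
      (fun _ => commute_coeffOp_lam _ _),
    anticomm_mul_right (commute_coeffOp_iota _ _), anticomm_iota_lam, anticomm_iota_lam]
  congr 2
  · split_ifs <;> simp
  · split_ifs <;> simp

/-- Koszul terms anticommute among themselves, and so do the terms with F_k. Summing the mixed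
anticommutators for a fixed k gives F_k (t_k^{e+1} - c_k t_{k+1}), which is zero by the relation.
The Koszul sum runs up to `N` inclusive so that l = k + 1 is present for every k < `N`. -/
theorem tateDiff_mul_self (ht : ∀ k l, Commute (t k) (t l))
    (h : ∀ k, t k ^ (e + 1) = c k • t (k + 1)) : tateDiff t e c N * tateDiff t e c N = 0 := by
  have h1 := sum_mul_sum_eq_zero (Finset.range (N + 1)) (koszulTerm t)
    (fun k _ => koszulTerm_mul_self k) (fun k l _ => anticomm_koszulTerm ht k l)
  have h2 := sum_mul_sum_eq_zero (Finset.range N) (tateTerm t e c)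
    (fun k _ => tateTerm_mul_self k) (fun k l _ => anticomm_tateTerm_tateTerm ht k l)
  have h3 : anticomm (∑ k ∈ Finset.range N, tateTerm t e c k)
      (∑ k ∈ Finset.range (N + 1), koszulTerm t k) = 0 := by
    rw [anticomm_symm, map_sum]
    refine Finset.sum_eq_zero fun k hk => ?_
    rw [Finset.mem_range] at hk
    rw [anticomm_symm]
    simp only [map_sum, anticomm_tateTerm_koszulTerm ht]
    rw [← Finset.mul_sum, Finset.sum_sub_distrib, Finset.sum_ite_eq, Finset.sum_ite_eq,
      if_pos (Finset.mem_range.2 (by omega)), if_pos (Finset.mem_range.2 (by omega)), ← pow_succ, h,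
      map_zsmul, sub_self, mul_zero]
  rw [anticomm_apply] at h3
  rw [tateDiff, add_mul, mul_add, mul_add, h1, h2, zero_add, add_zero, add_comm, h3]

end differential

end Tate

end BGa

namespace BGa

namespace Tate

/-! ### Contracting homotopies -/

section contraction

variable {P : Type*} [AddCommGroup P]

theorem anticomm_raise_iota_lower_lam_self (k l : ℕ) :
    anticomm (raise k * iota l : Module.End ℤ (TateIndex → P)) (lower k * lam l) =
      1 - vacant k * (1 - occupied l) := by
  rw [anticomm_apply, mul_assoc, ← mul_assoc (iota l), ← (commute_lower_iota k l).eq, mul_assoc,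
    iota_mul_lam_self, mul_assoc (lower k), ← mul_assoc (lam l), ← (commute_raise_lam k l).eq,
    mul_assoc, lam_mul_iota_self, ← mul_assoc, ← mul_assoc, raise_mul_lower, lower_mul_raise]
  noncomm_ring

theorem anticomm_raise_iota_lower_lam {k l k' l' : ℕ} (hk : k ≠ l) (hk' : k' ≠ l') :
    anticomm (raise k * iota k' : Module.End ℤ (TateIndex → P)) (lower l * lam l') = 0 := by
  rw [anticomm_mul_left, anticomm_mul_right (commute_lower_iota _ _), anticomm_iota_lam,
    if_neg hk', mul_zero, mul_zero]
  exact Commute.mul_right (raise_mul_lower_of_ne hk) (commute_raise_lam _ _)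

variable {t : ℕ → Module.End ℤ P} {e : ℕ} {c : ℕ → ℤ} {N : ℕ}

theorem tateTerm_eq (hc : ∀ k, c k • (1 : Module.End ℤ P) = 0) (k : ℕ) :
    tateTerm t e c k = coeffOp (t k ^ e) * (raise k * iota k) := by
  have h : c k • iota (k + 1) = (0 : Module.End ℤ (TateIndex → P)) := by
    have := congrArg (fun f => coeffOp f * iota (k + 1)) (hc k)
    simpa only [map_zsmul, map_one, map_zero, zero_mul, smul_mul_assoc, one_mul] using this
  rw [tateTerm, h, sub_zero, ← mul_assoc, ← (commute_coeffOp_raise _ _).eq, mul_assoc]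

/-- Contraction of the `r`-th tensor factor of the Tate resolution when the coefficients `c_k` act
by zero. -/
theorem anticomm_tateDiff_contraction (hc : ∀ k, c k • (1 : Module.End ℤ P) = 0) {r : ℕ}
    (hr : r < N) {U V Q : Module.End ℤ P} (h1 : t r * U + V * t r ^ e = 1) (h2 : U * t r = 1 - Q)
    (h3 : t r ^ e * V = Q) (hU : ∀ k, k ≠ r → Commute (t k) U)
    (hV : ∀ k, k ≠ r → Commute (t k) V) :
    anticomm (tateDiff t e c N) (coeffOp U * iota r + coeffOp V * (lower r * lam r)) =
      1 - coeffOp Q * (vacant r * (1 - occupied r)) := by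
  have hGl : ∀ a : Module.End ℤ P, Commute (coeffOp a) (lower r * lam r) := fun a =>
    (commute_coeffOp_lower _ _).mul_right (commute_coeffOp_lam _ _)
  have hFi : ∀ (a : Module.End ℤ P) k, Commute (coeffOp a) (raise k * iota k) := fun a k =>
    (commute_coeffOp_raise _ _).mul_right (commute_coeffOp_iota _ _)
  -- The four families of anticommutators vanish for k ≠ r, where `U` and `V` commute with t_k. For
  -- k = r no such commutation is available, and the order of the coefficient operators must be
  -- kept: it is what separates the occupied from the unoccupied part.
  have k1 : ∀ k, anticomm (koszulTerm t k) (coeffOp U * iota r) = if k = r then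
      coeffOp (t r * U) * occupied r + coeffOp (U * t r) * (1 - occupied r) else 0 := by
    intro k
    split_ifs with h
    · subst h
      rw [anticomm_apply, koszulTerm, mul_assoc, ← mul_assoc (lam k),
        ← (commute_coeffOp_lam _ _).eq, mul_assoc, lam_mul_iota_self, mul_assoc (coeffOp U),
        ← mul_assoc (iota k), ← (commute_coeffOp_iota _ _).eq, mul_assoc, iota_mul_lam_self,
        map_mul, map_mul, mul_assoc, mul_assoc]
    · rw [koszulTerm, anticomm_coeffOp_mul _ _ (hU k h) _ _ (fun _ => commute_coeffOp_lam _ _)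
        (fun _ => commute_coeffOp_iota _ _), anticomm_symm, anticomm_iota_lam,
        if_neg (Ne.symm h), mul_zero]
  have k2 : ∀ k, anticomm (koszulTerm t k) (coeffOp V * (lower r * lam r)) = 0 := by
    intro k
    rcases eq_or_ne k r with rfl | h
    · have e1 : lam k * (lower k * lam k) = (0 : Module.End ℤ (TateIndex → P)) := by
        rw [← mul_assoc, ← (commute_lower_lam _ _).eq, mul_assoc, lam_mul_self, mul_zero]
      rw [anticomm_apply, koszulTerm, mul_assoc, ← mul_assoc (lam k),
        ← (commute_coeffOp_lam _ _).eq, mul_assoc, e1, mul_assoc (coeffOp V),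
        ← mul_assoc (lower k * lam k), ← (hGl _).eq, mul_assoc (coeffOp (t k)),
        mul_assoc (lower k), lam_mul_self]
      simp only [mul_zero, add_zero]
    · rw [koszulTerm, anticomm_coeffOp_mul _ _ (hV k h) _ _ (fun _ => commute_coeffOp_lam _ _) hGl,
        anticomm_mul_right (commute_lower_lam _ _), anticomm_lam_lam, mul_zero, mul_zero]
  have k3 : ∀ k, anticomm (tateTerm t e c k) (coeffOp U * iota r) = 0 := by
    intro k
    rcases eq_or_ne k r with rfl | h
    · have e1 : raise k * iota k * iota k = (0 : Module.End ℤ (TateIndex → P)) := by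
        rw [mul_assoc, iota_mul_self, mul_zero]
      have e2 : iota k * (raise k * iota k) = (0 : Module.End ℤ (TateIndex → P)) := by
        rw [← mul_assoc, ← (commute_raise_iota _ _).eq, mul_assoc, iota_mul_self, mul_zero]
      rw [tateTerm_eq hc, anticomm_apply, mul_assoc, ← mul_assoc (raise k * iota k),
        ← (hFi _ _).eq, mul_assoc, e1, mul_assoc (coeffOp U), ← mul_assoc (iota k),
        ← (commute_coeffOp_iota _ _).eq, mul_assoc, e2]
      simp only [mul_zero, add_zero]
    · exact anticomm_tateTerm_coeffOp_mul_iota _ _ _ (hU k h)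
  have k4 : ∀ k, anticomm (tateTerm t e c k) (coeffOp V * (lower r * lam r)) = if k = r then
      coeffOp (t r ^ e * V) * ((1 - vacant r) * (1 - occupied r)) +
        coeffOp (V * t r ^ e) * occupied r else 0 := by
    intro k
    split_ifs with h
    · subst h
      have e1 : raise k * iota k * (lower k * lam k) =
          ((1 - vacant k) * (1 - occupied k) : Module.End ℤ (TateIndex → P)) := by
        rw [mul_assoc, ← mul_assoc (iota k), ← (commute_lower_iota _ _).eq, mul_assoc,
          iota_mul_lam_self, ← mul_assoc, raise_mul_lower]
      have e2 : lower k * lam k * (raise k * iota k) =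
          (occupied k : Module.End ℤ (TateIndex → P)) := by
        rw [mul_assoc, ← mul_assoc (lam k), ← (commute_raise_lam _ _).eq, mul_assoc,
          lam_mul_iota_self, ← mul_assoc, lower_mul_raise, one_mul]
      rw [tateTerm_eq hc, anticomm_apply, mul_assoc, ← mul_assoc (raise k * iota k),
        ← (hFi _ _).eq, mul_assoc, e1, mul_assoc (coeffOp V), ← mul_assoc (lower k * lam k),
        ← (hGl _).eq, mul_assoc (coeffOp (t k ^ e)), e2, map_mul, map_mul, mul_assoc, mul_assoc]
    · rw [tateTerm_eq hc, anticomm_coeffOp_mul _ _ ((hV k h).pow_left e) _ _ (fun a => hFi a k)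
        hGl, anticomm_raise_iota_lower_lam h h, mul_zero]
  have k12 := fun k => (anticomm_symm _ _).trans ((map_add _ _ _).trans
    ((congrArg₂ (· + ·) (k1 k) (k2 k)).trans (add_zero _)))
  have k34 := fun k => (anticomm_symm _ _).trans ((map_add _ _ _).trans
    ((congrArg₂ (· + ·) (k3 k) (k4 k)).trans (zero_add _)))
  rw [anticomm_symm, tateDiff, map_add, map_sum, map_sum]
  simp only [k12, k34]
  rw [Finset.sum_ite_eq', Finset.sum_ite_eq', if_pos (Finset.mem_range.2 hr),
    if_pos (Finset.mem_range.2 (by omega)), h2, h3, map_sub, map_one]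
  -- On the occupied part the sum is t_r U + V t_r^e = 1. On the unoccupied part it is (1 - Q) + Q
  -- (1 - vacant), so only Q · vacant is missing from the identity.
  have h1' : coeffOp (V * t r ^ e) = 1 - coeffOp (t r * U) := by
    rw [← map_one (coeffOp (P := P)), ← h1, map_add, add_sub_cancel_left]
  rw [h1']
  noncomm_ring

/-- The differential `∑ u_k F_k ι_{k+1}`. -/
noncomputable def constDiff (u : ℕ → ℤ) (N : ℕ) : Module.End ℤ (TateIndex → P) :=
  ∑ k ∈ Finset.range N, u k • (raise k * iota (k + 1))

/-- The generators F_r and λ_{r+1} form a Koszul pair for δ. Dividing by F_r and multiplying by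
λ_{r+1} is the homotopy for this pair and anticommutes with the summands of the other pairs. -/
theorem anticomm_constDiff (u : ℕ → ℤ) {r : ℕ} (hr : r < N) :
    anticomm (constDiff u N : Module.End ℤ (TateIndex → P)) (lower r * lam (r + 1)) =
      u r • (1 - vacant r * (1 - occupied (r + 1))) := by
  rw [anticomm_symm, constDiff, map_sum, Finset.sum_eq_single r]
  · rw [map_zsmul, anticomm_symm, anticomm_raise_iota_lower_lam_self]
  · intro k _ hk
    rw [map_zsmul, anticomm_symm, anticomm_raise_iota_lower_lam hk (by omega), smul_zero]
  · intro h
    exact absurd (Finset.mem_range.2 hr) h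

/-- With t = 0 only the terms c_k F_k ι_{k+1} remain; `he` is required because 0 ^ 0 = 1 would keep
ι_k alive. -/
theorem tateDiff_zero (u : ℕ → ℤ) (he : e ≠ 0) (a : ℤ) :
    tateDiff (fun _ => (0 : Module.End ℤ P)) e (fun k => a * u k) N = -(a • constDiff u N) := by
  rw [tateDiff, constDiff, Finset.smul_sum, ← Finset.sum_neg_distrib]
  simp only [koszulTerm, tateTerm, map_zero, zero_mul, Finset.sum_const_zero, zero_add,
    zero_pow he, zero_sub, mul_neg, mul_smul_comm, mul_smul]

theorem constDiff_mul_self (u : ℕ → ℤ) :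
    constDiff u N * constDiff u N = (0 : Module.End ℤ (TateIndex → P)) := by
  -- δ is, up to sign, the Tate differential for t = 0, where the relations hold trivially; `e = 1`
  -- is just a convenient nonzero value.
  have h := tateDiff_mul_self (P := P) (t := fun _ => 0) (e := 1) (c := fun k => 1 * u k) (N := N)
    (fun _ _ => rfl) (fun _ => by simp)
  rw [tateDiff_zero u one_ne_zero, one_smul, neg_mul_neg] at h
  exact h

end contraction

/-! ### Naturality in the coefficients -/

section naturality

variable {P P' : Type*} [AddCommGroup P] [AddCommGroup P'] (g : P →+ P')

theorem mapCoeff_lam (k : ℕ) (m : TateIndex → P) :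
    mapCoeff g (lam (P := P) k m) = lam (P := P') k (mapCoeff g m) := by
  ext j
  simp only [lam, Module.End.mul_apply, occupied_apply, toggle_apply, mapCoeff_apply]
  split_ifs <;> simp

theorem mapCoeff_iota (k : ℕ) (m : TateIndex → P) :
    mapCoeff g (iota (P := P) k m) = iota (P := P') k (mapCoeff g m) := by
  ext j
  simp only [iota, Module.End.mul_apply, occupied_apply, toggle_apply, mapCoeff_apply,
    LinearMap.sub_apply, Pi.sub_apply, Module.End.one_apply]
  split_ifs <;> simp

theorem mapCoeff_raise (k : ℕ) (m : TateIndex → P) :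
    mapCoeff g (raise (P := P) k m) = raise (P := P') k (mapCoeff g m) := by
  ext j
  simp only [raise_apply, mapCoeff_apply]
  split_ifs <;> simp

theorem mapCoeff_coeffOp {t : Module.End ℤ P} {t' : Module.End ℤ P'} (h : ∀ x, g (t x) = t' (g x))
    (m : TateIndex → P) : mapCoeff g (coeffOp t m) = coeffOp t' (mapCoeff g m) := by
  ext j
  exact h _

theorem mapCoeff_tateDiff {t : ℕ → Module.End ℤ P} {t' : ℕ → Module.End ℤ P'}
    (h : ∀ k x, g (t k x) = t' k (g x)) (e : ℕ) (c : ℕ → ℤ) (N : ℕ) (m : TateIndex → P) :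
    mapCoeff g (tateDiff t e c N m) = tateDiff t' e c N (mapCoeff g m) := by
  have h' : ∀ (k n : ℕ) x, g ((t k ^ n) x) = (t' k ^ n) (g x) := by
    intro k n
    induction n with
    | zero => intro x; rfl
    | succ n ih => intro x; rw [pow_succ', pow_succ', Module.End.mul_apply, h, ih]; rfl
  simp only [tateDiff, LinearMap.add_apply, LinearMap.sum_apply, map_add, map_sum, koszulTerm,
    tateTerm, Module.End.mul_apply, LinearMap.sub_apply, LinearMap.smul_apply]
  congr 1
  · exact Finset.sum_congr rfl fun k _ => by rw [mapCoeff_coeffOp g (h k), mapCoeff_lam]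
  · refine Finset.sum_congr rfl fun k _ => ?_
    rw [mapCoeff_raise, map_sub, map_zsmul, mapCoeff_coeffOp g (h' k e), mapCoeff_iota,
      mapCoeff_iota (P := P)]

/-- Every summand of D ends with a multiplication by some λ_k or F_k, and hence produces no trivial
monomial. This lets the augmentation component be read off from a sum D a + augmentation. -/
theorem tateDiff_apply_zero (t : ℕ → Module.End ℤ P) (e : ℕ) (c : ℕ → ℤ) (N : ℕ)
    (m : TateIndex → P) : tateDiff t e c N m (∅, 0) = 0 := by
  simp [tateDiff, koszulTerm, tateTerm, LinearMap.sum_apply, Finset.sum_apply, lam, occupied_apply,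
    raise_apply]

end naturality

end Tate

end BGa

namespace BGa

/-! ### Operators in the first variable -/

section shiftOp

open MvPolynomial

variable {R : Type*} [CommRing R] {n : ℕ}

/-- The linear operator with `x₀ ^ a * m ↦ c(a) x₀ ^ φ(a) * m` for monomials `m` in `x₁, x₂, …`. -/
noncomputable def shiftOp (c : ℕ → R) (φ : ℕ → ℕ) : Module.End ℤ (Cochain R (n + 1)) :=
  ((basisMonomials (Fin (n + 1)) R).constr R
    fun e => monomial (e.update 0 (φ (e 0))) (c (e 0))).restrictScalars ℤ

theorem shiftOp_monomial (c : ℕ → R) (φ : ℕ → ℕ) (e : Fin (n + 1) →₀ ℕ) (r : R) :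
    shiftOp c φ (monomial e r) = monomial (e.update 0 (φ (e 0))) (c (e 0) * r) := by
  have h : monomial e r = r • basisMonomials (Fin (n + 1)) R e := by
    rw [coe_basisMonomials, smul_monomial, smul_eq_mul, mul_one]
  rw [h, shiftOp, LinearMap.restrictScalars_apply, map_smul, Module.Basis.constr_basis,
    smul_monomial, smul_eq_mul, mul_comm]

/-- Arbitrary coefficients `r` appear because the endomorphisms are only ℤ-linear. -/
theorem end_ext {f g : Module.End ℤ (Cochain R (n + 1))}
    (h : ∀ e r, f (monomial e r) = g (monomial e r)) : f = g := by
  refine LinearMap.ext fun x => ?_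
  induction x using MvPolynomial.induction_on' with
  | monomial e r => exact h e r
  | add p q hp hq => rw [map_add, map_add, hp, hq]

theorem shiftOp_mul (c c' : ℕ → R) (φ φ' : ℕ → ℕ) :
    (shiftOp c φ * shiftOp c' φ' : Module.End ℤ (Cochain R (n + 1))) =
      shiftOp (fun a => c (φ' a) * c' a) (φ ∘ φ') := by
  refine end_ext fun e r => ?_
  rw [Module.End.mul_apply, shiftOp_monomial, shiftOp_monomial, shiftOp_monomial]
  simp [mul_assoc]

/-- Exponent maps need agree only where the coefficient is nonzero. This disposes of truncated
subtraction: out-of-range exponents always carry a zero coefficient. -/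
theorem shiftOp_congr {c c' : ℕ → R} {φ φ' : ℕ → ℕ} (h : ∀ a, c a = c' a)
    (h' : ∀ a, c a ≠ 0 → φ a = φ' a) :
    (shiftOp c φ : Module.End ℤ (Cochain R (n + 1))) = shiftOp c' φ' := by
  refine end_ext fun e r => ?_
  rw [shiftOp_monomial, shiftOp_monomial, ← h]
  by_cases h0 : c (e 0) = 0
  · simp [h0]
  · rw [h' _ h0]

theorem shiftOp_add (c c' : ℕ → R) (φ : ℕ → ℕ) :
    (shiftOp c φ + shiftOp c' φ : Module.End ℤ (Cochain R (n + 1))) = shiftOp (c + c') φ := by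
  refine end_ext fun e r => ?_
  rw [LinearMap.add_apply, shiftOp_monomial, shiftOp_monomial, shiftOp_monomial, ← map_add,
    ← add_mul, Pi.add_apply]

theorem shiftOp_one : (shiftOp 1 id : Module.End ℤ (Cochain R (n + 1))) = 1 := by
  refine end_ext fun e r => ?_
  rw [shiftOp_monomial, Pi.one_apply, one_mul, id, Module.End.one_apply, Finsupp.update_self]

theorem zsmul_shiftOp (z : ℤ) (c : ℕ → R) (φ : ℕ → ℕ) :
    z • (shiftOp c φ : Module.End ℤ (Cochain R (n + 1))) = shiftOp (fun a => z * c a) φ := by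
  refine end_ext fun e r => ?_
  rw [LinearMap.smul_apply, shiftOp_monomial, shiftOp_monomial, ← map_zsmul, zsmul_eq_mul,
    mul_assoc]

/-- The divided derivative `∂₀ ^ k / k!` with respect to the first variable. -/
noncomputable def hasse (k : ℕ) : Module.End ℤ (Cochain R (n + 1)) :=
  shiftOp (fun a => (a.choose k : R)) (· - k)

/-- The law of divided powers, from C(a, l) C(a - l, k) = C(a, k + l) C(k + l, l). -/
theorem hasse_mul_hasse (k l : ℕ) :
    (hasse k * hasse l : Module.End ℤ (Cochain R (n + 1))) = ((k + l).choose k : ℤ) • hasse (k + l) := by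
  rw [hasse, hasse, hasse, shiftOp_mul, zsmul_shiftOp]
  refine shiftOp_congr (fun a => ?_) fun a _ => ?_
  · have := Nat.choose_mul (n := a) (Nat.le_add_left l k)
    rw [Nat.add_sub_cancel, ← Nat.choose_symm_add] at this
    have := congrArg (Nat.cast : ℕ → R) this
    push_cast at this ⊢
    linear_combination -this
  · simp only [Function.comp_apply]; omega

theorem commute_hasse (k l : ℕ) :
    Commute (hasse k : Module.End ℤ (Cochain R (n + 1))) (hasse l) := by
  rw [commute_iff_eq, hasse_mul_hasse, hasse_mul_hasse, add_comm l k, ← Nat.choose_symm_add]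

theorem hasse_pow (q j : ℕ) : (hasse q ^ j : Module.End ℤ (Cochain R (n + 1))) =
    (∏ i ∈ Finset.range j, (((i + 1) * q).choose q : ℤ)) • hasse (j * q) := by
  induction j with
  | zero =>
    rw [pow_zero, Finset.prod_range_zero, one_smul, zero_mul, hasse, ← shiftOp_one]
    exact shiftOp_congr (by simp) (by simp)
  | succ j ih =>
    rw [pow_succ', ih, mul_smul_comm, hasse_mul_hasse, Finset.prod_range_succ, mul_smul,
      show q + j * q = (j + 1) * q by ring]

/-- Translation of the first variable by a new variable. -/
noncomputable def translate : Cochain R (n + 1) →ₐ[R] Polynomial (Cochain R (n + 1)) :=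
  aeval fun i => Polynomial.C (X i) + if i = 0 then Polynomial.X else 0

/-- Taylor's formula. The description on monomials is suited to products, the one by Taylor
coefficients to compatibility with pullbacks. -/
theorem hasse_eq_coeff (k : ℕ) (f : Cochain R (n + 1)) : hasse k f = (translate f).coeff k := by
  induction f using MvPolynomial.induction_on' with
  | add f g h1 h2 => rw [map_add, map_add, Polynomial.coeff_add, h1, h2]
  | monomial e r =>
    have h0 : (aeval fun i => Polynomial.C (X i : Cochain R (n + 1)) + if i = 0 then Polynomial.X else 0)
        (monomial e r) = Polynomial.C (C r * ∏ i : Fin n, X i.succ ^ e i.succ) *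
          (Polynomial.X + Polynomial.C (X 0)) ^ e 0 := by
      rw [aeval_monomial, Finsupp.prod_fintype _ _ (by simp), Fin.prod_univ_succ]
      simp only [Fin.succ_ne_zero, if_true, if_false, add_zero, map_mul, map_prod, map_pow]
      rw [add_comm (Polynomial.C _)]
      change Polynomial.C (C r) * _ = _
      ring
    rw [translate, h0, Polynomial.coeff_C_mul, Polynomial.coeff_X_add_C_pow, hasse, shiftOp_monomial,
      monomial_eq, Finsupp.prod_fintype _ _ (by simp), Fin.prod_univ_succ]
    simp only [Finsupp.coe_update, Function.update_self, ne_eq, Fin.succ_ne_zero, not_false_eq_true,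
      Function.update_of_ne, map_mul, map_natCast]
    ring

/-- Every coface except the zeroth sends x₀ to x₀ or x₀ + x₁ and the other variables to expressions
without x₀, so translating x₀ before or after amounts to the same. The zeroth one replaces x₀ by x₁
and has to be excluded. -/
theorem translate_coface (i : ℕ) (f : Cochain R (n + 1)) :
    translate (coface (i + 1) f) = (translate f).map (coface (i + 1) : _ →ₐ[R] _).toRingHom := by
  have : (translate.comp (coface (i + 1)) : Cochain R (n + 1) →ₐ[R] _) =
      (Polynomial.mapAlgHom (coface (i + 1))).comp translate := by
    ext j : 1
    simp only [AlgHom.comp_apply, coface, translate, aeval_X, face, Polynomial.coe_mapAlgHom,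
      Polynomial.map_add, Polynomial.map_C]
    refine Fin.cases ?_ (fun j => ?_) j
    · rcases i with - | i
      · simp [face]
        ring
      · simp [face]
    · simp only [Fin.val_succ, Fin.succ_ne_zero, if_false, add_lt_add_iff_right, add_left_inj]
      split_ifs <;> simp [face, *]
  exact DFunLike.congr_fun this f

theorem hasse_coface (i k : ℕ) (f : Cochain R (n + 1)) :
    coface (i + 1) (hasse k f) = hasse k (coface (i + 1) f) := by
  rw [hasse_eq_coeff, hasse_eq_coeff, translate_coface, Polynomial.coeff_map]
  rfl

theorem hasse_map {S : Type*} [CommRing S] (g : R →+* S) (k : ℕ) (f : Cochain R (n + 1)) :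
    MvPolynomial.map g (hasse k f) = hasse k (MvPolynomial.map g f) := by
  induction f using MvPolynomial.induction_on' with
  | add f g h1 h2 => rw [map_add, map_add, h1, h2, map_add, map_add]
  | monomial e r => 
    rw [hasse, hasse, shiftOp_monomial, map_monomial, map_monomial, shiftOp_monomial, map_mul,
      map_natCast]

end shiftOp

end BGa

namespace BGa

/-! ### Truncated polynomial structure in characteristic `p` -/

/-- Lucas' theorem: the digits of p^r below position r vanish, so the only factor left is C(n / p^r,
1). -/
theorem choose_prime_pow_cast (p : ℕ) [Fact p.Prime] (n r : ℕ) :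
    ((n.choose (p ^ r) : ℕ) : ZMod p) = ((n / p ^ r : ℕ) : ZMod p) := by
  have h := (ZMod.intCast_eq_intCast_iff _ _ p).2
    (Choose.choose_modEq_choose_mul_prod_range_choose (p := p) (n := n) (k := p ^ r) r)
  rw [Finset.prod_eq_one, Nat.div_self (pow_pos (Fact.out : p.Prime).pos r),
    Nat.choose_one_right] at h
  · rw [Nat.cast_one, mul_one, Int.cast_natCast, Int.cast_natCast] at h
    exact h
  · intro i hi
    rw [Finset.mem_range] at hi
    have : p ^ r / p ^ i % p = 0 := by
      rw [Nat.pow_div hi.le (Fact.out : p.Prime).pos]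
      exact Nat.mod_eq_zero_of_dvd (dvd_pow_self p (by omega))
    rw [this, Nat.choose_zero_right]

/-- The falling factorial is (p - 1)! · C(d, p - 1). Wilson's theorem gives the -1, and by Lucas the
binomial coefficient depends on d mod p and is nonzero only when that digit is p - 1. -/
theorem descFactorial_cast (p : ℕ) [Fact p.Prime] (d : ℕ) :
    ((d.descFactorial (p - 1) : ℕ) : ZMod p) = if ((d + 1 : ℕ) : ZMod p) = 0 then -1 else 0 := by
  have hp := (Fact.out : p.Prime)
  have h2 := hp.two_le
  have h := (ZMod.intCast_eq_intCast_iff _ _ p).2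
    (Choose.choose_modEq_choose_mod_mul_choose_div (p := p) (n := d) (k := p - 1))
  rw [Nat.mod_eq_of_lt (show p - 1 < p by omega), Nat.div_eq_of_lt (show p - 1 < p by omega),
    Nat.choose_zero_right] at h
  push_cast at h
  rw [Nat.descFactorial_eq_factorial_mul_choose, Nat.cast_mul, ZMod.wilsons_lemma, h, mul_one]
  simp only [ZMod.natCast_eq_zero_iff]
  have hd : p ∣ d + 1 ↔ d % p = p - 1 := by
    have := Nat.mod_lt d hp.pos
    rw [Nat.dvd_iff_mod_eq_zero, Nat.add_mod]
    constructor
    · intro h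
      by_contra h'
      rw [Nat.mod_eq_of_lt (a := 1) (by omega), Nat.mod_eq_of_lt (by omega)] at h
      omega
    · intro h
      rw [h, Nat.mod_eq_of_lt (a := 1) (by omega), Nat.sub_add_cancel (by omega), Nat.mod_self]
  split_ifs with h'
  · rw [hd.1 h', Nat.choose_self]; simp
  · have h1 : d % p ≠ p - 1 := fun h => h' (hd.2 h)
    have := Nat.mod_lt d hp.pos
    rw [Nat.choose_eq_zero_of_lt (by omega)]; simp

section charP

variable (p : ℕ) [Fact p.Prime] (n : ℕ)

/-- The divided derivative of order `p ^ r` in the first variable. -/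
noncomputable def hasseP (R : Type*) [CommRing R] (p n r : ℕ) : Module.End ℤ (Cochain R (n + 1)) :=
  hasse (p ^ r)

/-- Raising the `r`-th base `p` digit of the exponent of the first variable. -/
noncomputable def digitUp (r : ℕ) : Module.End ℤ (Cochain (ZMod p) (n + 1)) :=
  -- For the digit p - 1 the denominator is zero, and the convention 0⁻¹ = 0 kills the monomial
  -- instead of producing a carry.
  shiftOp (fun a => (((a / p ^ r + 1 : ℕ) : ZMod p))⁻¹) (· + p ^ r)

/-- Filling up the `r`-th base `p` digit of the exponent of the first variable. -/
noncomputable def digitFill (r : ℕ) : Module.End ℤ (Cochain (ZMod p) (n + 1)) :=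
  -- The coefficient -1 compensates (p - 1)! = -1, the effect of lowering the digit from p - 1 to 0.
  shiftOp (fun a => if ((a / p ^ r : ℕ) : ZMod p) = 0 then -1 else 0) (· + (p - 1) * p ^ r)

/-- The projection onto the monomials with vanishing `r`-th base `p` digit of the exponent of the
first variable. -/
noncomputable def digitZero (r : ℕ) : Module.End ℤ (Cochain (ZMod p) (n + 1)) :=
  shiftOp (fun a => if ((a / p ^ r : ℕ) : ZMod p) = 0 then 1 else 0) id

variable {p n}

theorem hasseP_eq (r : ℕ) : hasseP (ZMod p) p n r =
    shiftOp (fun a => ((a / p ^ r : ℕ) : ZMod p)) (· - p ^ r) := by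
  rw [hasseP, hasse]
  exact shiftOp_congr (fun a => choose_prime_pow_cast p a r) fun _ _ => rfl

theorem hasseP_pow (r j : ℕ) : hasseP (ZMod p) p n r ^ j =
    shiftOp (fun a => ((a / p ^ r).descFactorial j : ZMod p)) (· - j * p ^ r) := by
  induction j with
  | zero =>
    rw [pow_zero, ← shiftOp_one]
    exact shiftOp_congr (by simp) (by simp)
  | succ j ih =>
    rw [pow_succ', ih, hasseP_eq, shiftOp_mul]
    refine shiftOp_congr (fun a => ?_) fun a _ => ?_
    · rw [Nat.descFactorial_succ, mul_comm j, Nat.sub_mul_div, Nat.cast_mul]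
    · simp only [Function.comp_apply, add_mul, one_mul]; omega

/-- The first summand is the projection onto monomials whose r-th digit is not p - 1, the second the
projection onto those where it is. -/
theorem hasseP_mul_digitUp_add (r : ℕ) :
    hasseP (ZMod p) p n r * digitUp p n r + digitFill p n r * hasseP (ZMod p) p n r ^ (p - 1) = 1 := by
  have hq : 0 < p ^ r := pow_pos (Fact.out : p.Prime).pos r
  have h1 : hasseP (ZMod p) p n r * digitUp p n r =
      shiftOp (fun a => if ((a / p ^ r + 1 : ℕ) : ZMod p) = 0 then 0 else 1) id := by
    rw [hasseP_eq, digitUp, shiftOp_mul]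
    refine shiftOp_congr (fun a => ?_) fun a _ => by simp
    rw [Nat.add_div_right _ hq]
    split_ifs with h
    · rw [h]; simp
    · exact mul_inv_cancel₀ h
  have h2 : digitFill p n r * hasseP (ZMod p) p n r ^ (p - 1) =
      shiftOp (fun a => if ((a / p ^ r + 1 : ℕ) : ZMod p) = 0 then 1 else 0) id := by
    rw [hasseP_pow, digitFill, shiftOp_mul]
    have key : ∀ a, ((a / p ^ r + 1 : ℕ) : ZMod p) = 0 → p - 1 ≤ a / p ^ r := by
      intro a ha
      exact Nat.sub_le_of_le_add (Nat.le_of_dvd (Nat.succ_pos _) ((ZMod.natCast_eq_zero_iff _ _).1 ha))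
    refine shiftOp_congr (fun a => ?_) fun a ha => ?_
    · rw [descFactorial_cast]
      by_cases h : ((a / p ^ r + 1 : ℕ) : ZMod p) = 0
      · rw [if_pos h, if_pos h, if_pos, neg_mul_neg, mul_one]
        rw [mul_comm, Nat.sub_mul_div, Nat.cast_sub (key a h),
          Nat.cast_sub (Fact.out : p.Prime).one_le, ← h]
        simp
      · rw [if_neg h, if_neg h, mul_zero]
    · have h : ((a / p ^ r + 1 : ℕ) : ZMod p) = 0 := by
        by_contra h
        rw [descFactorial_cast, if_neg h, mul_zero] at ha
        exact ha rfl
      have := Nat.mul_le_of_le_div _ _ _ (key a h)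
      simp only [Function.comp_apply, id]; omega
  rw [h1, h2, shiftOp_add, ← shiftOp_one]
  refine shiftOp_congr (fun a => ?_) fun a _ => rfl
  simp only [Pi.add_apply, Pi.one_apply]
  split_ifs <;> simp

theorem digitUp_mul_hasseP (r : ℕ) :
    digitUp p n r * hasseP (ZMod p) p n r = 1 - digitZero p n r := by
  have hq : 0 < p ^ r := pow_pos (Fact.out : p.Prime).pos r
  rw [eq_sub_iff_add_eq]
  have h1 : digitUp p n r * hasseP (ZMod p) p n r =
      shiftOp (fun a => if ((a / p ^ r : ℕ) : ZMod p) = 0 then 0 else 1) id := by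
    rw [hasseP_eq, digitUp, shiftOp_mul]
    have key : ∀ a, ((a / p ^ r : ℕ) : ZMod p) ≠ 0 → p ^ r ≤ a := by
      intro a ha
      by_contra h
      rw [Nat.div_eq_of_lt (by omega)] at ha
      exact ha (by simp)
    refine shiftOp_congr (fun a => ?_) fun a ha => ?_
    · split_ifs with h
      · rw [h, mul_zero]
      · rw [← Nat.add_div_right _ hq, Nat.sub_add_cancel (key a h)]
        exact inv_mul_cancel₀ h
    · have := key a (right_ne_zero_of_mul ha)
      simp only [Function.comp_apply, id]; omega
  rw [h1, digitZero, shiftOp_add, ← shiftOp_one]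
  refine shiftOp_congr (fun a => ?_) fun a _ => rfl
  simp only [Pi.add_apply, Pi.one_apply]
  split_ifs <;> simp

theorem hasseP_pow_mul_digitFill (r : ℕ) :
    hasseP (ZMod p) p n r ^ (p - 1) * digitFill p n r = digitZero p n r := by
  have hp := (Fact.out : p.Prime)
  have hq : 0 < p ^ r := pow_pos hp.pos r
  rw [hasseP_pow, digitFill, shiftOp_mul]
  refine shiftOp_congr (fun a => ?_) fun a _ => by simp
  rw [descFactorial_cast, Nat.add_mul_div_right _ _ hq]
  by_cases h : ((a / p ^ r : ℕ) : ZMod p) = 0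
  · rw [if_pos h, if_pos h, if_pos, neg_mul_neg, mul_one]
    rw [add_assoc, Nat.sub_add_cancel hp.one_le, Nat.cast_add, h]; simp
  · rw [if_neg h, if_neg h, mul_zero]

/-- Operators changing different digits commute. -/
theorem commute_shiftOp_of_digits {c : ℕ → ZMod p} {w k r : ℕ} (hk : k ≠ r)
    (hc : ∀ a b : ℕ, ((a / p ^ r : ℕ) : ZMod p) = ((b / p ^ r : ℕ) : ZMod p) → c a = c b)
    (hw : ∀ a, c a ≠ 0 → (((a + w * p ^ r) / p ^ (r + 1) : ℕ)) = a / p ^ (r + 1)) :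
    Commute (hasseP (ZMod p) p n k) (shiftOp c (· + w * p ^ r)) := by
  have hp := (Fact.out : p.Prime)
  have hq : ∀ r, 0 < p ^ r := fun r => pow_pos hp.pos r
  rw [commute_iff_eq, hasseP_eq, shiftOp_mul, shiftOp_mul]
  -- Adding multiples of p^k leaves the lower digits alone. Conversely, by `hlt`, a change that does
  -- not carry out of position s leaves all higher digits alone.
  have hmod : ∀ a s k x : ℕ, s < k →
      (((a + x * p ^ k) / p ^ s : ℕ) : ZMod p) = ((a / p ^ s : ℕ) : ZMod p) := by
    intro a s k x hs
    obtain ⟨m, rfl⟩ := Nat.exists_eq_add_of_lt hs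
    rw [show x * p ^ (s + m + 1) = x * p ^ m * p * p ^ s by ring, Nat.add_mul_div_right _ _ (hq s)]
    push_cast; simp
  have hlt : ∀ {s k : ℕ} {a b : ℕ}, s < k → a / p ^ (s + 1) = b / p ^ (s + 1) →
      a / p ^ k = b / p ^ k := by
    intro s k a b h hab
    obtain ⟨m, rfl⟩ := Nat.exists_eq_add_of_lt h
    rw [show s + m + 1 = s + 1 + m by ring, pow_add p (s + 1), ← Nat.div_div_eq_div_mul, hab,
      Nat.div_div_eq_div_mul]
  have key : ∀ a, ((a / p ^ k : ℕ) : ZMod p) ≠ 0 → p ^ k ≤ a := by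
    intro a ha
    by_contra h
    rw [Nat.div_eq_of_lt (by omega)] at ha
    exact ha (by simp)
  -- Subtracting p^k from a number with nonzero k-th digit causes no borrow, so the r-th digit, on
  -- which `c` depends, is unchanged.
  have hc' : ∀ a, ((a / p ^ k : ℕ) : ZMod p) ≠ 0 → c (a - p ^ k) = c a := by
    intro a ha
    apply hc
    rcases lt_or_gt_of_ne hk with h | h
    · rw [hlt h]
      rw [pow_succ, ← Nat.div_div_eq_div_mul, ← Nat.div_div_eq_div_mul,
        show a - p ^ k = a - p ^ k * 1 by rw [mul_one], Nat.sub_mul_div]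
      have h1 : ¬ p ∣ a / p ^ k := fun h => ha ((ZMod.natCast_eq_zero_iff _ _).2 h)
      generalize a / p ^ k = x at h1
      obtain ⟨y, rfl⟩ : ∃ y, x = y + 1 := Nat.exists_eq_succ_of_ne_zero fun h => h1 (h ▸ dvd_zero p)
      rw [Nat.add_sub_cancel, Nat.succ_div_of_not_dvd h1]
    · rw [← hmod (a - p ^ k) r k 1 h, one_mul, Nat.sub_add_cancel (key a ha)]
  have hd : ∀ a, c a ≠ 0 →
      (((a + w * p ^ r) / p ^ k : ℕ) : ZMod p) = ((a / p ^ k : ℕ) : ZMod p) := by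
    intro a ha
    rcases lt_or_gt_of_ne hk with h | h
    · exact hmod a k r w h
    · rw [hlt h (hw a ha)]
  refine shiftOp_congr (fun a => ?_) fun a ha => ?_
  · by_cases h : c a = 0
    · by_cases h' : ((a / p ^ k : ℕ) : ZMod p) = 0
      · rw [h, h', mul_zero, mul_zero]
      · rw [h, hc' a h', h, mul_zero, zero_mul]
    · rw [hd a h]
      by_cases h' : ((a / p ^ k : ℕ) : ZMod p) = 0
      · rw [h', zero_mul, mul_zero]
      · rw [hc' a h', mul_comm]
  · have h := key a (hd a (right_ne_zero_of_mul ha) ▸ left_ne_zero_of_mul ha)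
    simp only [Function.comp_apply]
    omega

theorem add_mul_pow_div (a w r : ℕ) (h : (a / p ^ r + w) / p = a / p ^ r / p) :
    (a + w * p ^ r) / p ^ (r + 1) = a / p ^ (r + 1) := by
  rw [pow_succ, ← Nat.div_div_eq_div_mul, ← Nat.div_div_eq_div_mul,
    Nat.add_mul_div_right _ _ (pow_pos (Fact.out : p.Prime).pos r), h]

theorem commute_hasseP_digitUp {k r : ℕ} (hk : k ≠ r) :
    Commute (hasseP (ZMod p) p n k) (digitUp p n r) := by
  have h := commute_shiftOp_of_digits (n := n) (c := fun a => (((a / p ^ r + 1 : ℕ) : ZMod p))⁻¹)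
    (w := 1) hk (fun a b hab => by simp only [Nat.cast_add, hab]) (fun a ha => by
      apply add_mul_pow_div
      exact Nat.succ_div_of_not_dvd fun h => ha (by
        simp only [(ZMod.natCast_eq_zero_iff _ _).2 h, inv_zero]))
  rw [digitUp]
  simpa only [one_mul] using h

theorem commute_hasseP_digitFill {k r : ℕ} (hk : k ≠ r) :
    Commute (hasseP (ZMod p) p n k) (digitFill p n r) := by
  refine commute_shiftOp_of_digits (n := n) hk (fun a b hab => by simp only [hab]) (fun a ha => ?_)
  apply add_mul_pow_div
  have hp := (Fact.out : p.Prime)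
  have h : ((a / p ^ r : ℕ) : ZMod p) = 0 := by
    by_contra h
    exact ha (if_neg h)
  obtain ⟨y, hy⟩ := (ZMod.natCast_eq_zero_iff _ _).1 h
  rw [hy, Nat.mul_div_cancel_left _ hp.pos, Nat.mul_add_div hp.pos,
    Nat.div_eq_of_lt (Nat.sub_lt hp.pos one_pos), add_zero]

end charP

end BGa

namespace BGa

/-! ### The structure constants -/

/-- The coefficient in `γ_{p^k}(t) ^ p = c_k γ_{p^{k+1}}(t)`. -/
def primeCoeff (p k : ℕ) : ℤ := ∏ i ∈ Finset.range p, (((i + 1) * p ^ k).choose (p ^ k) : ℤ)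

theorem hasseP_pow_prime {R : Type*} [CommRing R] (p n k : ℕ) :
    hasseP R p n k ^ p = primeCoeff p k • hasseP R p n (k + 1) := by
  rw [hasseP, hasse_pow, hasseP, primeCoeff, pow_succ']

/-- The factor with index i < p - 1 is congruent to i + 1 modulo p, hence prime to p. The last
factor C(p^{k+1}, p^k) has p-adic valuation exactly one, so p occurs once in the product. -/
theorem exists_primeCoeff_eq (p : ℕ) [hp : Fact p.Prime] (k : ℕ) :
    ∃ u : ℤ, primeCoeff p k = p * u ∧ IsCoprime u p := by
  have hpp := hp.out
  obtain ⟨q, hq⟩ : ∃ q, p = q + 1 := ⟨p - 1, (Nat.sub_add_cancel hpp.one_le).symm⟩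
  have h1 : ∀ i ∈ Finset.range q, IsCoprime (((i + 1) * p ^ k).choose (p ^ k) : ℤ) p := by
    intro i hi
    rw [Finset.mem_range] at hi
    have h := Choose.choose_pow_mul_pow_mul_modEq_choose_nat (p := p) (k := k) (a := i + 1) (b := 1)
    rw [mul_one, Nat.choose_one_right, mul_comm] at h
    refine Nat.isCoprime_iff_coprime.2 (Nat.Coprime.symm ((Nat.Prime.coprime_iff_not_dvd hpp).2 ?_))
    intro hd
    have := (Nat.modEq_zero_iff_dvd.1 (h.symm.trans (Nat.modEq_zero_iff_dvd.2 hd)))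
    exact absurd (Nat.le_of_dvd (by omega) this) (by omega)
  obtain ⟨m, hm⟩ : p ∣ (p ^ (k + 1)).choose (p ^ k) :=
    hpp.dvd_choose_pow (pow_pos hpp.pos k).ne' (Nat.pow_lt_pow_right hpp.one_lt k.lt_succ_self).ne
  have h2 : IsCoprime (m : ℤ) p := by
    refine Nat.isCoprime_iff_coprime.2 (Nat.Coprime.symm ((Nat.Prime.coprime_iff_not_dvd hpp).2 ?_))
    rintro ⟨l, rfl⟩
    have h := hpp.emultiplicity_choose_prime_pow (n := k + 1) (k := p ^ k)
      (Nat.pow_le_pow_right hpp.pos k.le_succ) (pow_pos hpp.pos k).ne'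
    rw [multiplicity_pow_self_of_prime hpp.prime, Nat.add_sub_cancel_left] at h
    have h3 : ¬ p ^ (1 + 1) ∣ (p ^ (k + 1)).choose (p ^ k) :=
      fun h' => absurd (le_emultiplicity_of_pow_dvd h') (by rw [h]; norm_num)
    exact h3 ⟨l, by rw [hm]; ring⟩
  refine ⟨(∏ i ∈ Finset.range q, (((i + 1) * p ^ k).choose (p ^ k) : ℤ)) * m, ?_,
    (IsCoprime.prod_left h1).mul_left h2⟩
  have h3 : primeCoeff p k = (∏ i ∈ Finset.range q, (((i + 1) * p ^ k).choose (p ^ k) : ℤ)) *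
      ((q + 1) * p ^ k).choose (p ^ k) := by
    rw [primeCoeff, ← Finset.prod_range_succ, ← hq]
  rw [h3, ← hq, ← pow_succ', hm]
  push_cast
  ring

/-! ### Weights -/

namespace Tate

/-- The weight of a monomial: `λ_k` has weight `p ^ k` and `F_k` has weight `p ^ (k + 1)`. -/
def wt (p : ℕ) (j : TateIndex) : ℕ := ∑ k ∈ j.1, p ^ k + j.2.sum fun k a => a * p ^ (k + 1)

theorem wt_symmDiff_of_mem (p : ℕ) {j : TateIndex} {k : ℕ} (h : k ∈ j.1) :
    wt p (symmDiff j.1 {k}, j.2) + p ^ k = wt p j := by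
  have : symmDiff j.1 {k} = j.1.erase k := by
    ext x
    simp only [Finset.mem_symmDiff, Finset.mem_singleton, Finset.mem_erase]
    grind
  rw [wt, wt, this, ← Finset.sum_erase_add _ _ h]
  dsimp only
  ring

theorem wt_symmDiff_of_notMem (p : ℕ) {j : TateIndex} {k : ℕ} (h : k ∉ j.1) :
    wt p (symmDiff j.1 {k}, j.2) = wt p j + p ^ k := by
  have h' : k ∈ symmDiff j.1 {k} := by simp [Finset.mem_symmDiff, h]
  have := wt_symmDiff_of_mem p (j := (symmDiff j.1 {k}, j.2)) h'
  rw [← this]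
  simp

theorem wt_add_single (p : ℕ) (j : TateIndex) (k : ℕ) :
    wt p (j.1, j.2 + Finsupp.single k 1) = wt p j + p ^ (k + 1) := by
  rw [wt, wt, Finsupp.sum_add_index' (by simp) (by intros; ring), Finsupp.sum_single_index (by simp)]
  ring

section weight

variable {P : Type*} [AddCommGroup P] (p : ℕ) (S : ℤ → AddSubgroup P)

/-- The families of weight `d`, with respect to a family `S` of subgroups of the coefficients. -/
def weight (d : ℤ) : AddSubgroup (TateIndex → P) where
  carrier := {m | ∀ j, m j ∈ S (d - wt p j)}
  zero_mem' _ := zero_mem _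
  add_mem' h h' j := add_mem (h j) (h' j)
  neg_mem' h j := neg_mem (h j)

variable {p S}

theorem mem_weight {d : ℤ} {m : TateIndex → P} : m ∈ weight p S d ↔ ∀ j, m j ∈ S (d - wt p j) :=
  Iff.rfl

variable {d d' : ℤ} {m : TateIndex → P}

theorem lam_mem_weight (k : ℕ) (h : d' = d + p ^ k) (hm : m ∈ weight p S d) :
    lam (P := P) k m ∈ weight p S d' := by
  intro j
  rw [lam, Module.End.mul_apply, occupied_apply]
  split_ifs with hk
  · rw [toggle_apply]
    refine zsmul_mem ?_ _
    convert hm (symmDiff j.1 {k}, j.2) using 2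
    rw [h, ← wt_symmDiff_of_mem p hk]
    push_cast
    ring
  · exact zero_mem _

theorem iota_mem_weight (k : ℕ) (h : d' = d - p ^ k) (hm : m ∈ weight p S d) :
    iota (P := P) k m ∈ weight p S d' := by
  intro j
  rw [iota, Module.End.mul_apply, LinearMap.sub_apply, Pi.sub_apply, Module.End.one_apply,
    occupied_apply]
  split_ifs with hk
  · rw [sub_self]; exact zero_mem _
  · rw [toggle_apply, sub_zero]
    refine zsmul_mem ?_ _
    convert hm (symmDiff j.1 {k}, j.2) using 2
    rw [h, wt_symmDiff_of_notMem p hk]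
    push_cast
    ring

theorem raise_mem_weight (k : ℕ) (h : d' = d + p ^ (k + 1)) (hm : m ∈ weight p S d) :
    raise (P := P) k m ∈ weight p S d' := by
  intro j
  rw [raise_apply]
  split_ifs with hk
  · exact zero_mem _
  · convert hm (j.1, j.2 - Finsupp.single k 1) using 2
    have := wt_add_single p (j.1, j.2 - Finsupp.single k 1) k
    dsimp only at this
    rw [tsub_add_cancel_of_le (by rw [Finsupp.single_le_iff]; omega)] at this
    rw [h, show j = (j.1, j.2) from rfl, this]
    push_cast
    ring

theorem lower_mem_weight (k : ℕ) (h : d' = d - p ^ (k + 1)) (hm : m ∈ weight p S d) :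
    lower (P := P) k m ∈ weight p S d' := by
  intro j
  rw [lower_apply]
  convert hm (j.1, j.2 + Finsupp.single k 1) using 2
  rw [h, wt_add_single]
  push_cast
  ring

theorem coeffOp_mem_weight {t : Module.End ℤ P} (w : ℤ) (ht : ∀ i, ∀ x ∈ S i, t x ∈ S (i + w))
    (h : d' = d + w) (hm : m ∈ weight p S d) : coeffOp t m ∈ weight p S d' := by
  intro j
  rw [h, show d + w - wt p j = d - wt p j + w by ring]
  exact ht _ _ (hm j)

theorem mapCoeff_mem_weight {P' : Type*} [AddCommGroup P'] {S' : ℤ → AddSubgroup P'} {g : P →+ P'}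
    (hg : ∀ i, ∀ x ∈ S i, g x ∈ S' i) (hm : m ∈ weight p S d) : mapCoeff g m ∈ weight p S' d :=
  fun j => hg _ _ (hm j)

theorem pow_mem_of_shift {t : Module.End ℤ P} (w : ℤ) (ht : ∀ i, ∀ x ∈ S i, t x ∈ S (i + w))
    (e : ℕ) : ∀ i, ∀ x ∈ S i, (t ^ e) x ∈ S (i + e * w) := by
  induction e with
  | zero => intro i x hx; simpa using hx
  | succ e ih =>
    intro i x hx
    rw [pow_succ', Module.End.mul_apply]
    convert ht _ _ (ih i x hx) using 2
    push_cast
    ring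

/-- The weights balance: -p^k + p^k for t_k λ_k, then p^{k+1} - (p - 1) p^k - p^k for F_k t_k^{p-1}
ι_k, and p^{k+1} - p^{k+1} for F_k ι_{k+1}. -/
theorem tateDiff_mem_weight {t : ℕ → Module.End ℤ P}
    (ht : ∀ k i, ∀ x ∈ S i, t k x ∈ S (i + -(p : ℤ) ^ k)) (hp : p ≠ 0) (c : ℕ → ℤ) (N : ℕ)
    (hm : m ∈ weight p S d) : tateDiff t (p - 1) c N m ∈ weight p S d := by
  rw [tateDiff, LinearMap.add_apply, LinearMap.sum_apply, LinearMap.sum_apply]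
  refine add_mem (sum_mem fun k _ => ?_) (sum_mem fun k _ => ?_)
  · exact coeffOp_mem_weight (d := d + p ^ k) _ (ht k) (by ring) (lam_mem_weight k rfl hm)
  · refine raise_mem_weight k (d := d - p ^ (k + 1)) (by ring) (sub_mem ?_ (zsmul_mem ?_ _))
    · refine coeffOp_mem_weight _ (pow_mem_of_shift _ (ht k) _) ?_ (iota_mem_weight k rfl hm)
      rw [Nat.cast_sub (Nat.one_le_iff_ne_zero.2 hp)]
      push_cast
      ring
    · exact iota_mem_weight _ rfl hm

theorem constDiff_mem_weight (u : ℕ → ℤ) (N : ℕ) (hm : m ∈ weight p S d) :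
    constDiff (P := P) u N m ∈ weight p S d := by
  rw [constDiff, LinearMap.sum_apply]
  refine sum_mem fun k _ => zsmul_mem ?_ _
  exact raise_mem_weight k (d := d - p ^ (k + 1)) (by ring) (iota_mem_weight (k + 1) rfl hm)

end weight

end Tate

/-- The cochains homogeneous of degree `i`. -/
def homog (R : Type*) [CommRing R] (n : ℕ) (i : ℤ) : AddSubgroup (Cochain R n) where
  -- The degree is an integer since it will be a weight minus the weight of a Tate monomial. When
  -- this is negative the subgroup is zero.
  carrier := {f | ∀ e, f.coeff e ≠ 0 → (e.degree : ℤ) = i}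
  zero_mem' e he := absurd (MvPolynomial.coeff_zero e) he
  add_mem' {f g} hf hg e he := by
    by_cases h : f.coeff e = 0
    · refine hg e fun h' => he ?_
      rw [MvPolynomial.coeff_add, h, h', add_zero]
    · exact hf e h
  neg_mem' {f} hf e he := hf e fun h => he (by rw [MvPolynomial.coeff_neg, h, neg_zero])

/-! ### Homogeneity of the operators and of the cofaces -/

section homog

open MvPolynomial

variable {R : Type*} [CommRing R] {n : ℕ} {i : ℤ}

theorem monomial_mem_homog {e : Fin n →₀ ℕ} {r : R} (h : r ≠ 0 → (e.degree : ℤ) = i) :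
    monomial e r ∈ homog R n i := by
  intro e' he'
  rw [coeff_monomial] at he'
  split_ifs at he' with h'
  · exact h' ▸ h he'
  · exact absurd rfl he'

theorem induction_homog {Q : Cochain R n → Prop} (h0 : Q 0) (hadd : ∀ f g, Q f → Q g → Q (f + g))
    (hm : ∀ e r, (e.degree : ℤ) = i → Q (monomial e r)) {f : Cochain R n} (hf : f ∈ homog R n i) :
    Q f := by
  rw [← support_sum_monomial_coeff f]
  refine Finset.sum_induction _ Q hadd h0 fun e he => hm _ _ (hf e (mem_support_iff.1 he))

theorem mem_homog_iff {d : ℕ} {f : Cochain R n} : f ∈ homog R n d ↔ f.IsHomogeneous d := by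
  have hw : ∀ e : Fin n →₀ ℕ, Finsupp.weight 1 e = e.degree := fun e =>
    (DFunLike.congr_fun Finsupp.degree_eq_weight_one e).symm
  constructor
  · intro h e he
    rw [hw]
    exact_mod_cast h e he
  · intro h e he
    have := h he
    rw [hw] at this
    exact_mod_cast this

theorem shiftOp_mem_homog {c : ℕ → R} {φ : ℕ → ℕ} {w : ℤ}
    (h : ∀ a, c a ≠ 0 → (φ a : ℤ) = a + w) {f : Cochain R (n + 1)} (hf : f ∈ homog R (n + 1) i) :
    shiftOp c φ f ∈ homog R (n + 1) (i + w) := by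
  refine induction_homog (Q := fun f => shiftOp c φ f ∈ _) ?_ (fun f g hf hg => ?_) (fun e r he => ?_) hf
  · rw [map_zero]; exact zero_mem _
  · rw [map_add]; exact add_mem hf hg
  · rw [shiftOp_monomial]
    refine monomial_mem_homog fun hr => ?_
    have h1 := h _ (left_ne_zero_of_mul hr)
    rw [Finsupp.degree_eq_sum, Fin.sum_univ_succ] at he ⊢
    simp only [Finsupp.coe_update, Function.update_self, ne_eq, Fin.succ_ne_zero, not_false_eq_true,
      Function.update_of_ne]
    push_cast at he ⊢
    rw [h1, ← he]
    ring

theorem hasseP_mem_homog (p r : ℕ) {f : Cochain R (n + 1)} (hf : f ∈ homog R (n + 1) i) :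
    hasseP R p n r f ∈ homog R (n + 1) (i + -(p : ℤ) ^ r) := by
  rw [hasseP, hasse]
  refine shiftOp_mem_homog (fun a ha => ?_) hf
  have : p ^ r ≤ a := by
    by_contra h
    exact ha (by rw [Nat.choose_eq_zero_of_lt (by omega), Nat.cast_zero])
  rw [Nat.cast_sub this]
  push_cast
  ring

theorem aeval_mem_homog {m : ℕ} {g : Fin n → Cochain R m} (hg : ∀ a, g a ∈ homog R m 1)
    {f : Cochain R n} (hf : f ∈ homog R n i) : aeval g f ∈ homog R m i := by
  refine induction_homog (Q := fun f => aeval g f ∈ _) ?_ (fun f g hf hg => ?_) (fun e r he => ?_) hf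
  · rw [map_zero]; exact zero_mem _
  · rw [map_add]; exact add_mem hf hg
  · rw [← he, mem_homog_iff]
    have h := (isHomogeneous_monomial r (d := e) rfl).aeval g
      (fun a => mem_homog_iff.1 (by exact_mod_cast hg a))
    simpa only [Nat.one_mul] using h

theorem map_mem_homog {R' : Type*} [CommRing R'] (φ : R →+* R') {f : Cochain R n}
    (hf : f ∈ homog R n i) : MvPolynomial.map φ f ∈ homog R' n i := fun e he =>
  hf e fun h => he (by rw [coeff_map, h, map_zero])

theorem X_mem_homog (a : Fin n) : (X a : Cochain R n) ∈ homog R n 1 :=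
  monomial_mem_homog fun _ => by simp

theorem coface_mem_homog (a : ℕ) {f : Cochain R n} (hf : f ∈ homog R n i) :
    coface a f ∈ homog R (n + 1) i := by
  refine aeval_mem_homog (fun b => ?_) hf
  rw [face]
  split_ifs
  exacts [X_mem_homog _, add_mem (X_mem_homog _) (X_mem_homog _), X_mem_homog _]

end homog

end BGa

namespace BGa

/-! ### The shifted complex -/

section decalage

open MvPolynomial

variable {R : Type*} [CommRing R]

/-- The differential of the shifted complex `𝒪(𝔾ₐ^{n+1})`, obtained by omitting the first coface. -/
noncomputable def shiftDiff (n : ℕ) : Cochain R (n + 1) →+ Cochain R (n + 2) :=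
  ∑ i ∈ Finset.range (n + 2), (-1 : ℤ) ^ i • (coface (k := R) (n := n + 1) (i + 1) : _ →+ _)

theorem shiftDiff_apply {n : ℕ} (f : Cochain R (n + 1)) :
    shiftDiff n f = ∑ i ∈ Finset.range (n + 2), (-1 : ℤ) ^ i • coface (i + 1) f := by
  simp [shiftDiff, AddMonoidHom.finsetSum_apply]

theorem shiftDiff_eq {n : ℕ} (f : Cochain R (n + 1)) :
    shiftDiff n f = coface 0 f - diff (n + 1) f := by
  rw [shiftDiff_apply, diff_apply, Finset.sum_range_succ' _ (n + 2)]
  simp [pow_succ]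

/-- By the cosimplicial identity d⁰ dⁱ = d^{i+1} d⁰, the functions independent of x₀ form a copy of
the standard complex inside the shifted one. -/
theorem shiftDiff_coface_zero {n : ℕ} (f : Cochain R n) :
    shiftDiff n (coface 0 f) = coface 0 (diff n f) := by
  rw [shiftDiff_apply, diff_apply, map_sum]
  refine Finset.sum_congr rfl fun i _ => ?_
  rw [map_zsmul, ← coface_coface (Nat.zero_le i)]

theorem shiftDiff_shiftDiff {n : ℕ} (f : Cochain R (n + 1)) :
    shiftDiff (n + 1) (shiftDiff n f) = 0 := by
  have h := shiftDiff_coface_zero f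
  rw [shiftDiff_eq f, map_sub, shiftDiff_coface_zero, shiftDiff_eq, diff_diff, sub_zero, sub_self]

theorem shiftDiff_hasseP (p r : ℕ) {n : ℕ} (f : Cochain R (n + 1)) :
    shiftDiff n (hasseP R p n r f) = hasseP R p (n + 1) r (shiftDiff n f) := by
  rw [shiftDiff_apply, shiftDiff_apply, map_sum]
  refine Finset.sum_congr rfl fun i _ => ?_
  rw [map_zsmul, hasseP, hasseP, hasse_coface]

/-- Setting the first variable to zero. -/
noncomputable def dropFirst (n : ℕ) : Cochain R (n + 1) →ₐ[R] Cochain R n :=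
  aeval (Fin.cons 0 X)

theorem dropFirst_coface_zero {n : ℕ} (f : Cochain R n) : dropFirst n (coface 0 f) = f := by
  have : (dropFirst n).comp (coface 0) = AlgHom.id R (Cochain R n) := by
    ext j : 1
    simp [dropFirst, coface, face]
  exact DFunLike.congr_fun this f

theorem dropFirst_coface_one {n : ℕ} (f : Cochain R (n + 1)) :
    dropFirst (n + 1) (coface 1 f) = f := by
  have : (dropFirst (n + 1)).comp (coface 1) = AlgHom.id R (Cochain R (n + 1)) := by
    ext j : 1
    refine Fin.cases ?_ (fun j => ?_) j
    · simp [dropFirst, coface, face]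
    · simp [dropFirst, coface, face]
  exact DFunLike.congr_fun this f

theorem dropFirst_coface_succ {n : ℕ} (i : ℕ) (f : Cochain R (n + 1)) :
    dropFirst (n + 1) (coface (i + 2) f) = coface (i + 1) (dropFirst n f) := by
  have : (dropFirst (n + 1)).comp (coface (i + 2)) =
      (coface (i + 1)).comp (dropFirst n : Cochain R (n + 1) →ₐ[R] _) := by
    ext j : 1
    refine Fin.cases ?_ (fun j => ?_) j
    · simp [dropFirst, coface, face]
    · simp only [dropFirst, coface, face, AlgHom.comp_apply, aeval_X, Fin.val_succ, Fin.cons_succ,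
        Nat.add_lt_add_iff_right, Nat.add_right_cancel_iff, ← Fin.succ_castSucc]
      split_ifs <;> simp
  exact DFunLike.congr_fun this f

/-- Setting x₀ = 0 is an extra degeneracy: it undoes the first coface and commutes with the others
up to a shift of index, so it is a contracting homotopy of the shifted complex. -/
theorem dropFirst_shiftDiff {n : ℕ} (f : Cochain R (n + 2)) :
    dropFirst (n + 2) (shiftDiff (n + 1) f) = f - shiftDiff n (dropFirst (n + 1) f) := by
  rw [shiftDiff_apply, shiftDiff_apply, map_sum, Finset.sum_range_succ']
  simp only [map_zsmul, dropFirst_coface_succ, zero_add, pow_zero, one_smul, dropFirst_coface_one,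
    pow_succ, mul_neg_one, neg_smul, map_neg, Finset.sum_neg_distrib]
  abel

/-- At the start of the complex the homotopy misses the constants, which are the cohomology of the
shifted complex. -/
theorem dropFirst_shiftDiff_zero (f : Cochain R 1) :
    dropFirst 1 (shiftDiff 0 f) = f - coface 0 (dropFirst 0 f) := by
  have h : ∀ g : Cochain R 0, coface 1 g = coface 0 g := by
    intro g
    have : (coface 1 : Cochain R 0 →ₐ[R] _) = coface 0 := by
      ext j : 1
      exact j.elim0
    rw [this]
  rw [shiftDiff_apply, map_sum, Finset.sum_range_succ, Finset.sum_range_one]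
  simp only [zero_add, pow_zero, one_smul, dropFirst_coface_one, pow_one, neg_smul, map_neg,
    dropFirst_coface_succ, h]
  abel

theorem exists_shiftDiff_eq {n : ℕ} {f : Cochain R (n + 2)} (h : shiftDiff (n + 1) f = 0) :
    f = shiftDiff n (dropFirst (n + 1) f) := by
  have := dropFirst_shiftDiff f
  rw [h, map_zero] at this
  exact (sub_eq_zero.1 this.symm)

theorem eq_coface_zero {f : Cochain R 1} (h : shiftDiff 0 f = 0) :
    f = coface 0 (dropFirst 0 f) := by
  have := dropFirst_shiftDiff_zero f
  rw [h, map_zero] at this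
  exact (sub_eq_zero.1 this.symm)

theorem coface_zero_injective {n : ℕ} :
    Function.Injective (coface 0 : Cochain R n → Cochain R (n + 1)) :=
  Function.LeftInverse.injective dropFirst_coface_zero

/-- A cocycle that becomes independent of its first variable modulo coboundaries of the shifted
complex is a coboundary. -/
theorem eq_diff_of_sub_shiftDiff {n : ℕ} {f : Cochain R (n + 2)} (hf : diff (n + 2) f = 0)
    {g : Cochain R (n + 1)} {g' : Cochain R (n + 1)} (h : f - shiftDiff n g = coface 0 g') :
    f = diff (n + 1) g' := by
  -- A cocycle satisfies `shiftDiff f = coface 0 f`, so applying the shifted differential to `h`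
  -- turns it into the zeroth coface of the desired equality.
  apply coface_zero_injective
  rw [← shiftDiff_coface_zero, ← h, map_sub, shiftDiff_shiftDiff, sub_zero, shiftDiff_eq, hf,
    sub_zero]

variable {i : ℤ}

theorem dropFirst_mem_homog {n : ℕ} {f : Cochain R (n + 1)} (hf : f ∈ homog R (n + 1) i) :
    dropFirst n f ∈ homog R n i := by
  refine aeval_mem_homog (fun b => ?_) hf
  refine Fin.cases ?_ (fun j => ?_) b
  · exact zero_mem _
  · exact X_mem_homog j

theorem shiftDiff_mem_homog {n : ℕ} {f : Cochain R (n + 1)} (hf : f ∈ homog R (n + 1) i) :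
    shiftDiff n f ∈ homog R (n + 2) i := by
  rw [shiftDiff_apply]
  exact sum_mem fun a _ => zsmul_mem (coface_mem_homog _ hf) _

theorem coface_zero_eq_rename {n : ℕ} (f : Cochain R n) : coface 0 f = rename Fin.succ f := by
  have : (coface 0 : Cochain R n →ₐ[R] _) = rename Fin.succ := by
    ext a : 1
    simp [coface, face]
  rw [this]

theorem exists_eq_coface_zero {n : ℕ} {f : Cochain R (n + 1)}
    (hf : ∀ e, f.coeff e ≠ 0 → e 0 = 0) : ∃ g, f = coface 0 g := by
  rw [← support_sum_monomial_coeff f]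
  refine Finset.sum_induction _ (fun f : Cochain R (n + 1) => ∃ g, f = coface 0 g) ?_
    ⟨0, (map_zero _).symm⟩ fun e he => ?_
  · rintro _ _ ⟨a, rfl⟩ ⟨b, rfl⟩
    exact ⟨a + b, (map_add _ _ _).symm⟩
  · have h : Finsupp.mapDomain Fin.succ e.tail = e := by
      ext j
      refine Fin.cases ?_ (fun j => ?_) j
      · rw [hf e (mem_support_iff.1 he), Finsupp.mapDomain_of_notMem_range]
        rintro ⟨a, ha⟩
        exact Fin.succ_ne_zero a ha
      · rw [Finsupp.mapDomain_apply (Fin.succ_injective n), Finsupp.tail_apply]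
    exact ⟨monomial e.tail (f.coeff e), by rw [coface_zero_eq_rename, rename_monomial, h]⟩

end decalage

end BGa

namespace BGa

/-! ### The Tate resolution of the trivial module -/

open Tate MvPolynomial

section resolution

variable {R : Type*} [CommRing R] {p n N : ℕ}

/-- The Tate differential with coefficients in `𝒪(𝔾ₐ^{n+1})`. -/
noncomputable def resDiff (R : Type*) [CommRing R] (p n N : ℕ) :
    Module.End ℤ (TateIndex → Cochain R (n + 1)) :=
  tateDiff (hasseP R p n) (p - 1) (primeCoeff p) N

/-- The cochains independent of the first variable. -/
noncomputable def constHom (R : Type*) [CommRing R] (n : ℕ) : Cochain R n →+ Cochain R (n + 1) :=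
  (coface 0 : Cochain R n →ₐ[R] _).toRingHom.toAddMonoidHom

theorem constHom_apply (f : Cochain R n) : constHom R n f = coface 0 f := rfl

/-- The family supported at the trivial monomial. -/
def baseHom (P : Type*) [AddCommGroup P] : P →+ (TateIndex → P) :=
  AddMonoidHom.single (fun _ : TateIndex => P) (∅, 0)

/-- The augmentation of the Tate resolution. -/
noncomputable def augment (R : Type*) [CommRing R] (n : ℕ) :
    Cochain R n →+ (TateIndex → Cochain R (n + 1)) :=
  (mapCoeff (constHom R n)).comp (baseHom _)

theorem augment_apply_zero (f : Cochain R n) : augment R n f (∅, 0) = coface 0 f := by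
  simp [augment, baseHom, constHom_apply]

theorem augment_apply_of_ne (f : Cochain R n) {j : TateIndex} (hj : j ≠ (∅, 0)) :
    augment R n f j = 0 := by
  simp [augment, baseHom, constHom_apply, hj]

theorem resDiff_resDiff (hp : p.Prime) (m : TateIndex → Cochain R (n + 1)) :
    resDiff R p n N (resDiff R p n N m) = 0 := by
  have h := tateDiff_mul_self (N := N) (t := hasseP R p n) (e := p - 1) (c := primeCoeff p)
    (fun k l => commute_hasse _ _)
    (fun k => by rw [Nat.sub_add_cancel hp.one_le, hasseP_pow_prime])
  exact LinearMap.congr_fun h m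

/-- Functions independent of x₀ have no Taylor coefficient of positive order in x₀. -/
theorem hasseP_coface_zero (hp : p.Prime) (k : ℕ) (f : Cochain R n) :
    hasseP R p n k (coface 0 f) = 0 := by
  have h : ∀ f : Cochain R n, translate (coface 0 f) = Polynomial.C (coface 0 f) := by
    intro f
    have : translate.comp (coface 0 : Cochain R n →ₐ[R] _) = Polynomial.CAlgHom.comp
        (coface 0 : Cochain R n →ₐ[R] _) := by
      ext a : 1
      simp [coface, face, translate]
    exact DFunLike.congr_fun this f
  rw [hasseP, hasse_eq_coeff, h, Polynomial.coeff_C_of_ne_zero (pow_pos hp.pos k).ne']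

/-- On families independent of x₀ all the t_k vanish, and only the terms with c_k = p u_k survive.
This factor `p` is the source of the torsion in the cohomology. -/
theorem resDiff_mapCoeff_coface_zero (hp : p.Prime) {u : ℕ → ℤ}
    (hu : ∀ k, primeCoeff p k = p * u k) (κ : TateIndex → Cochain R n) :
    resDiff R p n N (mapCoeff (constHom R n) κ) =
      mapCoeff (constHom R n) (-((p : ℤ) • constDiff (P := Cochain R n) u N κ)) := by
  have h := tateDiff_zero (P := Cochain R n) (N := N) u (Nat.sub_pos_of_lt hp.one_lt).ne' p
  rw [← funext hu] at h
  have h' : tateDiff (fun _ => (0 : Module.End ℤ (Cochain R n))) (p - 1) (primeCoeff p) N κ =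
      -((p : ℤ) • constDiff (P := Cochain R n) u N κ) := by
    rw [h]; rfl
  rw [← h', resDiff]
  refine (mapCoeff_tateDiff _ (fun k x => ?_) _ _ _ _).symm
  exact (map_zero _).trans (hasseP_coface_zero hp k x).symm

theorem iota_single {P : Type*} [AddCommGroup P] (k : ℕ) (x : P) :
    iota (P := P) k (baseHom P x) = 0 := by
  ext j
  rw [iota, Module.End.mul_apply, LinearMap.sub_apply, Pi.sub_apply, Module.End.one_apply,
    occupied_apply]
  split_ifs with hk
  · rw [sub_self]; rfl
  · have : (symmDiff j.1 {k}, j.2) ≠ ((∅, 0) : TateIndex) := by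
      intro h
      have h1 : k ∈ symmDiff j.1 {k} := by simp [Finset.mem_symmDiff, hk]
      rw [(Prod.mk.inj h).1] at h1
      simp at h1
    rw [toggle_apply, sub_zero, baseHom, AddMonoidHom.single_apply, Pi.single_eq_of_ne this, smul_zero]
    rfl

theorem constDiff_single {P : Type*} [AddCommGroup P] (u : ℕ → ℤ) (x : P) :
    constDiff (P := P) u N (baseHom P x) = 0 := by
  simp [constDiff, LinearMap.sum_apply, iota_single]

theorem resDiff_augment [hp : Fact p.Prime] (f : Cochain R n) :
    resDiff R p n N (augment R n f) = 0 := by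
  choose u hu _ using exists_primeCoeff_eq p
  have h := resDiff_mapCoeff_coface_zero (N := N) hp.out hu
    (baseHom _ f)
  rw [constDiff_single, smul_zero, neg_zero, map_zero] at h
  exact h

theorem resDiff_apply_zero (m : TateIndex → Cochain R (n + 1)) : resDiff R p n N m (∅, 0) = 0 :=
  tateDiff_apply_zero _ _ _ _ _

/-- The divided derivatives commute with all cofaces but the zeroth. This is why the double complex
is built on the shifted complex. -/
theorem mapCoeff_shiftDiff_resDiff (m : TateIndex → Cochain R (n + 1)) :
    mapCoeff (shiftDiff n) (resDiff R p n N m) = resDiff R p (n + 1) N (mapCoeff (shiftDiff n) m) :=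
  mapCoeff_tateDiff _ (fun _ _ => shiftDiff_hasseP p _ _) _ _ _ _

theorem mapCoeff_map_resDiff {R' : Type*} [CommRing R'] (g : R →+* R')
    (m : TateIndex → Cochain R (n + 1)) :
    mapCoeff (MvPolynomial.map g : _ →+* _).toAddMonoidHom (resDiff R p n N m) =
      resDiff R' p n N (mapCoeff (MvPolynomial.map g : _ →+* _).toAddMonoidHom m) :=
  mapCoeff_tateDiff _ (fun _ _ => hasse_map g _ _) _ _ _ _

theorem mapCoeff_shiftDiff_augment (f : Cochain R n) :
    mapCoeff (shiftDiff n) (augment R n f) = augment R (n + 1) (diff n f) := by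
  ext1 j
  rw [mapCoeff_apply]
  by_cases hj : j = (∅, 0)
  · rw [hj, augment_apply_zero, augment_apply_zero, shiftDiff_coface_zero]
  · rw [augment_apply_of_ne _ hj, augment_apply_of_ne _ hj, map_zero]

/-- The elements of weight `d` of the Tate resolution. -/
noncomputable abbrev resWeight (R : Type*) [CommRing R] (p n : ℕ) (d : ℤ) :
    AddSubgroup (TateIndex → Cochain R n) := weight p (homog R n) d

variable {d : ℕ}

theorem resDiff_mem_weight (hp : p.Prime) {m : TateIndex → Cochain R (n + 1)}
    (hm : m ∈ resWeight R p (n + 1) d) : resDiff R p n N m ∈ resWeight R p (n + 1) d :=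
  tateDiff_mem_weight (fun k _ _ hx => hasseP_mem_homog p k hx) hp.ne_zero _ _ hm

theorem wt_eq_zero : wt p (∅, 0) = 0 := by simp [wt]

theorem augment_mem_weight {f : Cochain R n} (hf : f ∈ homog R n d) :
    augment R n f ∈ resWeight R p (n + 1) d := by
  intro j
  by_cases hj : j = (∅, 0)
  · rw [hj, augment_apply_zero, wt_eq_zero, Nat.cast_zero, sub_zero]
    exact coface_mem_homog _ hf
  · rw [augment_apply_of_ne _ hj]
    exact zero_mem _

theorem eq_zero_of_mem_homog_of_neg {f : Cochain R n} {i : ℤ} (hf : f ∈ homog R n i) (hi : i < 0) :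
    f = 0 := by
  ext e
  rw [coeff_zero]
  by_contra h
  have := hf e h
  omega

theorem eq_zero_of_lt_wt {m : TateIndex → Cochain R n} (hm : m ∈ resWeight R p n d) {j : TateIndex}
    (hj : d < wt p j) : m j = 0 :=
  eq_zero_of_mem_homog_of_neg (hm j) (by omega)

theorem pow_le_wt {j : TateIndex} {k : ℕ} (h : k ∈ j.1) : p ^ k ≤ wt p j :=
  (Finset.single_le_sum (f := fun k => p ^ k) (fun _ _ => Nat.zero_le _) h).trans
    (Nat.le_add_right _ _)

theorem mul_pow_le_wt (j : TateIndex) (k : ℕ) : j.2 k * p ^ (k + 1) ≤ wt p j := by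
  refine le_trans ?_ (Nat.le_add_left _ _)
  by_cases h : k ∈ j.2.support
  · exact Finset.single_le_sum (f := fun k => j.2 k * p ^ (k + 1)) (fun _ _ => Nat.zero_le _) h
  · rw [Finsupp.notMem_support_iff.1 h, zero_mul]
    exact Nat.zero_le _

/-- If the weight is less than `p ^ N`, the monomials of a nonzero coefficient involve only
generators with index less than `N`. -/
theorem eq_zero_of_index (hp : p.Prime) (hN : d < p ^ N) {m : TateIndex → Cochain R n}
    (hm : m ∈ resWeight R p n d) {j : TateIndex} {s : ℕ} (hs : N ≤ s) (h : s ∈ j.1 ∨ j.2 s ≠ 0) :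
    m j = 0 := by
  refine eq_zero_of_lt_wt hm (hN.trans_le ?_)
  rcases h with h | h
  · exact (Nat.pow_le_pow_right hp.pos hs).trans (pow_le_wt h)
  · refine (Nat.pow_le_pow_right hp.pos (by omega : N ≤ s + 1)).trans
      (le_trans ?_ (mul_pow_le_wt j s))
    exact Nat.le_mul_of_pos_left _ (Nat.pos_of_ne_zero h)

/-- A generator of index k has weight at least p^k > k, and an exponent never exceeds the weight it
contributes. Indices and exponents are thereby bounded by `d`. -/
theorem finite_index (p n d : ℕ) [Fact p.Prime] :
    {x : TateIndex × (Fin n →₀ ℕ) | wt p x.1 + x.2.degree = d}.Finite := by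
  have hp := (Fact.out : p.Prime)
  let A : ℕ →₀ ℕ := Finsupp.onFinset (Finset.range (d + 1)) (fun k => if k < d + 1 then d else 0)
    (fun k hk => by simp only [Finset.mem_range]; by_contra h; simp [h] at hk)
  refine (((Finset.finite_toSet (Finset.range (d + 1)).powerset).prod (Set.finite_Icc 0 A)).prod
    (Set.finite_Icc 0 (Finsupp.equivFunOnFinite.symm fun _ : Fin n => d))).subset ?_
  rintro ⟨j, e⟩ h
  have h : wt p j + e.degree = d := h
  refine ⟨⟨?_, ⟨zero_le, fun k => ?_⟩⟩, ⟨zero_le, fun i => ?_⟩⟩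
  · rw [Finset.mem_coe, Finset.mem_powerset]
    intro k hk
    have := (Nat.lt_pow_self hp.one_lt).trans_le (pow_le_wt (p := p) hk)
    rw [Finset.mem_range]
    dsimp only at this
    omega
  · have h1 : j.2 k * p ^ (k + 1) ≤ d := (mul_pow_le_wt (p := p) j k).trans (by omega)
    have h2 := (Nat.lt_succ_self k).trans (Nat.lt_pow_self hp.one_lt (n := k + 1))
    by_cases h0 : j.2 k = 0
    · rw [h0]; exact Nat.zero_le _
    · have h3 : p ^ (k + 1) ≤ j.2 k * p ^ (k + 1) := Nat.le_mul_of_pos_left _ (Nat.pos_of_ne_zero h0)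
      have h4 : j.2 k ≤ j.2 k * p ^ (k + 1) := Nat.le_mul_of_pos_right _ (by omega)
      have h5 : k < d + 1 := by omega
      change j.2 k ≤ if k < d + 1 then d else 0
      rw [if_pos h5]
      omega
  · have := Finsupp.le_degree i e
    change e i ≤ d
    omega

/-- Families are arbitrary functions on monomials, but a fixed weight leaves finitely many integer
coefficients that can be nonzero. This is the finiteness needed for Nakayama. -/
theorem finite_resWeight (p n d : ℕ) [Fact p.Prime] :
    Module.Finite ℤ (AddSubgroup.toIntSubmodule (resWeight ℤ p n d)) := by
  let S := {x : TateIndex × (Fin n →₀ ℕ) | wt p x.1 + x.2.degree = d}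
  have : Finite S := finite_index p n d
  let F : AddSubgroup.toIntSubmodule (resWeight ℤ p n d) →ₗ[ℤ] (S → ℤ) :=
    { toFun := fun m x => coeff x.1.2 (m.1 x.1.1)
      map_add' := fun m m' => by ext x; exact coeff_add _ _ _
      map_smul' := fun c m => by ext x; exact coeff_smul _ _ _ }
  refine Module.Finite.of_injective F ?_
  rw [← LinearMap.ker_eq_bot, LinearMap.ker_eq_bot']
  intro m hm
  refine Subtype.ext (funext fun j => ?_)
  refine MvPolynomial.ext _ _ fun e => ?_
  by_contra h
  have h1 : (e.degree : ℤ) = d - wt p j := m.2 j e (by simpa using h)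
  exact h (congrFun hm ⟨(j, e), show wt p j + e.degree = d by omega⟩)

end resolution

end BGa

namespace BGa

open Tate MvPolynomial

/-! ### Exactness of the Tate resolution modulo `p` -/

section exactness

variable {p n N d : ℕ} [Fact p.Prime]

theorem coeff_digitZero (r : ℕ) (f : Cochain (ZMod p) (n + 1)) (e : Fin (n + 1) →₀ ℕ) :
    coeff e (digitZero p n r f) = if ((e 0 / p ^ r : ℕ) : ZMod p) = 0 then coeff e f else 0 := by
  induction f using MvPolynomial.induction_on' with
  | add f g h1 h2 => rw [map_add, coeff_add, coeff_add, h1, h2]; split_ifs <;> simp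
  | monomial e' r' =>
    rw [digitZero, shiftOp_monomial, id, Finsupp.update_self, coeff_monomial, coeff_monomial]
    by_cases h : e' = e
    · subst h; simp
    · simp [h]

theorem digitUp_mem_homog (r : ℕ) {i : ℤ} {f : Cochain (ZMod p) (n + 1)}
    (hf : f ∈ homog (ZMod p) (n + 1) i) : digitUp p n r f ∈ homog (ZMod p) (n + 1) (i + p ^ r) := by
  rw [digitUp]
  exact shiftOp_mem_homog (fun a _ => by push_cast; ring) hf

theorem digitFill_mem_homog (r : ℕ) {i : ℤ} {f : Cochain (ZMod p) (n + 1)}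
    (hf : f ∈ homog (ZMod p) (n + 1) i) :
    digitFill p n r f ∈ homog (ZMod p) (n + 1) (i + (p - 1) * p ^ r) := by
  rw [digitFill]
  refine shiftOp_mem_homog (fun a _ => ?_) hf
  push_cast [Nat.cast_sub (Fact.out : p.Prime).one_le]
  ring

/-- The contraction of the `r`-th factor of the Tate resolution modulo `p`. -/
noncomputable def resContraction (p n r : ℕ) [Fact p.Prime] :
    Module.End ℤ (TateIndex → Cochain (ZMod p) (n + 1)) :=
  coeffOp (digitUp p n r) * iota r + coeffOp (digitFill p n r) * (lower r * lam r)

theorem resContraction_mem_weight (r : ℕ) {m : TateIndex → Cochain (ZMod p) (n + 1)}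
    (hm : m ∈ resWeight (ZMod p) p (n + 1) d) :
    resContraction p n r m ∈ resWeight (ZMod p) p (n + 1) d := by
  have hU : ∀ i, ∀ x ∈ homog (ZMod p) (n + 1) i,
      digitUp p n r x ∈ homog (ZMod p) (n + 1) (i + (p : ℤ) ^ r) :=
    fun i x hx => digitUp_mem_homog r hx
  have hV : ∀ i, ∀ x ∈ homog (ZMod p) (n + 1) i,
      digitFill p n r x ∈ homog (ZMod p) (n + 1) (i + ((p : ℤ) - 1) * (p : ℤ) ^ r) :=
    fun i x hx => digitFill_mem_homog r hx
  have h1 : iota (P := Cochain (ZMod p) (n + 1)) r m ∈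
      resWeight (ZMod p) p (n + 1) (d - (p : ℤ) ^ r) := iota_mem_weight r rfl hm
  have h2 : lower (P := Cochain (ZMod p) (n + 1)) r (lam (P := Cochain (ZMod p) (n + 1)) r m) ∈
      resWeight (ZMod p) p (n + 1) (d + (p : ℤ) ^ r - (p : ℤ) ^ (r + 1)) :=
    lower_mem_weight r rfl (lam_mem_weight r rfl hm)
  rw [resContraction, LinearMap.add_apply, Module.End.mul_apply, Module.End.mul_apply,
    Module.End.mul_apply]
  generalize digitUp p n r = U at hU
  generalize digitFill p n r = V at hV
  exact add_mem (coeffOp_mem_weight ((p : ℤ) ^ r) hU (by ring) h1)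
    (coeffOp_mem_weight (((p : ℤ) - 1) * (p : ℤ) ^ r) hV (by ring) h2)

/-- Modulo p the constants c_k act by zero, so the r-th factor decouples and the homotopy formula
applies. On a cocycle it leaves the projection onto monomials with neither λ_r nor F_r and with
vanishing r-th digit of the exponent of x₀. -/
theorem resDiff_resContraction {r : ℕ} (hr : r < N) {m : TateIndex → Cochain (ZMod p) (n + 1)}
    (hm : resDiff (ZMod p) p n N m = 0) :
    m - resDiff (ZMod p) p n N (resContraction p n r m) =
      fun j => if r ∈ j.1 ∨ j.2 r ≠ 0 then 0 else digitZero p n r (m j) := by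
  have hc : ∀ k, primeCoeff p k • (1 : Module.End ℤ (Cochain (ZMod p) (n + 1))) = 0 := by
    intro k
    obtain ⟨u, hu, -⟩ := exists_primeCoeff_eq p k
    have h : ((p : ℤ) • (1 : Module.End ℤ (Cochain (ZMod p) (n + 1)))) = 0 := by
      refine LinearMap.ext fun x => MvPolynomial.ext _ _ fun e => ?_
      simp
    rw [hu, mul_comm, mul_smul, h, smul_zero]
  have h := LinearMap.congr_fun (anticomm_tateDiff_contraction (e := p - 1) hc hr
    (hasseP_mul_digitUp_add (n := n) r) (digitUp_mul_hasseP r) (hasseP_pow_mul_digitFill r)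
    (fun k hk => commute_hasseP_digitUp hk) (fun k hk => commute_hasseP_digitFill hk)) m
  rw [anticomm_apply, LinearMap.add_apply, Module.End.mul_apply, Module.End.mul_apply,
    LinearMap.sub_apply, Module.End.one_apply] at h
  change resDiff (ZMod p) p n N (resContraction p n r m) +
    resContraction p n r (resDiff (ZMod p) p n N m) = _ at h
  rw [hm, map_zero, add_zero] at h
  rw [h, sub_sub_cancel]
  ext1 j
  rw [Module.End.mul_apply, coeffOp_apply, Module.End.mul_apply, vacant_apply, LinearMap.sub_apply,
    Pi.sub_apply, occupied_apply, Module.End.one_apply]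
  by_cases h1 : r ∈ j.1 <;> by_cases h2 : j.2 r = 0 <;> simp [h1, h2]

theorem eq_zero_of_digits {a : ℕ} (ha : a < p ^ N)
    (h : ∀ s < N, ((a / p ^ s : ℕ) : ZMod p) = 0) : a = 0 := by
  have : ∀ s ≤ N, p ^ s ∣ a := by
    intro s
    induction s with
    | zero => intro _; rw [pow_zero]; exact one_dvd a
    | succ s ih =>
      intro hs
      obtain ⟨b, rfl⟩ := ih (by omega)
      have h' := h s (by omega)
      rw [Nat.mul_div_cancel_left _ (pow_pos (Fact.out : p.Prime).pos s),
        ZMod.natCast_eq_zero_iff] at h'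
      rw [pow_succ]
      exact Nat.mul_dvd_mul_left _ h'
  exact Nat.eq_zero_of_dvd_of_lt (this N le_rfl) ha

/-- The factors r = 0, …, N - 1 are contracted one after the other. Each step subtracts a boundary
and replaces the cocycle by a projection of itself, so what was achieved for smaller r persists. -/
theorem exists_eq_resDiff_add_modP (hN : d < p ^ N) {m : TateIndex → Cochain (ZMod p) (n + 1)}
    (hm : m ∈ resWeight (ZMod p) p (n + 1) d) (h : resDiff (ZMod p) p n N m = 0) :
    ∃ a ∈ resWeight (ZMod p) p (n + 1) d, ∃ m₀ ∈ resWeight (ZMod p) p (n + 1) d,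
      m = resDiff (ZMod p) p n N a + m₀ ∧ (∀ j, j ≠ (∅, 0) → m₀ j = 0) ∧
        ∀ j e, coeff e (m₀ j) ≠ 0 → e 0 = 0 := by
  have hp := (Fact.out : p.Prime)
  have key : ∀ r ≤ N, ∃ a ∈ resWeight (ZMod p) p (n + 1) d,
      ∃ m₀ ∈ resWeight (ZMod p) p (n + 1) d, m = resDiff (ZMod p) p n N a + m₀ ∧ ∀ s < r, ∀ j,
        (s ∈ j.1 ∨ j.2 s ≠ 0 → m₀ j = 0) ∧
          ∀ e, coeff e (m₀ j) ≠ 0 → ((e 0 / p ^ s : ℕ) : ZMod p) = 0 := by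
    intro r
    induction r with
    | zero => exact fun _ => ⟨0, zero_mem _, m, hm, by rw [map_zero, zero_add], by simp⟩
    | succ r ih =>
      intro hr
      obtain ⟨a, ha, m₀, hm₀, rfl, hs⟩ := ih (by omega)
      rw [map_add, resDiff_resDiff hp, zero_add] at h
      have e := resDiff_resContraction (by omega : r < N) h
      have hmem := resContraction_mem_weight r hm₀
      refine ⟨a + resContraction p n r m₀, add_mem ha hmem,
        m₀ - resDiff (ZMod p) p n N (resContraction p n r m₀),
        sub_mem hm₀ (resDiff_mem_weight hp hmem), ?_, ?_⟩
      · rw [map_add, add_assoc, add_sub_cancel]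
      · intro s hsr j
        rw [e]
        dsimp only
        rcases Nat.lt_succ_iff_lt_or_eq.1 hsr with hsr | rfl
        · refine ⟨fun h => ?_, fun e he => ?_⟩
          · rw [(hs s hsr j).1 h, map_zero, ite_self]
          · refine (hs s hsr j).2 e fun h => he ?_
            split_ifs
            · rw [coeff_zero]
            · rw [coeff_digitZero, h, ite_self]
        · refine ⟨fun h => if_pos h, fun e he => ?_⟩
          by_contra h
          refine he ?_
          split_ifs
          · rw [coeff_zero]
          · rw [coeff_digitZero, if_neg h]
  obtain ⟨a, ha, m₀, hm₀, hm', hs⟩ := key N le_rfl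
  refine ⟨a, ha, m₀, hm₀, hm', fun j hj => ?_, fun j e he => ?_⟩
  · have : ∃ s, s ∈ j.1 ∨ j.2 s ≠ 0 := by
      by_contra! h
      refine hj (Prod.ext ?_ ?_)
      · exact Finset.eq_empty_of_forall_notMem fun s => (h s).1
      · exact Finsupp.ext fun s => (h s).2
    obtain ⟨s, h⟩ := this
    -- Generators of index at least `N` are not contracted, but they weigh at least p^N > d and
    -- cannot occur.
    rcases lt_or_ge s N with hsN | hsN
    · exact (hs s hsN j).1 h
    · exact eq_zero_of_index hp hN hm₀ hsN h
  · refine eq_zero_of_digits (p := p) (N := N) ?_ fun s hsN => (hs s hsN j).2 e he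
    have h1 := hm₀ j e he
    have h2 := Finsupp.le_degree 0 e
    omega

/-- Lifting coefficient by coefficient does not enlarge the support, so weights and vanishing
conditions pass to the lift. -/
theorem exists_lift_coeff (f : Cochain (ZMod p) n) :
    ∃ g : Cochain ℤ n, MvPolynomial.map (Int.castRingHom (ZMod p)) g = f ∧
      ∀ e, coeff e g ≠ 0 → coeff e f ≠ 0 := by
  choose c hc using ZMod.intCast_surjective (n := p)
  refine ⟨∑ e ∈ f.support, monomial e (c (coeff e f)), ?_, fun e he h => he ?_⟩
  · rw [map_sum]
    conv_rhs => rw [← support_sum_monomial_coeff f]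
    exact Finset.sum_congr rfl fun e _ => by rw [map_monomial, eq_intCast, hc]
  · rw [coeff_sum]
    refine Finset.sum_eq_zero fun e' he' => ?_
    rw [coeff_monomial, if_neg]
    rintro rfl
    exact mem_support_iff.1 he' h

/-- Reduction modulo `p` of the Tate resolution. -/
noncomputable def resReduce (p n : ℕ) :
    (TateIndex → Cochain ℤ n) →+ (TateIndex → Cochain (ZMod p) n) :=
  mapCoeff (MvPolynomial.map (Int.castRingHom (ZMod p)) : _ →+* _).toAddMonoidHom

theorem exists_lift_family {m : TateIndex → Cochain (ZMod p) n}
    (hm : m ∈ resWeight (ZMod p) p n d) :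
    ∃ m' ∈ resWeight ℤ p n d, resReduce p n m' = m ∧
      ∀ j e, coeff e (m' j) ≠ 0 → coeff e (m j) ≠ 0 := by
  choose g hg hg' using fun j => exists_lift_coeff (m j)
  exact ⟨g, fun j e he => hm j e (hg' j e he), funext hg, hg'⟩

theorem exists_eq_smul_of_resReduce_eq_zero {m : TateIndex → Cochain ℤ n}
    (hm : m ∈ resWeight ℤ p n d) (h : resReduce p n m = 0) :
    ∃ m' ∈ resWeight ℤ p n d, m = (p : ℤ) • m' := by
  have h' : ∀ j, ∃ g, m j = (p : ℤ) • g := by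
    intro j
    obtain ⟨g, hg⟩ := (MvPolynomial.C_dvd_iff_zmod p (m j)).2 (congrFun h j)
    exact ⟨g, by rw [hg, zsmul_eq_mul]; simp⟩
  choose g hg using h'
  refine ⟨g, fun j e he => hm j e ?_, funext hg⟩
  rw [hg, coeff_smul, smul_eq_mul]
  exact mul_ne_zero (Int.natCast_ne_zero.2 (Fact.out : p.Prime).ne_zero) he

theorem smul_family_injective {a : ℤ} (ha : a ≠ 0) {m m' : TateIndex → Cochain ℤ n}
    (h : a • m = a • m') : m = m' :=
  funext fun j => MvPolynomial.ext _ _ fun e => by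
    have h' := congrArg (coeff e) (congrFun h j)
    rw [Pi.smul_apply, Pi.smul_apply, coeff_smul, coeff_smul, smul_eq_mul, smul_eq_mul] at h'
    exact mul_left_cancel₀ ha h'

/-- Modulo `p`, the Tate resolution is exact in positive degrees. -/
theorem exists_eq_resDiff_add_smul (hN : d < p ^ N) {m : TateIndex → Cochain ℤ (n + 1)}
    (hm : m ∈ resWeight ℤ p (n + 1) d) (h : resDiff ℤ p n N m = 0) :
    ∃ a ∈ resWeight ℤ p (n + 1) d, ∃ b : Cochain ℤ n, ∃ m' ∈ resWeight ℤ p (n + 1) d,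
      m = resDiff ℤ p n N a + augment ℤ n b + (p : ℤ) • m' ∧ resDiff ℤ p n N m' = 0 := by
  have hp := (Fact.out : p.Prime)
  have hnat : ∀ m, resReduce p (n + 1) (resDiff ℤ p n N m) =
      resDiff (ZMod p) p n N (resReduce p (n + 1) m) := mapCoeff_map_resDiff _
  obtain ⟨a₀, ha₀, m₀, hm₀, hsum, h1, h2⟩ := exists_eq_resDiff_add_modP (m := resReduce p (n + 1) m)
    hN (mapCoeff_mem_weight (fun i x hx => map_mem_homog _ hx) hm) (by rw [← hnat, h, map_zero])
  obtain ⟨a, ha, rfl, -⟩ := exists_lift_family ha₀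
  obtain ⟨m₁, hm₁, rfl, h3⟩ := exists_lift_family hm₀
  -- The lift is still supported at the trivial monomial and independent of x₀, which makes it an
  -- augmentation over ℤ.
  obtain ⟨b, hb⟩ : ∃ b, m₁ = augment ℤ n b := by
    obtain ⟨b, hb⟩ := exists_eq_coface_zero (f := m₁ (∅, 0)) fun e he => h2 _ e (h3 _ e he)
    refine ⟨b, funext fun j => ?_⟩
    by_cases hj : j = (∅, 0)
    · rw [hj, augment_apply_zero, hb]
    · rw [augment_apply_of_ne _ hj]
      refine MvPolynomial.ext _ _ fun e => ?_
      rw [coeff_zero]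
      by_contra he
      exact h3 j e he (by rw [h1 j hj, coeff_zero])
  obtain ⟨m', hm', hpm⟩ := exists_eq_smul_of_resReduce_eq_zero (p := p)
    (m := m - (resDiff ℤ p n N a + m₁)) (d := d)
    (sub_mem hm (add_mem (resDiff_mem_weight hp ha) hm₁))
    (by rw [map_sub, map_add, hnat, hsum, sub_self])
  refine ⟨a, ha, b, m', hm', ?_, ?_⟩
  · rw [← hpm, hb]; abel
  · refine smul_family_injective (Int.natCast_ne_zero.2 hp.ne_zero) ?_
    rw [← map_zsmul, ← hpm, map_sub, map_add, h, resDiff_resDiff hp, hb, resDiff_augment]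
    simp

/-- Away from integers prime to `p`, the Tate resolution is exact in positive degrees. -/
theorem exists_smul_eq_resDiff_add (hN : d < p ^ N) {m : TateIndex → Cochain ℤ (n + 1)}
    (hm : m ∈ resWeight ℤ p (n + 1) d) (h : resDiff ℤ p n N m = 0) :
    ∃ M : ℤ, IsCoprime M p ∧ ∃ a ∈ resWeight ℤ p (n + 1) d, ∃ b : Cochain ℤ n,
      M • m = resDiff ℤ p n N a + augment ℤ n b := by
  let W := AddSubgroup.toIntSubmodule (resWeight ℤ p (n + 1) d)
  let Z := W ⊓ LinearMap.ker (resDiff ℤ p n N)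
  let B := W.map (resDiff ℤ p n N) ⊔ LinearMap.range (augment ℤ n).toIntLinearMap
  have : Module.Finite ℤ W := finite_resWeight p (n + 1) d
  have hZ : Z.FG := by
    have : IsNoetherian ℤ W := isNoetherian_of_isNoetherianRing_of_finite ℤ W
    exact isNoetherian_submodule.1 this Z inf_le_left
  -- Nakayama: the cocycles `Z` of weight `d` are finitely generated and contained in `B` + p `Z`,
  -- so some M ≡ 1 mod p carries `Z` into `B`.
  obtain ⟨M, hM, hM'⟩ := Submodule.exists_sub_one_mem_and_smul_eq_zero_of_fg_of_le_smul
    (Ideal.span {(p : ℤ)}) (Z.map B.mkQ) (hZ.map _) (by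
      rintro _ ⟨z, hz, rfl⟩
      obtain ⟨a, ha, b, m', hm', hz', h'⟩ := exists_eq_resDiff_add_smul hN hz.1 hz.2
      have e : B.mkQ z = (p : ℤ) • B.mkQ m' := by
        rw [← map_smul, ← sub_eq_zero, ← map_sub, Submodule.mkQ_apply,
          Submodule.Quotient.mk_eq_zero, hz', add_sub_cancel_right]
        exact add_mem (Submodule.mem_sup_left ⟨a, ha, rfl⟩) (Submodule.mem_sup_right ⟨b, rfl⟩)
      rw [e]
      exact Submodule.smul_mem_smul (Ideal.mem_span_singleton_self _) ⟨m', ⟨hm', h'⟩, rfl⟩)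
  have hq := hM' _ ⟨m, ⟨hm, h⟩, rfl⟩
  rw [← map_smul, Submodule.mkQ_apply, Submodule.Quotient.mk_eq_zero] at hq
  obtain ⟨_, ⟨a, ha, rfl⟩, _, ⟨b, rfl⟩, hab⟩ := Submodule.mem_sup.1 hq
  obtain ⟨c, hc⟩ := Ideal.mem_span_singleton.1 hM
  exact ⟨M, ⟨1, -c, by linear_combination hc⟩, a, ha, b, hab.symm⟩

/-- Up to integers prime to `p`, closed constants of weight at least two are exact. -/
theorem exists_smul_eq_constDiff (hd : 2 ≤ d) (hN : d < p ^ N) {u : ℕ → ℤ}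
    (hu : ∀ k, IsCoprime (u k) p) {κ : TateIndex → Cochain ℤ 0} (hκ : κ ∈ resWeight ℤ p 0 d)
    (h : constDiff (P := Cochain ℤ 0) u N κ = 0) :
    ∃ M : ℤ, IsCoprime M p ∧ ∃ σ ∈ resWeight ℤ p 0 d, M • κ = constDiff (P := Cochain ℤ 0) u N σ := by
  have hp := (Fact.out : p.Prime)
  have hδδ : ∀ x : TateIndex → Cochain ℤ 0, constDiff (P := Cochain ℤ 0) u N (constDiff (P := Cochain ℤ 0) u N x) = 0 := fun x =>
    LinearMap.congr_fun (constDiff_mul_self (P := Cochain ℤ 0) (N := N) u) x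
  -- The Koszul pairs F_s, λ_{s+1} are removed one at a time. Each homotopy is an identity only up
  -- to u_s, which is absorbed into `M`.
  have key : ∀ r ≤ N, ∃ M : ℤ, IsCoprime M p ∧ ∃ σ ∈ resWeight ℤ p 0 d, ∃ κ' ∈ resWeight ℤ p 0 d,
      M • κ = constDiff (P := Cochain ℤ 0) u N σ + κ' ∧ ∀ s < r, ∀ j, s + 1 ∈ j.1 ∨ j.2 s ≠ 0 → κ' j = 0 := by
    intro r
    induction r with
    | zero =>
      exact fun _ => ⟨1, isCoprime_one_left, 0, zero_mem _, κ, hκ, by rw [map_zero, zero_add, one_smul],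
        by simp⟩
    | succ r ih =>
      intro hr
      obtain ⟨M, hM, σ, hσ, κ', hκ', hsum, hs⟩ := ih (by omega)
      have hclosed : constDiff (P := Cochain ℤ 0) u N κ' = 0 := by
        have := congrArg (constDiff (P := Cochain ℤ 0) u N) hsum
        rw [map_smul, h, smul_zero, map_add, hδδ, zero_add] at this
        exact this.symm
      have e := LinearMap.congr_fun (anticomm_constDiff (P := Cochain ℤ 0) u (by omega : r < N)) κ'
      have hmem : (lower r * lam (r + 1) : Module.End ℤ (TateIndex → Cochain ℤ 0)) κ' ∈
          resWeight ℤ p 0 d :=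
        lower_mem_weight r (d := d + p ^ (r + 1)) (by ring) (lam_mem_weight (r + 1) rfl hκ')
      generalize (lower r * lam (r + 1) : Module.End ℤ (TateIndex → Cochain ℤ 0)) = L at e hmem
      rw [anticomm_apply, LinearMap.add_apply, Module.End.mul_apply, Module.End.mul_apply, hclosed,
        map_zero, add_zero, LinearMap.smul_apply, LinearMap.sub_apply, Module.End.one_apply,
        smul_sub] at e
      refine ⟨u r * M, (hu r).mul_left hM, u r • σ + L κ',
        add_mem (zsmul_mem hσ _) hmem,
        u r • (vacant r * (1 - occupied (r + 1)) : Module.End ℤ (TateIndex → Cochain ℤ 0)) κ', ?_, ?_, ?_⟩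
      · have : u r • (vacant r * (1 - occupied (r + 1)) : Module.End ℤ (TateIndex → Cochain ℤ 0)) κ' =
            u r • κ' - constDiff (P := Cochain ℤ 0) u N (L κ') := by rw [e, sub_sub_cancel]
        rw [this]
        exact sub_mem (zsmul_mem hκ' _) (constDiff_mem_weight _ _ hmem)
      · rw [mul_smul, hsum, smul_add, map_add, map_smul, e]
        abel
      · intro s hsr j hj
        rw [Pi.smul_apply, Module.End.mul_apply, vacant_apply, LinearMap.sub_apply, Pi.sub_apply,
          Module.End.one_apply, occupied_apply]
        rcases Nat.lt_succ_iff_lt_or_eq.1 hsr with hsr | rfl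
        · rw [hs s hsr j hj]; simp
        · rcases hj with hj | hj
          · simp [hj]
          · simp [hj]
  obtain ⟨M, hM, σ, hσ, κ', hκ', hsum, hs⟩ := key N le_rfl
  -- Once all F_s and λ_{s+1} are excluded, for large s by weight, only 1 and λ₀ remain. The
  -- coefficients being constants, these live in weights 0 and 1, below `d`.
  suffices κ' = 0 from ⟨M, hM, σ, hσ, by rw [hsum, this, add_zero]⟩
  ext1 j
  by_contra hj
  change ¬ κ' j = 0 at hj
  have hwt : wt p j = d := by
    obtain ⟨e, he⟩ := MvPolynomial.ne_zero_iff.1 hj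
    have h1 := hκ' j e he
    rw [Subsingleton.elim e 0, map_zero] at h1
    omega
  have h1 : j.2 = 0 := by
    ext s
    by_contra h0
    rcases lt_or_ge s N with hsN | hsN
    · exact hj (hs s hsN j (Or.inr h0))
    · exact hj (eq_zero_of_index hp hN hκ' hsN (Or.inr h0))
  have h2 : j.1 ⊆ {0} := by
    intro s hs'
    rw [Finset.mem_singleton]
    by_contra h0
    obtain ⟨s, rfl⟩ := Nat.exists_eq_succ_of_ne_zero h0
    rcases lt_or_ge s N with hsN | hsN
    · exact hj (hs s hsN j (Or.inl hs'))
    · exact hj (eq_zero_of_index hp hN hκ' (by omega : N ≤ s + 1) (Or.inl hs'))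
  have h3 : wt p j ≤ 1 := by
    rw [wt, h1, Finsupp.sum_zero_index, add_zero]
    exact (Finset.sum_le_sum_of_subset h2).trans (by simp)
  omega

end exactness

end BGa

namespace BGa

open Tate MvPolynomial

/-! ### Torsion of the homogeneous cocycles -/

section zigzag

/-- The coboundaries in `𝒪(𝔾ₐⁿ)`. -/
noncomputable def cobdry (R : Type*) [CommRing R] : ∀ n : ℕ, AddSubgroup (Cochain R n)
  | 0 => ⊥
  | n + 1 => (diff n).range

variable {p N d n : ℕ}

theorem diff_zero {R : Type*} [CommRing R] (f : Cochain R 0) : diff 0 f = 0 := by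
  have h1 : (coface 1 : Cochain R 0 →ₐ[R] _) = coface 0 := by
    ext j : 1
    exact j.elim0
  rw [diff_apply, Finset.sum_range_succ, Finset.sum_range_one, h1]
  simp

theorem mapCoeff_dropFirst_mem_weight {m : TateIndex → Cochain ℤ (n + 1)}
    (hm : m ∈ resWeight ℤ p (n + 1) d) : (fun j => dropFirst n (m j)) ∈ resWeight ℤ p n d :=
  mem_weight.2 fun j => dropFirst_mem_homog (mem_weight.1 hm j)

theorem mapCoeff_shiftDiff_mem_weight {m : TateIndex → Cochain ℤ (n + 1)}
    (hm : m ∈ resWeight ℤ p (n + 1) d) : mapCoeff (shiftDiff n) m ∈ resWeight ℤ p (n + 2) d :=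
  mem_weight.2 fun j => shiftDiff_mem_homog (mem_weight.1 hm j)

theorem mapCoeff_constHom_mem_weight {m : TateIndex → Cochain ℤ n}
    (hm : m ∈ resWeight ℤ p n d) : mapCoeff (constHom ℤ n) m ∈ resWeight ℤ p (n + 1) d :=
  mem_weight.2 fun j => coface_mem_homog 0 (mem_weight.1 hm j)

theorem mapCoeff_constHom_injective {x : TateIndex → Cochain ℤ n}
    (hx : mapCoeff (constHom ℤ n) x = 0) : x = 0 := by
  funext j
  have h := congrFun hx j
  rw [mapCoeff_apply, constHom_apply, Pi.zero_apply] at h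
  apply coface_zero_injective
  rw [h, Pi.zero_apply, map_zero]

theorem eq_mapCoeff_constHom {m : TateIndex → Cochain ℤ 1} (h : mapCoeff (shiftDiff 0) m = 0) :
    m = mapCoeff (constHom ℤ 0) (fun j => dropFirst 0 (m j)) := by
  funext j
  have h := congrFun h j
  rw [mapCoeff_apply, Pi.zero_apply] at h
  rw [mapCoeff_apply, constHom_apply]
  exact eq_coface_zero h

theorem eq_mapCoeff_shiftDiff {m : TateIndex → Cochain ℤ (n + 2)}
    (h : mapCoeff (shiftDiff (n + 1)) m = 0) :
    m = mapCoeff (shiftDiff n) (fun j => dropFirst (n + 1) (m j)) := by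
  funext j
  have h := congrFun h j
  rw [mapCoeff_apply, Pi.zero_apply] at h
  rw [mapCoeff_apply]
  exact exists_shiftDiff_eq h

theorem mapCoeff_shiftDiff_constHom (x : TateIndex → Cochain ℤ 0) :
    mapCoeff (shiftDiff 0) (mapCoeff (constHom ℤ 0) x) = 0 := by
  funext j
  rw [mapCoeff_apply, mapCoeff_apply, constHom_apply, shiftDiff_coface_zero, diff_zero, map_zero]
  rfl

theorem mapCoeff_shiftDiff_shiftDiff (x : TateIndex → Cochain ℤ (n + 1)) :
    mapCoeff (shiftDiff (n + 1)) (mapCoeff (shiftDiff n) x) = 0 := by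
  funext j
  rw [mapCoeff_apply, mapCoeff_apply, shiftDiff_shiftDiff]
  rfl

/-- D has no component at the trivial monomial, so the component there determines the augmented
function. -/
theorem eq_of_resDiff_add_augment {a a' : TateIndex → Cochain ℤ (n + 1)} {c c' : Cochain ℤ n}
    (h : resDiff ℤ p n N a + augment ℤ n c = resDiff ℤ p n N a' + augment ℤ n c') : c = c' := by
  have h' := congrFun h (∅, 0)
  rw [Pi.add_apply, Pi.add_apply, resDiff_apply_zero, resDiff_apply_zero, zero_add, zero_add,
    augment_apply_zero, augment_apply_zero] at h'
  exact coface_zero_injective h'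

variable [Fact p.Prime]

/-- A family closed for the shifted differential in lowest degree is a constant κ, and D κ = -p δ κ.
Cancelling p gives δ κ = 0, so M κ = δ σ, and M p κ = D(-σ) is a boundary of constants. -/
theorem exists_smul_eq_resDiff_add_augment_zero (hd : 2 ≤ d) (hN : d < p ^ N)
    {m : TateIndex → Cochain ℤ 1} (hm : m ∈ resWeight ℤ p 1 d)
    (hclosed : mapCoeff (shiftDiff 0) m = 0) (hD : resDiff ℤ p 0 N m = 0) :
    ∃ M : ℤ, IsCoprime M p ∧ ∃ a ∈ resWeight ℤ p 1 d, mapCoeff (shiftDiff 0) a = 0 ∧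
      (M * p) • m = resDiff ℤ p 0 N a := by
  have hp := (Fact.out : p.Prime)
  choose u hu hu' using exists_primeCoeff_eq p
  obtain ⟨κ, hκ, rfl⟩ : ∃ κ ∈ resWeight ℤ p 0 d, m = mapCoeff (constHom ℤ 0) κ :=
    ⟨_, mapCoeff_dropFirst_mem_weight hm, eq_mapCoeff_constHom hclosed⟩
  rw [resDiff_mapCoeff_coface_zero hp hu] at hD
  have h1 : (p : ℤ) • constDiff (P := Cochain ℤ 0) u N κ = (p : ℤ) • 0 := by
    rw [smul_zero]
    exact neg_eq_zero.1 (mapCoeff_constHom_injective hD)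
  obtain ⟨M, hM, σ, hσ, hMσ⟩ := exists_smul_eq_constDiff hd hN hu' hκ
    (smul_family_injective (Int.natCast_ne_zero.2 hp.ne_zero) h1)
  refine ⟨M, hM, mapCoeff (constHom ℤ 0) (-σ), mapCoeff_constHom_mem_weight (neg_mem hσ),
    mapCoeff_shiftDiff_constHom _, ?_⟩
  rw [resDiff_mapCoeff_coface_zero hp hu, map_neg (constDiff (P := Cochain ℤ 0) u N), smul_neg,
    neg_neg, ← hMσ, ← map_zsmul, smul_smul, mul_comm]

/-- Zigzag in the double complex, S denoting the shifted differential. Write m = S m₁. Then D m₁ is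
closed for both differentials one degree lower, so induction gives M p D m₁ = D a with S a = 0.
Exactness of D gives M' (M p m₁ - a) = D a' plus the augmentation of some b. Applying S removes a
and turns b into its coboundary. -/
theorem exists_smul_eq_resDiff_add_augment (hd : 2 ≤ d) (hN : d < p ^ N) :
    ∀ (n : ℕ) (m : TateIndex → Cochain ℤ (n + 1)), m ∈ resWeight ℤ p (n + 1) d →
      mapCoeff (shiftDiff n) m = 0 → resDiff ℤ p n N m = 0 →
      ∃ M : ℤ, IsCoprime M p ∧ ∃ a ∈ resWeight ℤ p (n + 1) d, mapCoeff (shiftDiff n) a = 0 ∧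
        ∃ c ∈ cobdry ℤ n, (M * p) • m = resDiff ℤ p n N a + augment ℤ n c := by
  have hp := (Fact.out : p.Prime)
  intro n
  induction n with
  | zero =>
    intro m hm hclosed hD
    obtain ⟨M, hM, a, ha, ha', h⟩ := exists_smul_eq_resDiff_add_augment_zero hd hN hm hclosed hD
    exact ⟨M, hM, a, ha, ha', 0, zero_mem _, by rw [map_zero, add_zero, h]⟩
  | succ n ih =>
    intro m hm hclosed hD
    obtain ⟨m₁, hm₁, rfl⟩ : ∃ m₁ ∈ resWeight ℤ p (n + 1) d, m = mapCoeff (shiftDiff n) m₁ :=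
      ⟨_, mapCoeff_dropFirst_mem_weight hm, eq_mapCoeff_shiftDiff hclosed⟩
    obtain ⟨M, hM, a, ha, ha', c, -, hMa⟩ := ih (resDiff ℤ p n N m₁) (resDiff_mem_weight hp hm₁)
      (by rw [mapCoeff_shiftDiff_resDiff, hD]) (resDiff_resDiff hp _)
    -- Both sides of the inductive identity are boundaries of D up to the augmentation of `c`, so
    -- `c` is read off as zero.
    have hc : 0 = c := by
      refine eq_of_resDiff_add_augment (p := p) (N := N) (a := (M * p) • m₁) (a' := a) ?_
      rw [← hMa, map_zero, add_zero, map_zsmul]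
    rw [← hc, map_zero, add_zero, ← map_zsmul, ← sub_eq_zero, ← map_sub] at hMa
    obtain ⟨M', hM', a', haw, b, hb⟩ := exists_smul_eq_resDiff_add hN
      (sub_mem (zsmul_mem hm₁ (M * p)) ha) hMa
    refine ⟨M' * M, hM'.mul_left hM, mapCoeff (shiftDiff n) a', mapCoeff_shiftDiff_mem_weight haw,
      mapCoeff_shiftDiff_shiftDiff _, diff n b, ⟨b, rfl⟩, ?_⟩
    rw [← mapCoeff_shiftDiff_resDiff, ← mapCoeff_shiftDiff_augment, ← map_add, ← hb, map_zsmul,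
      map_sub, ha', sub_zero, map_zsmul, smul_smul, mul_assoc]

/-- Homogeneous cocycles of weight at least two are `p`-torsion up to integers prime to `p`. -/
theorem exists_smul_mem_cobdry (p : ℕ) [Fact p.Prime] (hd : 2 ≤ d) {f : Cochain ℤ n}
    (hf : f ∈ homog ℤ n d) (h : diff n f = 0) :
    ∃ M : ℤ, IsCoprime M p ∧ (M * p) • f ∈ cobdry ℤ n := by
  -- The zigzag is applied to the augmentation of `f` with N = d, allowed since d < p^d. The trivial
  -- component then says M p f = c.
  obtain ⟨M, hM, a, -, -, c, hc, hMc⟩ := exists_smul_eq_resDiff_add_augment hd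
    (Nat.lt_pow_self (Fact.out : p.Prime).one_lt) n (augment ℤ n f) (augment_mem_weight hf)
    (by rw [mapCoeff_shiftDiff_augment, h, map_zero]) (resDiff_augment f)
  refine ⟨M, hM, ?_⟩
  rw [eq_of_resDiff_add_augment (p := p) (N := d) (a := 0) (a' := a) (c := (M * p) • f) (c' := c) ?_]
  · exact hc
  · rw [map_zero, zero_add, map_zsmul, hMc]

end zigzag

end BGa

namespace BGa

open MvPolynomial

/-! ### Cocycles of weight at most one -/

section lowWeight

variable {n : ℕ}

theorem coface_zero_X {R : Type*} [CommRing R] (j : Fin n) :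
    coface 0 (X j : Cochain R n) = X j.succ := by
  rw [coface_zero_eq_rename, rename_X]

/-- All cofaces beyond the first fix x₀. There are n + 1 of them, an even number, and their signs
cancel. -/
theorem shiftDiff_X_zero (hn : Odd n) : shiftDiff n (X 0 : Cochain ℤ (n + 1)) = X 0 + X 1 := by
  rw [shiftDiff_apply, Finset.sum_range_succ']
  have h1 : ∀ i ∈ Finset.range (n + 1), (-1 : ℤ) ^ (i + 1) • coface (i + 1 + 1) (X 0 : Cochain ℤ (n + 1)) =
      (-1 : ℤ) ^ (i + 1) • (X 0 : Cochain ℤ (n + 2)) := by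
    intro i _
    congr 1
    simp [coface, face]
  rw [Finset.sum_congr rfl h1, ← Finset.sum_smul]
  have h2 : ∑ i ∈ Finset.range (n + 1), (-1 : ℤ) ^ (i + 1) = 0 := by
    simp only [pow_succ, ← Finset.sum_mul, neg_one_geom_sum]
    rw [if_pos hn.add_one, zero_mul]
  rw [h2]
  simp [coface, face]

/-- Constants do not involve x₀, so no correction by a shifted coboundary is needed. -/
theorem mem_cobdry_of_weight_zero {f : Cochain ℤ (n + 2)} (hf : f ∈ homog ℤ (n + 2) 0)
    (h : diff (n + 2) f = 0) : f ∈ cobdry ℤ (n + 2) := by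
  obtain ⟨g, rfl⟩ := exists_eq_coface_zero (f := f) fun e he => by
    have h1 := hf e he
    have h2 := Finsupp.le_degree 0 e
    omega
  exact ⟨g, (eq_diff_of_sub_shiftDiff h (g := 0) (by rw [map_zero, sub_zero])).symm⟩

theorem exists_eq_smul_X_add {f : Cochain ℤ (n + 1)} (hf : f ∈ homog ℤ (n + 1) 1) :
    ∃ (a : ℤ) (g : Cochain ℤ n), f = a • X 0 + coface 0 g := by
  obtain ⟨g, hg⟩ := exists_eq_coface_zero
    (f := f - coeff (Finsupp.single 0 1) f • X 0) fun e he => by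
      by_contra h0
      have h1 : (e.degree : ℤ) = 1 := by
        by_cases h : coeff e f = 0
        · rw [coeff_sub, h, coeff_smul, coeff_X] at he
          split_ifs at he with h'
          · rw [← h']; simp
          · simp at he
        · exact hf e h
      have h2 : e = Finsupp.single 0 1 := by
        have h3 := Finsupp.le_degree 0 e
        have h4 : e 0 = 1 := by omega
        ext j
        by_cases hj : j = 0
        · rw [hj, h4, Finsupp.single_eq_same]
        · rw [Finsupp.single_eq_of_ne hj]
          have : e.degree = ∑ i, e i := Finsupp.degree_eq_sum e
          rw [← Finset.add_sum_erase _ _ (Finset.mem_univ 0)] at this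
          have h5 := Finset.single_le_sum (f := fun i => e i) (fun _ _ => Nat.zero_le _)
            (Finset.mem_erase.2 ⟨hj, Finset.mem_univ j⟩)
          omega
      rw [h2, coeff_sub, coeff_smul, coeff_X, if_pos rfl] at he
      simp at he
  exact ⟨_, g, by rw [← hg, add_sub_cancel]⟩

/-- Let a be the coefficient of x₀. For even n the cocycle condition `shiftDiff f = coface 0 f`
forces a = 0, by comparing the parts involving x₀. For odd n, subtracting the shifted coboundary of
a x₀, which is a (x₀ + x₁), removes x₀. -/
theorem mem_cobdry_of_weight_one {f : Cochain ℤ (n + 2)} (hf : f ∈ homog ℤ (n + 2) 1)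
    (h : diff (n + 2) f = 0) : f ∈ cobdry ℤ (n + 2) := by
  obtain ⟨a, g, rfl⟩ := exists_eq_smul_X_add hf
  rcases Nat.even_or_odd n with hn | hn
  · have h1 := shiftDiff_eq (a • X 0 + coface 0 g : Cochain ℤ (n + 2))
    rw [h, sub_zero, map_add, map_zsmul, shiftDiff_X_zero hn.add_one, shiftDiff_coface_zero] at h1
    have h2 := congrArg (fun x => x - coface 0 (dropFirst _ x)) h1
    have h0 : dropFirst (n + 2) (X 0 : Cochain ℤ (n + 3)) = 0 := by simp [dropFirst]
    have h3 : dropFirst (n + 2) (X 1 : Cochain ℤ (n + 3)) = X 0 := by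
      rw [← dropFirst_coface_zero (X 0 : Cochain ℤ (n + 2)), coface_zero_X]; rfl
    have h4 : coface 0 (X 0 : Cochain ℤ (n + 2)) = X 1 := by rw [coface_zero_X]; rfl
    simp only [map_add, map_zsmul, dropFirst_coface_zero, h0, h3, h4, sub_self] at h2
    have h5 : a • (X 0 : Cochain ℤ (n + 3)) = 0 := by
      rw [← h2, map_zero, zero_add, smul_add]
      abel
    have ha : a = 0 := by
      have := congrArg (coeff (Finsupp.single 0 1)) h5
      rwa [coeff_smul, coeff_X, if_pos rfl, smul_eq_mul, mul_one, coeff_zero] at this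
    exact ⟨g, (eq_diff_of_sub_shiftDiff h (g := 0)
      (by rw [map_zero, sub_zero, ha, zero_smul, zero_add])).symm⟩
  · refine ⟨g - a • X 0, (eq_diff_of_sub_shiftDiff h (g := a • X 0) ?_).symm⟩
    rw [map_zsmul, shiftDiff_X_zero hn, map_sub, map_zsmul, coface_zero_X, smul_add]
    change _ = coface 0 g - a • X 1
    abel

/-- Three cofaces with alternating signs send a constant to itself. -/
theorem eq_zero_of_weight_zero {f : Cochain ℤ 1} (hf : f ∈ homog ℤ 1 0) (h : diff 1 f = 0) :
    f = 0 := by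
  have hc : f = C (coeff 0 f) := by
    ext e
    rw [coeff_C]
    split_ifs with he
    · rw [he]
    · by_contra h0
      have := hf e h0
      exact he ((Finsupp.degree_eq_zero_iff e).1 (by omega)).symm
  rw [hc, diff_apply] at h
  simp only [Finset.sum_range_succ, Finset.sum_range_zero, coface, aeval_C, algebraMap_eq] at h
  rw [hc]
  simpa using h

end lowWeight

/-! ### Decomposition of cocycles by weight -/

section homogeneousComponent

variable {R : Type*} [CommRing R] {n : ℕ}

theorem diff_mem_homog {i : ℤ} {f : Cochain R n} (hf : f ∈ homog R n i) :
    diff n f ∈ homog R (n + 1) i := by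
  rw [diff_apply]
  exact sum_mem fun a _ => zsmul_mem (coface_mem_homog _ hf) _

theorem diff_homogeneousComponent (d : ℕ) (f : Cochain R n) :
    diff n (homogeneousComponent d f) = homogeneousComponent d (diff n f) := by
  induction f using MvPolynomial.induction_on' with
  | add f g h1 h2 => rw [map_add, map_add, map_add, map_add, h1, h2]
  | monomial e r =>
    have h := isHomogeneous_monomial (R := R) (n := e.degree) r rfl
    have h' := mem_homog_iff.1 (diff_mem_homog (mem_homog_iff.2 h))
    rw [homogeneousComponent_of_mem h, homogeneousComponent_of_mem h']
    split_ifs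
    · rfl
    · exact map_zero _

theorem homogeneousComponent_mem_homog (d : ℕ) (f : Cochain R n) :
    homogeneousComponent d f ∈ homog R n d :=
  mem_homog_iff.2 (homogeneousComponent_isHomogeneous d f)

/-- The cofaces preserve weight, so each homogeneous component is a cocycle. Weights 0 and 1 give
coboundaries outright, larger ones the torsion bound, and finitely many multipliers prime to p are
multiplied together. -/
theorem exists_smul_mem_cobdry_of_closed (p : ℕ) [Fact p.Prime] {f : Cochain ℤ (n + 2)}
    (h : diff (n + 2) f = 0) : ∃ M : ℤ, IsCoprime M p ∧ (M * p) • f ∈ cobdry ℤ (n + 2) := by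
  rw [← sum_homogeneousComponent f]
  refine Finset.sum_induction _
    (fun f : Cochain ℤ (n + 2) => ∃ M : ℤ, IsCoprime M p ∧ (M * p) • f ∈ cobdry ℤ (n + 2)) ?_
    ⟨1, isCoprime_one_left, by rw [smul_zero]; exact zero_mem _⟩ fun d _ => ?_
  · rintro f g ⟨M, hM, hf⟩ ⟨M', hM', hg⟩
    refine ⟨M * M', hM.mul_left hM', ?_⟩
    rw [smul_add, show (M * M' * p) • f = M' • (M * p) • f by rw [smul_smul]; congr 1; ring,
      show (M * M' * p) • g = M • (M' * p) • g by rw [smul_smul]; congr 1; ring]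
    exact add_mem (zsmul_mem hf _) (zsmul_mem hg _)
  · have hc : diff (n + 2) (homogeneousComponent d f) = 0 := by
      rw [diff_homogeneousComponent, h, map_zero]
    have hd := homogeneousComponent_mem_homog d f
    rcases lt_or_ge d 2 with h2 | h2
    · refine ⟨1, isCoprime_one_left, zsmul_mem ?_ _⟩
      interval_cases d
      · exact mem_cobdry_of_weight_zero hd hc
      · exact mem_cobdry_of_weight_one hd hc
    · exact exists_smul_mem_cobdry p h2 hd hc

/-- There are no nonzero coboundaries in degree 1, so in weight at least 2 the torsion bound says
that a nonzero multiple of the component vanishes, and polynomials are torsion-free. The prime 2 is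
an arbitrary choice. -/
theorem eq_smul_X_of_closed {f : Cochain ℤ 1} (h : diff 1 f = 0) :
    f = coeff (Finsupp.single 0 1) f • X 0 := by
  have : Fact (Nat.Prime 2) := ⟨Nat.prime_two⟩
  have key : ∀ d, d ≠ 1 → homogeneousComponent d f = 0 := by
    intro d hd1
    have hc : diff 1 (homogeneousComponent d f) = 0 := by
      rw [diff_homogeneousComponent, h, map_zero]
    have hd := homogeneousComponent_mem_homog d f
    rcases Nat.eq_zero_or_pos d with rfl | h0
    · exact eq_zero_of_weight_zero hd hc
    · obtain ⟨M, hM, g, hg⟩ := exists_smul_mem_cobdry 2 (by omega) hd hc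
      rw [diff_zero] at hg
      refine (smul_eq_zero.1 hg.symm).resolve_left (mul_ne_zero ?_ two_ne_zero)
      rintro rfl
      exact absurd (Int.isUnit_iff.1 (isCoprime_zero_left.1 hM)) (by norm_num)
  ext e
  rw [coeff_smul, coeff_X]
  have he : e = Finsupp.single 0 (e 0) := by
    ext
    exact Finsupp.single_eq_same.symm
  by_cases h1 : e 0 = 1
  · rw [he, h1, if_pos rfl, smul_eq_mul, mul_one]
  · rw [if_neg (fun h' => h1 (by rw [← h']; simp)), smul_zero]
    have := congrArg (coeff e) (key e.degree (by
      rw [he, Finsupp.degree_single]; exact h1))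
    rwa [coeff_homogeneousComponent, if_pos rfl, coeff_zero] at this

end homogeneousComponent

end BGa

namespace BGa

open MvPolynomial

/-! ### The graded pieces of the cohomology -/

section graded

variable {k : Type*} [CommRing k]

theorem totalDiff_apply_succ (c : TotalCochain k) (n : ℕ) :
    totalDiff k c (n + 1) = diff n (c n) := by
  induction c using DirectSum.induction_on with
  | zero => simp
  | add x y hx hy => simp only [map_add, DirectSum.add_apply, hx, hy]
  | of m f =>
    rw [totalDiff_of]
    by_cases h : m = n
    · subst h; rw [DirectSum.of_eq_same, DirectSum.of_eq_same]
    · rw [DirectSum.of_eq_of_ne _ _ _ (by omega), DirectSum.of_eq_of_ne _ _ _ (Ne.symm h), map_zero]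

theorem totalDiff_apply_zero (c : TotalCochain k) : totalDiff k c 0 = 0 := by
  induction c using DirectSum.induction_on with
  | zero => simp
  | add x y hx hy => simp only [map_add, DirectSum.add_apply, hx, hy, add_zero]
  | of m f => rw [totalDiff_of, DirectSum.of_eq_of_ne _ _ _ (by omega)]

theorem totalDiff_apply_mem_cobdry (c : TotalCochain k) :
    ∀ n : ℕ, totalDiff k c n ∈ cobdry k n
  | 0 => by rw [totalDiff_apply_zero]; exact zero_mem _
  | n + 1 => ⟨c n, (totalDiff_apply_succ c n).symm⟩

theorem diff_cocycle (z : cocycles k) (n : ℕ) : diff n ((z : TotalCochain k) n) = 0 := by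
  have h : totalDiff k z = 0 := z.2
  rw [← totalDiff_apply_succ, h]
  rfl

theorem toClass_eq_zero_iff {z : cocycles k} :
    toClass k z = 0 ↔ ∃ c, totalDiff k c = z :=
  Ideal.Quotient.eq_zero_iff_mem (I := coboundaries k)

/-- The class of a homogeneous cocycle. -/
noncomputable def degreeClass (k : Type*) [CommRing k] (n : ℕ) :
    (diff (k := k) n).ker →+ Cohomology k :=
  (toClass k).toAddMonoidHom.comp
    { toFun := fun f => ⟨DirectSum.of (Cochain k) n f, by
        change totalDiff k _ = 0
        rw [totalDiff_of, f.2, map_zero]⟩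
      map_zero' := Subtype.ext (map_zero _)
      map_add' := fun _ _ => Subtype.ext (map_add _ _ _) }

theorem mem_cohomologyDegree {n : ℕ} {y : Cohomology k} :
    y ∈ cohomologyDegree k n ↔ ∃ f, degreeClass k n f = y := by
  constructor
  · rintro ⟨z, ⟨f, hf⟩, rfl⟩
    have hf : DirectSum.of (Cochain k) n f = z := hf
    refine ⟨⟨f, DirectSum.of_injective (β := Cochain k) (n + 1) ?_⟩, ?_⟩
    · have h : totalDiff k z = 0 := z.2
      rw [← totalDiff_of, hf, h, map_zero]
    · exact congrArg (toClass k) (Subtype.ext hf)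
  · rintro ⟨f, rfl⟩
    exact ⟨_, ⟨f.1, rfl⟩, rfl⟩

theorem degreeClass_eq_zero_iff {n : ℕ} {f : (diff (k := k) n).ker} :
    degreeClass k n f = 0 ↔ (f : Cochain k n) ∈ cobdry k n := by
  refine toClass_eq_zero_iff.trans ⟨?_, ?_⟩
  · rintro ⟨c, hc⟩
    have h := totalDiff_apply_mem_cobdry c n
    rw [hc] at h
    change DirectSum.of (Cochain k) n f n ∈ cobdry k n at h
    rwa [DirectSum.of_eq_same] at h
  · intro h
    cases n with
    | zero => exact ⟨0, by rw [map_zero, show f = 0 from Subtype.ext h]; exact (map_zero _).symm⟩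
    | succ n =>
      obtain ⟨g, hg⟩ := h
      exact ⟨DirectSum.of (Cochain k) n g, by rw [totalDiff_of, hg]; rfl⟩

/-- The part of degree `n` of a cocycle. -/
noncomputable def cocyclePart (k : Type*) [CommRing k] (n : ℕ) :
    cocycles k →+ (diff (k := k) n).ker where
  toFun z := ⟨(z : TotalCochain k) n, diff_cocycle z n⟩
  map_zero' := rfl
  map_add' _ _ := rfl

theorem degreeClass_cocyclePart_of_mem {n : ℕ} {z : cocycles k}
    (hz : z ∈ (coboundaries k).toAddSubgroup) : degreeClass k n (cocyclePart k n z) = 0 := by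
  obtain ⟨c, hc⟩ := hz
  refine degreeClass_eq_zero_iff.2 ?_
  have h := totalDiff_apply_mem_cobdry c n
  rw [hc] at h
  exact h

/-- The projection of the cohomology onto its part of degree `n`. -/
noncomputable def component (k : Type*) [CommRing k] (n : ℕ) : Cohomology k →+ Cohomology k :=
  QuotientAddGroup.lift (coboundaries k).toAddSubgroup ((degreeClass k n).comp (cocyclePart k n))
    fun _ hz => degreeClass_cocyclePart_of_mem hz

theorem component_toClass (n : ℕ) (z : cocycles k) :
    component k n (toClass k z) = degreeClass k n (cocyclePart k n z) := rfl

theorem component_mem (n : ℕ) (y : Cohomology k) : component k n y ∈ cohomologyDegree k n := by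
  obtain ⟨z, rfl⟩ := toClass_surjective y
  exact mem_cohomologyDegree.2 ⟨_, rfl⟩

theorem component_of_mem {n : ℕ} {y : Cohomology k} (hy : y ∈ cohomologyDegree k n) :
    component k n y = y := by
  obtain ⟨f, rfl⟩ := mem_cohomologyDegree.1 hy
  refine congrArg (degreeClass k n) (Subtype.ext ?_)
  exact DirectSum.of_eq_same n (f : Cochain k n)

theorem component_of_mem_of_ne {m n : ℕ} (h : m ≠ n) {y : Cohomology k}
    (hy : y ∈ cohomologyDegree k n) : component k m y = 0 := by
  obtain ⟨f, rfl⟩ := mem_cohomologyDegree.1 hy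
  refine (congrArg (degreeClass k m) (Subtype.ext ?_)).trans (map_zero _)
  exact DirectSum.of_eq_of_ne _ _ (f : Cochain k n) h

theorem mem_cohomologyDegree_iff_component {n : ℕ} {y : Cohomology k} :
    y ∈ cohomologyDegree k n ↔ component k n y = y :=
  ⟨component_of_mem, fun h => h ▸ component_mem n y⟩

theorem cohomology_induction {Q : Cohomology k → Prop} (h0 : Q 0)
    (hadd : ∀ x y, Q x → Q y → Q (x + y)) (h : ∀ n f, Q (degreeClass k n f)) (y : Cohomology k) :
    Q y := by
  classical
  obtain ⟨z, rfl⟩ := toClass_surjective y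
  have hz : toClass k z = ∑ n ∈ DFinsupp.support (z : TotalCochain k),
      degreeClass k n (cocyclePart k n z) := by
    have : z = ∑ n ∈ DFinsupp.support (z : TotalCochain k),
        (⟨DirectSum.of (Cochain k) n ((z : TotalCochain k) n), by
          change totalDiff k _ = 0
          rw [totalDiff_of, diff_cocycle, map_zero]⟩ : cocycles k) := by
      refine Subtype.ext ?_
      rw [AddSubmonoidClass.coe_finsetSum]
      exact (DirectSum.sum_support_of (z : TotalCochain k)).symm
    conv_lhs => rw [this, map_sum]
    rfl
  rw [hz]
  exact Finset.sum_induction _ Q hadd h0 fun n _ => h n _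

theorem component_map {l : Type*} [CommRing l] (φ : k →+* l) (n : ℕ) (y : Cohomology k) :
    component l n (mapCohomology φ y) = mapCohomology φ (component k n y) := by
  obtain ⟨z, rfl⟩ := toClass_surjective y
  change component l n (toClass l (mapCocycles φ z)) = toClass l (mapCocycles φ _)
  rw [component_toClass]
  refine congrArg (toClass l) (Subtype.ext ?_)
  change DirectSum.of (Cochain l) n (mapTotalCochain φ z n) =
    mapTotalCochain φ (DirectSum.of (Cochain k) n ((z : TotalCochain k) n))
  rw [mapTotalCochain_apply, mapTotalCochain_of]

theorem map_mem_cohomologyDegree {l : Type*} [CommRing l] (φ : k →+* l) {n : ℕ} {y : Cohomology k}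
    (hy : y ∈ cohomologyDegree k n) : mapCohomology φ y ∈ cohomologyDegree l n := by
  rw [mem_cohomologyDegree_iff_component, component_map, component_of_mem hy]

theorem mul_mem_cohomologyDegree {m n : ℕ} {x y : Cohomology k} (hx : x ∈ cohomologyDegree k m)
    (hy : y ∈ cohomologyDegree k n) : x * y ∈ cohomologyDegree k (m + n) := by
  obtain ⟨z, ⟨f, hf⟩, rfl⟩ := hx
  obtain ⟨w, ⟨g, hg⟩, rfl⟩ := hy
  refine ⟨z * w, ⟨cup f g, ?_⟩, rfl⟩
  have hf : DirectSum.of (Cochain k) m f = z := hf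
  have hg : DirectSum.of (Cochain k) n g = w := hg
  change DirectSum.of (Cochain k) (m + n) (cup f g) = (z * w : TotalCochain k)
  rw [← hf, ← hg, of_mul_of_cup]

theorem one_mem_cohomologyDegree : (1 : Cohomology k) ∈ cohomologyDegree k 0 :=
  ⟨1, ⟨(1 : MvPolynomial (Fin 0) k), rfl⟩, rfl⟩

theorem v₁_mem : v₁ ∈ cohomologyDegree ℤ 1 := ⟨_, ⟨X 0, rfl⟩, rfl⟩

theorem v₁_pow_mem (n : ℕ) : v₁ ^ n ∈ cohomologyDegree ℤ n := by
  induction n with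
  | zero => rw [pow_zero]; exact one_mem_cohomologyDegree
  | succ n ih => rw [pow_succ]; exact mul_mem_cohomologyDegree ih v₁_mem

end graded

/-! ### Torsion -/

section torsion

/-- The classes which are killed by `p` up to integers prime to `p`. -/
def elementary (p : ℕ) : AddSubgroup (Cohomology ℤ) where
  carrier := {y | ∃ M : ℤ, IsCoprime M p ∧ (M * p) • y = 0}
  zero_mem' := ⟨1, isCoprime_one_left, smul_zero _⟩
  add_mem' := by
    rintro x y ⟨M, hM, hx⟩ ⟨M', hM', hy⟩
    refine ⟨M * M', hM.mul_left hM', ?_⟩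
    rw [smul_add, show (M * M' * p) • x = M' • (M * p) • x by rw [smul_smul]; congr 1; ring,
      show (M * M' * p) • y = M • (M' * p) • y by rw [smul_smul]; congr 1; ring, hx, hy,
      smul_zero, smul_zero, add_zero]
  neg_mem' := by
    rintro x ⟨M, hM, hx⟩
    exact ⟨M, hM, by rw [smul_neg, hx, neg_zero]⟩

theorem degreeClass_zero (f : (diff (k := ℤ) 0).ker) :
    degreeClass ℤ 0 f = (coeff 0 (f : Cochain ℤ 0)) • (1 : Cohomology ℤ) := by
  have h : (1 : Cohomology ℤ) = degreeClass ℤ 0 ⟨1, diff_zero _⟩ := rfl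
  rw [h, ← map_zsmul]
  congr 1
  refine Subtype.ext ?_
  change (f : Cochain ℤ 0) = coeff 0 (f : Cochain ℤ 0) • (1 : Cochain ℤ 0)
  ext e
  rw [Subsingleton.elim e 0, coeff_smul, coeff_zero_one, smul_eq_mul, mul_one]

theorem degreeClass_one (f : (diff (k := ℤ) 1).ker) :
    degreeClass ℤ 1 f = (coeff (Finsupp.single 0 1) (f : Cochain ℤ 1)) • v₁ := by
  have hX : diff 1 (X 0 : Cochain ℤ 1) = 0 := by
    rw [diff_apply]
    simp [Finset.sum_range_succ, coface, face]
  have h : v₁ = degreeClass ℤ 1 ⟨X 0, hX⟩ := rfl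
  rw [h, ← map_zsmul]
  congr 1
  exact Subtype.ext (eq_smul_X_of_closed f.2)

theorem degreeClass_mem_elementary (p : ℕ) [Fact p.Prime] {n : ℕ} (f : (diff (k := ℤ) (n + 2)).ker) :
    degreeClass ℤ (n + 2) f ∈ elementary p := by
  obtain ⟨M, hM, h⟩ := exists_smul_mem_cobdry_of_closed p f.2
  exact ⟨M, hM, by rw [← map_zsmul]; exact degreeClass_eq_zero_iff.2 h⟩

/-- The integers a, b come from degrees 0 and 1 and do not depend on p; everything of degree at
least 2 is elementary for every p. -/
theorem exists_sub_mem_elementary (y : Cohomology ℤ) :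
    ∃ a b : ℤ, ∀ p : ℕ, p.Prime → y - (a • (1 : Cohomology ℤ) + b • v₁) ∈ elementary p := by
  induction y using cohomology_induction with
  | h0 => exact ⟨0, 0, fun p _ => by simp [zero_mem]⟩
  | hadd x y hx hy =>
    obtain ⟨a, b, h⟩ := hx
    obtain ⟨a', b', h'⟩ := hy
    refine ⟨a + a', b + b', fun p hp => ?_⟩
    have := add_mem (h p hp) (h' p hp)
    convert this using 1
    rw [add_smul, add_smul]
    abel
  | h n f =>
    match n, f with
    | 0, f => exact ⟨coeff 0 (f : Cochain ℤ 0), 0, fun p _ => by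
        rw [degreeClass_zero, zero_smul, add_zero, sub_self]
        exact zero_mem _⟩
    | 1, f => exact ⟨0, coeff (Finsupp.single 0 1) (f : Cochain ℤ 1), fun p _ => by
        rw [degreeClass_one, zero_smul, zero_add, sub_self]
        exact zero_mem _⟩
    | n + 2, f =>
      refine ⟨0, 0, fun p hp => ?_⟩
      have : Fact p.Prime := ⟨hp⟩
      rw [zero_smul, zero_smul, add_zero, sub_zero]
      exact degreeClass_mem_elementary p f

theorem eq_zero_of_smul_one {a : ℤ} (h : a • (1 : Cohomology ℤ) = 0) : a = 0 := by
  have h1 : a • (1 : Cohomology ℤ) = degreeClass ℤ 0 (a • ⟨1, diff_zero _⟩) := by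
    rw [map_zsmul]; rfl
  rw [h1, degreeClass_eq_zero_iff] at h
  have h2 := congrArg (coeff 0) (show a • (1 : Cochain ℤ 0) = 0 from h)
  rwa [coeff_smul, coeff_zero_one, smul_eq_mul, mul_one, coeff_zero] at h2

theorem eq_zero_of_smul_v₁ {b : ℤ} (h : b • v₁ = 0) : b = 0 := by
  have hX : diff 1 (X 0 : Cochain ℤ 1) = 0 := by
    rw [diff_apply]
    simp [Finset.sum_range_succ, coface, face]
  have h1 : b • v₁ = degreeClass ℤ 1 (b • ⟨X 0, hX⟩) := by
    rw [map_zsmul]; rfl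
  rw [h1, degreeClass_eq_zero_iff] at h
  obtain ⟨g, hg⟩ := h
  rw [diff_zero] at hg
  have h2 := congrArg (coeff (Finsupp.single 0 1)) (show 0 = b • (X 0 : Cochain ℤ 1) from hg)
  rw [coeff_smul, coeff_X, if_pos rfl, smul_eq_mul, mul_one, coeff_zero] at h2
  exact h2.symm

/-- 1 and v₁ lie in different degrees, and neither is torsion because there are no nonzero
coboundaries in degrees 0 and 1. -/
theorem eq_zero_of_smul_add_eq_zero {M a b : ℤ} (hM : M ≠ 0)
    (h : M • (a • (1 : Cohomology ℤ) + b • v₁) = 0) : a = 0 ∧ b = 0 := by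
  rw [smul_add, smul_smul, smul_smul] at h
  have h0 := congrArg (component ℤ 0) h
  have h1 := congrArg (component ℤ 1) h
  rw [map_add, map_zsmul, map_zsmul, component_of_mem one_mem_cohomologyDegree,
    component_of_mem_of_ne zero_ne_one v₁_mem, smul_zero, add_zero, map_zero] at h0
  rw [map_add, map_zsmul, map_zsmul, component_of_mem v₁_mem,
    component_of_mem_of_ne one_ne_zero one_mem_cohomologyDegree, smul_zero, zero_add, map_zero] at h1
  exact ⟨(mul_eq_zero.1 (eq_zero_of_smul_one h0)).resolve_left hM,
    (mul_eq_zero.1 (eq_zero_of_smul_v₁ h1)).resolve_left hM⟩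

theorem ne_zero_of_isCoprime {M : ℤ} {p : ℕ} (hp : p.Prime) (hM : IsCoprime M p) : M * p ≠ 0 := by
  refine mul_ne_zero ?_ (Int.natCast_ne_zero.2 hp.ne_zero)
  rintro rfl
  have := Int.isUnit_iff.1 (isCoprime_zero_left.1 hM)
  have := hp.two_le
  omega

/-- If y is torsion, so is its part a + b v₁ modulo elementary classes, which therefore vanishes. -/
theorem mem_elementary_of_smul_eq_zero {M : ℤ} (hM : M ≠ 0) {y : Cohomology ℤ} (h : M • y = 0)
    {p : ℕ} (hp : p.Prime) : y ∈ elementary p := by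
  obtain ⟨a, b, hy⟩ := exists_sub_mem_elementary y
  obtain ⟨M', hM', h'⟩ := hy p hp
  have h1 : (M * (M' * p)) • (a • (1 : Cohomology ℤ) + b • v₁) = 0 := by
    rw [smul_sub, sub_eq_zero] at h'
    rw [mul_smul, ← h', smul_comm, h, smul_zero]
  obtain ⟨rfl, rfl⟩ := eq_zero_of_smul_add_eq_zero (mul_ne_zero hM (ne_zero_of_isCoprime hp hM')) h1
  have := hy p hp
  rwa [zero_smul, zero_smul, add_zero, sub_zero] at this

/-- The `p`-primary torsion is killed by `p`. -/
theorem smul_eq_zero_of_pow_smul_eq_zero {p : ℕ} (hp : p.Prime) (m : ℕ) {x : Cohomology ℤ}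
    (h : p ^ m • x = 0) : p • x = 0 := by
  have h' : ((p : ℤ) ^ m) • x = 0 := by exact_mod_cast h
  obtain ⟨M, hM, hx⟩ := mem_elementary_of_smul_eq_zero
    (pow_ne_zero m (Int.natCast_ne_zero.2 hp.ne_zero)) h' hp
  -- Both M p and p^m kill x; since M and p^m are coprime, so does p.
  obtain ⟨u, v, huv⟩ := hM.pow_right (n := m)
  have : (p : ℤ) • x = 0 := by
    calc (p : ℤ) • x = (u * M + v * p ^ m) • (p : ℤ) • x := by rw [huv, one_smul]
      _ = u • (M * p) • x + (v * p) • (p : ℤ) ^ m • x := by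
        rw [add_smul, smul_smul, smul_smul, smul_smul, smul_smul]
        congr 2 <;> ring
      _ = 0 := by rw [hx, h', smul_zero, smul_zero, add_zero]
  exact_mod_cast this

end torsion

end BGa

namespace BGa

open MvPolynomial

/-! ### Torsion classes and their reductions -/

section reduction

variable (p : Nat.Primes)

/-- Exactness of the Bockstein sequence between multiplication by p and reduction: a lift of the
bounding cochain corrects the cocycle to one divisible by p. -/
theorem exists_eq_smul_of_reduction_eq_zero {y : Cohomology ℤ} (h : reduction p y = 0) :
    ∃ w, y = (p : ℕ) • w := by
  obtain ⟨z, rfl⟩ := toClass_surjective y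
  rw [reduction_mk] at h
  obtain ⟨c, hc⟩ := toClass_eq_zero_iff.1 h
  obtain ⟨u, rfl⟩ := exists_lift p c
  have hz : totalDiff ℤ z = 0 := z.2
  have hc' : totalDiff (ZMod p) (mapTotalCochain (Int.castRingHom (ZMod p)) u) =
    mapTotalCochain (Int.castRingHom (ZMod p)) (z : TotalCochain ℤ) := hc
  obtain ⟨s, hs⟩ := exists_eq_nsmul p (t := (z : TotalCochain ℤ) - totalDiff ℤ u) (by
    rw [map_sub, mapTotalCochain_totalDiff, hc', sub_self])
  have hs' : totalDiff ℤ s = 0 := nsmul_injective p (by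
    rw [← map_nsmul, ← hs, map_sub, hz, totalDiff_totalDiff, sub_zero, smul_zero])
  refine ⟨toClass ℤ ⟨s, hs'⟩, ?_⟩
  rw [← sub_eq_zero, ← map_nsmul, ← map_sub]
  refine toClass_eq_zero_iff.2 ⟨u, ?_⟩
  change _ = (z : TotalCochain ℤ) - (p : ℕ) • s
  rw [← hs, sub_sub_cancel]

/-- If d t = p z, the reduction of t is a cocycle and its connecting class is that of z. -/
theorem exists_connecting_eq {y : Cohomology ℤ} (h : (p : ℕ) • y = 0) : ∃ x, connecting p x = y := by
  obtain ⟨z, rfl⟩ := toClass_surjective y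
  rw [← map_nsmul] at h
  obtain ⟨t, ht⟩ := toClass_eq_zero_iff.1 h
  have ht : totalDiff ℤ t = (p : ℕ) • (z : TotalCochain ℤ) := ht
  refine ⟨toClass _ ⟨mapTotalCochain (Int.castRingHom (ZMod p)) t, ?_⟩, connecting_eq p rfl ht⟩
  change totalDiff _ _ = 0
  rw [← mapTotalCochain_totalDiff, ht, map_nsmul_eq_zero]

theorem smul_connecting (x : Cohomology (ZMod p)) : (p : ℕ) • connecting p x = 0 := by
  obtain ⟨z, rfl⟩ := toClass_surjective x
  obtain ⟨b, t, ht, hb⟩ := exists_connecting p z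
  rw [connecting_eq p ht hb, ← map_nsmul]
  exact toClass_eq_zero_iff.2 ⟨t, hb⟩

theorem reduction_mem_imBockstein {y : Cohomology ℤ} (h : (p : ℕ) • y = 0) :
    reduction p y ∈ imBockstein p := by
  obtain ⟨x, rfl⟩ := exists_connecting_eq p h
  exact ⟨x, rfl⟩

theorem smul_cohomology_eq_zero (x : Cohomology (ZMod p)) : (p : ℕ) • x = 0 := by
  obtain ⟨z, rfl⟩ := toClass_surjective x
  obtain ⟨t, ht⟩ := exists_lift p z
  rw [← map_nsmul]
  refine toClass_eq_zero_iff.2 ⟨0, ?_⟩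
  rw [map_zero]
  change 0 = (p : ℕ) • (z : TotalCochain (ZMod p))
  rw [← ht, ← map_nsmul, map_nsmul_eq_zero]

theorem eq_zero_of_smul_of_isCoprime {M : ℤ} (hM : IsCoprime M (p : ℕ)) {x : Cohomology (ZMod p)}
    (h : M • x = 0) : x = 0 := by
  obtain ⟨u, v, huv⟩ := hM
  rw [← one_smul ℤ x, ← huv, add_smul, mul_smul, mul_smul, h, natCast_zsmul,
    smul_cohomology_eq_zero, smul_zero, smul_zero, add_zero]

theorem reduction_aeval (f : Polynomial ℤ) :
    reduction p (Polynomial.aeval v₁ f) = Polynomial.aeval (reduction p v₁) f :=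
  (Polynomial.aeval_algHom_apply (reduction p).toIntAlgHom v₁ f).symm

end reduction

/-- The classes of finite order. -/
def torsionClasses : AddSubgroup (Cohomology ℤ) where
  carrier := {y | ∃ M : ℤ, M ≠ 0 ∧ M • y = 0}
  zero_mem' := ⟨1, one_ne_zero, smul_zero _⟩
  add_mem' := by
    rintro x y ⟨M, hM, hx⟩ ⟨M', hM', hy⟩
    refine ⟨M * M', mul_ne_zero hM hM', ?_⟩
    rw [smul_add, mul_smul, mul_smul, hy, smul_zero, smul_comm, hx, smul_zero, add_zero]
  neg_mem' := by
    rintro x ⟨M, hM, hx⟩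
    exact ⟨M, hM, by rw [smul_neg, hx, neg_zero]⟩

/-! ### Torsion classes are detected by their reductions -/

section torsionClasses

variable {t : Cohomology ℤ}

theorem mul_mem_torsionClasses (a : Cohomology ℤ) (ht : t ∈ torsionClasses) :
    a * t ∈ torsionClasses := by
  obtain ⟨M, hM, h⟩ := ht
  exact ⟨M, hM, by rw [← mul_smul_comm, h, mul_zero]⟩

theorem torsionClasses_mul_mem (ht : t ∈ torsionClasses) (a : Cohomology ℤ) :
    t * a ∈ torsionClasses := by
  obtain ⟨M, hM, h⟩ := ht
  exact ⟨M, hM, by rw [← smul_mul_assoc, h, zero_mul]⟩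

theorem map_mem_torsionClasses (g : Cohomology ℤ →+ Cohomology ℤ) (ht : t ∈ torsionClasses) :
    g t ∈ torsionClasses := by
  obtain ⟨M, hM, h⟩ := ht
  exact ⟨M, hM, by rw [← map_zsmul, h, map_zero]⟩

theorem mem_torsionClasses_of_smul {p : ℕ} (hp : p.Prime) (h : p • t = 0) : t ∈ torsionClasses :=
  ⟨p, Int.natCast_ne_zero.2 hp.ne_zero, by rw [natCast_zsmul, h]⟩

/-- A class of finite order is determined by its reductions. -/
theorem eq_zero_of_reduction (ht : t ∈ torsionClasses)
    (h : ∀ p : Nat.Primes, reduction p t = 0) : t = 0 := by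
  obtain ⟨M, hM, hMt⟩ := ht
  have hfin : IsOfFinAddOrder t := isOfFinAddOrder_iff_zsmul_eq_zero.2 ⟨M, hM, hMt⟩
  by_contra h0
  obtain ⟨p, hp, hdvd⟩ := Nat.exists_prime_and_dvd (mt AddMonoid.addOrderOf_eq_one_iff.1 h0)
  obtain ⟨w, hw⟩ := exists_eq_smul_of_reduction_eq_zero ⟨p, hp⟩ (h ⟨p, hp⟩)
  have hw : t = (p : ℤ) • w := by rw [natCast_zsmul]; exact hw
  -- With t = p w, the class w is torsion as well, so M' p w = M' t = 0 for some M' prime to p. But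
  -- p divides the order of t, a contradiction.
  obtain ⟨M', hM', hw'⟩ := mem_elementary_of_smul_eq_zero
    (mul_ne_zero hM (Int.natCast_ne_zero.2 hp.ne_zero)) (y := w) (by rw [mul_smul, ← hw, hMt]) hp
  rw [mul_smul, ← hw] at hw'
  have h1 := (Int.natCast_dvd_natCast.2 hdvd).trans (addOrderOf_dvd_iff_zsmul_eq_zero.2 hw')
  have h2 := hM'.isUnit_of_dvd' h1 dvd_rfl
  exact (Nat.prime_iff_prime_int.1 hp).not_isUnit h2

/-- With u M' + v p = 1, t splits as u M' t, which is killed by p, plus a multiple of p, which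
reduces to zero. -/
theorem reduction_mem_imBockstein_of_torsion (p : Nat.Primes) (ht : t ∈ torsionClasses) :
    reduction p t ∈ imBockstein p := by
  obtain ⟨M, hM, hMt⟩ := ht
  obtain ⟨M', ⟨u, v, huv⟩, h⟩ := mem_elementary_of_smul_eq_zero hM hMt p.2
  have h1 := reduction_mem_imBockstein p (y := u • M' • t) (by
    rw [← natCast_zsmul, smul_smul, smul_smul, show ((p : ℕ) : ℤ) * u * M' = u * (M' * (p : ℕ)) by ring,
      mul_smul, h, smul_zero])
  have h2 : reduction p t = reduction p (u • M' • t) := by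
    conv_lhs => rw [← one_smul ℤ t, ← huv]
    rw [add_smul, mul_smul, mul_smul, map_add, map_zsmul (reduction p) v, natCast_zsmul,
      map_nsmul (reduction p), smul_cohomology_eq_zero, smul_zero, add_zero]
  rwa [h2]

theorem finite_reduction_ne_zero (ht : t ∈ torsionClasses) :
    {p : Nat.Primes | reduction p t ≠ 0}.Finite := by
  obtain ⟨M, hM, hMt⟩ := ht
  refine (M.natAbs.primeFactors.finite_toSet.preimage
    (Nat.Primes.coe_nat_injective.injOn)).subset fun p hp => ?_
  rw [Set.mem_preimage, Finset.mem_coe, Nat.mem_primeFactors]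
  refine ⟨p.2, ?_, Int.natAbs_ne_zero.2 hM⟩
  by_contra hdvd
  refine hp (eq_zero_of_smul_of_isCoprime p (M := M) ?_ (by rw [← map_zsmul, hMt, map_zero]))
  rw [Int.isCoprime_iff_nat_coprime, Int.natAbs_natCast]
  exact ((Nat.Prime.coprime_iff_not_dvd p.2).2 hdvd).symm

end torsionClasses

/-! ### The torsion as the sum of the images of the Bocksteins -/

theorem exists_torsionLift (p : Nat.Primes) (b : imBockstein p) :
    ∃ y : Cohomology ℤ, (p : ℕ) • y = 0 ∧ reduction p y = b := by
  obtain ⟨x, hx⟩ := b.2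
  exact ⟨connecting p x, smul_connecting p x, hx⟩

/-- The difference is p w with p² w = 0, and elementary torsion gives p w = 0. So reduction is
injective on the classes killed by p, and lifts of elements of Im β_p are unique. -/
theorem eq_of_reduction_eq {p : Nat.Primes} {y y' : Cohomology ℤ} (h : (p : ℕ) • y = 0)
    (h' : (p : ℕ) • y' = 0) (hr : reduction p y = reduction p y') : y = y' := by
  obtain ⟨w, hw⟩ := exists_eq_smul_of_reduction_eq_zero p (y := y - y') (by
    rw [map_sub, hr, sub_self])
  rw [← sub_eq_zero, hw]
  refine smul_eq_zero_of_pow_smul_eq_zero p.2 2 ?_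
  rw [pow_two, mul_smul, ← hw, smul_sub, h, h', sub_self]

/-- The elements killed by `p` with given reduction in `Im β_p`. -/
noncomputable def torsionLift (p : Nat.Primes) : imBockstein p →+ Cohomology ℤ :=
  AddMonoidHom.mk' (fun b => (exists_torsionLift p b).choose) fun b b' => by
    have h := (exists_torsionLift p b).choose_spec
    have h' := (exists_torsionLift p b').choose_spec
    have h'' := (exists_torsionLift p (b + b')).choose_spec
    refine eq_of_reduction_eq h''.1 (by rw [smul_add, h.1, h'.1, add_zero]) ?_
    rw [h''.2, map_add, h.2, h'.2]
    rfl

theorem smul_torsionLift (p : Nat.Primes) (b : imBockstein p) : (p : ℕ) • torsionLift p b = 0 :=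
  (exists_torsionLift p b).choose_spec.1

theorem reduction_torsionLift (p : Nat.Primes) (b : imBockstein p) :
    reduction p (torsionLift p b) = b :=
  (exists_torsionLift p b).choose_spec.2

theorem reduction_torsionLift_of_ne {p q : Nat.Primes} (h : q ≠ p) (b : imBockstein q) :
    reduction p (torsionLift q b) = 0 := by
  refine eq_zero_of_smul_of_isCoprime p (M := (q : ℕ)) ?_ ?_
  · rw [Int.isCoprime_iff_nat_coprime, Int.natAbs_natCast, Int.natAbs_natCast]
    exact (Nat.coprime_primes q.2 p.2).2 fun h' => h (Subtype.ext h')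
  · rw [← map_zsmul, natCast_zsmul, smul_torsionLift, map_zero]

/-- The comparison map from the sum of the images of the Bocksteins to the cohomology. -/
noncomputable def torsionSum : (⨁ p : Nat.Primes, imBockstein p) →+ Cohomology ℤ :=
  DirectSum.toAddMonoid torsionLift

theorem torsionSum_of (p : Nat.Primes) (b : imBockstein p) :
    torsionSum (DirectSum.of (fun p : Nat.Primes => imBockstein p) p b) = torsionLift p b :=
  DirectSum.toAddMonoid_of _ _ _

theorem torsionSum_mem (b : ⨁ p : Nat.Primes, imBockstein p) : torsionSum b ∈ torsionClasses := by
  induction b using DirectSum.induction_on with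
  | zero => rw [map_zero]; exact zero_mem _
  | add x y hx hy => rw [map_add]; exact add_mem hx hy
  | of p b => rw [torsionSum_of]; exact mem_torsionClasses_of_smul p.2 (smul_torsionLift p b)

theorem reduction_torsionSum (p : Nat.Primes) (b : ⨁ p : Nat.Primes, imBockstein p) :
    reduction p (torsionSum b) = b p := by
  induction b using DirectSum.induction_on with
  | zero => rw [map_zero, map_zero]; rfl
  | add x y hx hy => rw [map_add, map_add, hx, hy]; rfl
  | of q b =>
    rw [torsionSum_of]
    by_cases h : q = p
    · subst h
      rw [reduction_torsionLift, DirectSum.of_eq_same]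
    · rw [reduction_torsionLift_of_ne h, DirectSum.of_eq_of_ne _ _ _ (Ne.symm h)]
      rfl

theorem eq_of_reduction {t t' : Cohomology ℤ} (ht : t ∈ torsionClasses) (ht' : t' ∈ torsionClasses)
    (h : ∀ p : Nat.Primes, reduction p t = reduction p t') : t = t' :=
  sub_eq_zero.1 (eq_zero_of_reduction (sub_mem ht ht') fun p => by rw [map_sub, h, sub_self])

theorem exists_torsionSum_eq {t : Cohomology ℤ} (ht : t ∈ torsionClasses) :
    ∃ b, torsionSum b = t := by
  let b : ⨁ p : Nat.Primes, imBockstein p := DirectSum.mk (fun p : Nat.Primes => imBockstein p)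
    (finite_reduction_ne_zero ht).toFinset fun p =>
      ⟨reduction p.1 t, reduction_mem_imBockstein_of_torsion p.1 ht⟩
  refine ⟨b, eq_of_reduction (torsionSum_mem b) ht fun p => ?_⟩
  rw [reduction_torsionSum]
  by_cases hp : reduction p t = 0
  · rw [DirectSum.mk_apply_of_notMem (by simpa using hp), hp]; rfl
  · rw [DirectSum.mk_apply_of_mem (by simpa using hp)]

/-- Projection onto a degree commutes with reduction, and torsion classes are determined by their
reductions. -/
theorem torsionSum_mem_cohomologyDegree {n : ℕ} {b : ⨁ p : Nat.Primes, imBockstein p}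
    (hb : ∀ p : Nat.Primes, (b p : Cohomology (ZMod p)) ∈ cohomologyDegree (ZMod p) n) :
    torsionSum b ∈ cohomologyDegree ℤ n := by
  rw [mem_cohomologyDegree_iff_component]
  refine eq_of_reduction (map_mem_torsionClasses _ (torsionSum_mem b)) (torsionSum_mem b) fun p => ?_
  rw [← component_map, reduction_torsionSum, component_of_mem (hb p)]

theorem smul_v₂ : (2 : ℕ) • v₂ = 0 := by
  rw [v₂, ← map_nsmul]
  exact toClass_eq_zero_iff.2 ⟨_, totalDiff_sq⟩

/-- The cup square of x is x₀ x₁, which is the negative of d(x²)/2; the sign is immaterial because 2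
v₂ = 0. -/
theorem v₁_sq : v₁ ^ 2 = v₂ := by
  have h : v₁ ^ 2 = -v₂ := by
    rw [pow_two, v₁, v₂, ← map_mul, ← map_neg]
    refine congrArg (toClass ℤ) (Subtype.ext ?_)
    change DirectSum.of (Cochain ℤ) 1 (X 0) * DirectSum.of (Cochain ℤ) 1 (X 0) = -halfPhi₂
    rw [of_mul_of_cup, halfPhi₂, ← map_neg, neg_neg, cup, rename_X, rename_X]
    rfl
  rw [h, ← sub_eq_zero, ← neg_eq_zero, neg_sub, sub_neg_eq_add, ← two_nsmul, smul_v₂]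

/-! ### The ring isomorphism -/

/-- The comparison map from `ℤ[v₁] ⊕ ⨁_p Im β_p` to the cohomology ring. -/
noncomputable def comparison : PreRing →+* Cohomology ℤ where
  toFun x := Polynomial.aeval v₁ x.1 + torsionSum x.2
  map_one' := by
    change Polynomial.aeval v₁ 1 + torsionSum 0 = 1
    rw [map_one, map_zero, add_zero]
  map_zero' := by
    change Polynomial.aeval v₁ 0 + torsionSum 0 = 0
    rw [map_zero, map_zero, add_zero]
  map_add' x y := by
    change Polynomial.aeval v₁ (x.1 + y.1) + torsionSum (x.2 + y.2) = _
    rw [map_add, map_add]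
    abel
  map_mul' x y := by
    have h : torsionSum (x * y).2 = Polynomial.aeval v₁ x.1 * torsionSum y.2 +
        torsionSum x.2 * Polynomial.aeval v₁ y.1 + torsionSum x.2 * torsionSum y.2 := by
      -- Both sides are torsion, so they may be compared modulo each p, where the identity is the
      -- definition of the product on the components.
      refine eq_of_reduction (torsionSum_mem _) (add_mem (add_mem
        (mul_mem_torsionClasses _ (torsionSum_mem _)) (torsionClasses_mul_mem (torsionSum_mem _) _))
        (mul_mem_torsionClasses _ (torsionSum_mem _))) fun p => ?_
      rw [reduction_torsionSum, PreRing.mul_snd, map_add, map_add, map_mul, map_mul, map_mul,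
        reduction_torsionSum, reduction_torsionSum, reduction_aeval, reduction_aeval]
    rw [h, PreRing.mul_fst, map_mul, add_mul, mul_add, mul_add]
    abel

theorem comparison_apply (x : PreRing) :
    comparison x = Polynomial.aeval v₁ x.1 + torsionSum x.2 := rfl

/-- The element of `ℤ[v₁] ⊕ ⨁_p Im β_p` with given components. -/
def PreRing.pair (f : Polynomial ℤ) (t : ⨁ p : Nat.Primes, imBockstein p) : PreRing := (f, t)

theorem comparison_pair (f : Polynomial ℤ) (t : ⨁ p : Nat.Primes, imBockstein p) :
    comparison (PreRing.pair f t) = Polynomial.aeval v₁ f + torsionSum t := rfl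

theorem comparison_ofImBockstein (p : Nat.Primes) (b : imBockstein p) :
    comparison (PreRing.ofImBockstein p b) = torsionLift p b := by
  rw [comparison_apply, PreRing.ofImBockstein, torsionSum_of, map_zero, zero_add]

theorem comparison_genV₁ : comparison PreRing.genV₁ = v₁ := by
  rw [comparison_apply, PreRing.genV₁, Polynomial.aeval_X, map_zero, add_zero]

theorem comparison_genV₂ : comparison PreRing.genV₂ = v₂ := by
  rw [PreRing.genV₂, comparison_ofImBockstein]
  exact eq_of_reduction_eq (smul_torsionLift _ _) smul_v₂ (reduction_torsionLift _ _)

/-- The comparison map from `(ℤ[v₁] ⊕ ⨁_p Im β_p) / (v₁² = v₂)` to the cohomology ring. -/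
noncomputable def comparisonTarget : Target →+* Cohomology ℤ :=
  RingQuot.lift ⟨comparison, by
    rintro _ _ ⟨rfl, rfl⟩
    rw [map_pow, comparison_genV₁, comparison_genV₂, v₁_sq]⟩

theorem comparisonTarget_mk (x : PreRing) : comparisonTarget (Target.mk x) = comparison x :=
  RingQuot.lift_mkRingHom_apply _ _ _

theorem mk_sq_mul (y : PreRing) :
    Target.mk (PreRing.genV₁ ^ 2 * y) = Target.mk (PreRing.genV₂ * y) := by
  rw [map_mul, map_mul, RingQuot.mkRingHom_rel (show PreRing.Rel _ _ from ⟨rfl, rfl⟩)]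

/-- Splitting f = X² g + (linear part), the relation turns v₁² g into v₂ g, which lies in the
torsion summand. -/
theorem exists_mk_eq (x : Target) : ∃ (a b : ℤ) (t : ⨁ p : Nat.Primes, imBockstein p),
    x = Target.mk (PreRing.pair (Polynomial.C a + Polynomial.C b * Polynomial.X) t) := by
  obtain ⟨⟨f, t⟩, rfl⟩ := RingQuot.mkRingHom_surjective _ x
  let g := f.divX.divX
  have hf : f = Polynomial.X ^ 2 * g +
      (Polynomial.C (f.coeff 0) + Polynomial.C (f.divX.coeff 0) * Polynomial.X) := by
    conv_lhs => rw [← Polynomial.divX_mul_X_add f, ← Polynomial.divX_mul_X_add f.divX]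
    ring
  have h : PreRing.pair f t = PreRing.genV₁ ^ 2 * PreRing.pair g 0 +
      PreRing.pair (Polynomial.C (f.coeff 0) + Polynomial.C (f.divX.coeff 0) * Polynomial.X) t := by
    refine PreRing.ext_components ?_ fun p => ?_
    · rw [PreRing.add_fst, PreRing.mul_fst, pow_two, PreRing.mul_fst]
      rw [pow_two] at hf
      exact hf
    · rw [PreRing.add_snd, PreRing.mul_snd, pow_two, PreRing.mul_snd]
      change _ = _ * 0 + (_ * 0 + 0 * _ + 0 * 0) * _ + (_ * 0 + 0 * _ + 0 * 0) * 0 + _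
      simp only [mul_zero, zero_mul, zero_add]
      rfl
  refine ⟨f.coeff 0, f.divX.coeff 0, (PreRing.genV₂ * PreRing.pair g 0).2 + t, ?_⟩
  change Target.mk (PreRing.pair f t) = _
  rw [h, map_add, mk_sq_mul, ← map_add]
  congr 1
  refine PreRing.ext_components ?_ fun p => rfl
  rw [PreRing.add_fst, PreRing.mul_fst]
  change 0 * g + _ = _
  rw [zero_mul, zero_add]
  rfl

theorem comparison_linear (a b : ℤ) (t : ⨁ p : Nat.Primes, imBockstein p) :
    comparison (PreRing.pair (Polynomial.C a + Polynomial.C b * Polynomial.X) t) =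
      a • (1 : Cohomology ℤ) + b • v₁ + torsionSum t := by
  rw [comparison_pair, map_add, map_mul, Polynomial.aeval_C, Polynomial.aeval_C, Polynomial.aeval_X,
    eq_intCast, eq_intCast, zsmul_eq_mul, zsmul_eq_mul, mul_one]

/-- In normal form, a multiplier killing the torsion summand forces a = b = 0; the torsion
components are then recovered by reduction modulo each p. -/
theorem comparisonTarget_injective : Function.Injective comparisonTarget := by
  rw [injective_iff_map_eq_zero]
  intro x hx
  obtain ⟨a, b, t, rfl⟩ := exists_mk_eq x
  rw [comparisonTarget_mk, comparison_linear] at hx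
  obtain ⟨M, hM, h⟩ := torsionSum_mem t
  obtain ⟨rfl, rfl⟩ := eq_zero_of_smul_add_eq_zero hM (a := a) (b := b) (by
    have := congrArg (M • ·) hx
    rwa [smul_add, h, add_zero, smul_zero] at this)
  rw [zero_smul, zero_smul, add_zero, zero_add] at hx
  rw [← map_zero Target.mk]
  congr 1
  refine PreRing.ext_components ?_ fun p => ?_
  · change Polynomial.C 0 + Polynomial.C 0 * Polynomial.X = 0
    simp
  · change (t p : Cohomology (ZMod p)) = 0
    rw [← reduction_torsionSum, hx, map_zero]

theorem mem_torsionClasses_of_elementary {t : Cohomology ℤ}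
    (h : ∀ p : ℕ, p.Prime → t ∈ elementary p) : t ∈ torsionClasses := by
  obtain ⟨M, hM, ht⟩ := h 2 Nat.prime_two
  exact ⟨_, ne_zero_of_isCoprime Nat.prime_two hM, ht⟩

theorem comparisonTarget_surjective : Function.Surjective comparisonTarget := by
  intro y
  obtain ⟨a, b, h⟩ := exists_sub_mem_elementary y
  obtain ⟨t, ht⟩ := exists_torsionSum_eq (mem_torsionClasses_of_elementary h)
  refine ⟨Target.mk (PreRing.pair (Polynomial.C a + Polynomial.C b * Polynomial.X) t), ?_⟩
  rw [comparisonTarget_mk, comparison_linear, ht, add_sub_cancel]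

theorem comparison_mem {n : ℕ} {x : PreRing} (hx : x ∈ PreRing.degree n) :
    comparison x ∈ cohomologyDegree ℤ n := by
  obtain ⟨⟨c, hc⟩, hb⟩ := hx
  rw [comparison_apply, hc, Polynomial.aeval_monomial, eq_intCast, ← zsmul_eq_mul]
  exact add_mem (zsmul_mem (v₁_pow_mem n) _) (torsionSum_mem_cohomologyDegree hb)

/-- Degrees 0 and 1 are spanned by powers of v₁. From degree 2 on every class is torsion and comes
from the Bockstein summands alone, the powers of v₁ included. -/
theorem exists_comparison_eq {n : ℕ} {y : Cohomology ℤ} (hy : y ∈ cohomologyDegree ℤ n) :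
    ∃ x ∈ PreRing.degree n, comparison x = y := by
  have h0 : ∀ (n : ℕ) (c : ℤ), PreRing.pair (Polynomial.monomial n c) 0 ∈ PreRing.degree n :=
    fun n c => ⟨⟨c, rfl⟩, fun p => zero_mem _⟩
  have h1 : ∀ (n : ℕ) (c : ℤ), comparison (PreRing.pair (Polynomial.monomial n c) 0) = c • v₁ ^ n := by
    intro n c
    rw [comparison_pair, Polynomial.aeval_monomial, eq_intCast, ← zsmul_eq_mul, map_zero, add_zero]
  obtain ⟨f, rfl⟩ := mem_cohomologyDegree.1 hy
  match n, f with
  | 0, f => exact ⟨_, h0 0 _, by rw [h1, pow_zero, degreeClass_zero]⟩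
  | 1, f => exact ⟨_, h0 1 _, by rw [h1, pow_one, degreeClass_one]⟩
  | n + 2, f =>
    obtain ⟨t, ht⟩ := exists_torsionSum_eq (mem_torsionClasses_of_elementary fun p hp => by
      have : Fact p.Prime := ⟨hp⟩
      exact degreeClass_mem_elementary p f)
    refine ⟨PreRing.pair 0 t, ⟨⟨0, (map_zero _).symm⟩, fun p => ?_⟩, ?_⟩
    · change (t p : Cohomology (ZMod p)) ∈ _
      rw [← reduction_torsionSum, ht]
      exact map_mem_cohomologyDegree _ hy
    · rw [comparison_pair, ht, map_zero, zero_add]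

/-- The cohomology ring of `B𝔾ₐ`. -/
noncomputable def cohomologyEquiv : Cohomology ℤ ≃+* Target :=
  (RingEquiv.ofBijective comparisonTarget
    ⟨comparisonTarget_injective, comparisonTarget_surjective⟩).symm

theorem cohomologyEquiv_symm_mk (x : PreRing) :
    cohomologyEquiv.symm (Target.mk x) = comparison x :=
  comparisonTarget_mk x

theorem cohomologyEquiv_comparison (x : PreRing) :
    cohomologyEquiv (comparison x) = Target.mk x := by
  rw [← cohomologyEquiv_symm_mk, RingEquiv.apply_symm_apply]

theorem map_cohomologyDegree (n : ℕ) :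
    (cohomologyDegree ℤ n).map cohomologyEquiv.toAddEquiv.toAddMonoidHom = Target.degree n := by
  ext x
  constructor
  · rintro ⟨y, hy, rfl⟩
    obtain ⟨x, hx, rfl⟩ := exists_comparison_eq hy
    exact ⟨x, hx, (cohomologyEquiv_comparison x).symm⟩
  · rintro ⟨x, hx, rfl⟩
    exact ⟨comparison x, comparison_mem hx, cohomologyEquiv_comparison x⟩

end BGa

namespace BGa

open MvPolynomial

/-! ### The torsion of the second cohomology -/

section secondCohomology

theorem diff_X_pow {k : Type*} [CommRing k] (m : ℕ) :
    diff 1 (X 0 ^ m : Cochain k 1) = X 1 ^ m - (X 0 + X 1) ^ m + X 0 ^ m := by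
  rw [diff_apply]
  simp [Finset.sum_range_succ, coface, face]
  ring

variable (p : Nat.Primes)

/-- Modulo p the power x^{p^r} is additive by Frobenius, so its coboundary is divisible by p. The
quotient is a cocycle because p can be cancelled. -/
theorem exists_smul_eq_diff_X_pow (r : ℕ) :
    ∃ g : (diff (k := ℤ) 2).ker, diff 1 (X 0 ^ (p : ℕ) ^ r : Cochain ℤ 1) = (p : ℤ) • (g : Cochain ℤ 2) := by
  have : Fact (p : ℕ).Prime := ⟨p.2⟩
  have h : MvPolynomial.map (Int.castRingHom (ZMod p)) (diff 1 (X 0 ^ (p : ℕ) ^ r : Cochain ℤ 1)) = 0 := by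
    rw [diff_X_pow]
    simp only [map_add, map_sub, map_pow, map_X]
    rw [add_pow_char_pow]
    ring
  obtain ⟨g, hg⟩ := (C_dvd_iff_zmod (p : ℕ) _).2 h
  have hg : diff 1 (X 0 ^ (p : ℕ) ^ r : Cochain ℤ 1) = (p : ℤ) • g := by
    rw [hg, zsmul_eq_mul]; simp
  refine ⟨⟨g, ?_⟩, hg⟩
  have h2 := diff_diff (X 0 ^ (p : ℕ) ^ r : Cochain ℤ 1)
  rw [hg, map_zsmul] at h2
  exact (smul_eq_zero.1 h2).resolve_left (Int.natCast_ne_zero.2 p.2.ne_zero)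

/-- The cocycle `d (x ^ pʳ) / p`. -/
noncomputable def powCocycle (r : ℕ) : (diff (k := ℤ) 2).ker :=
  (exists_smul_eq_diff_X_pow p r).choose

theorem smul_powCocycle (r : ℕ) :
    (p : ℤ) • (powCocycle p r : Cochain ℤ 2) = diff 1 (X 0 ^ (p : ℕ) ^ r) :=
  (exists_smul_eq_diff_X_pow p r).choose_spec.symm

/-- The class of `d (x ^ pʳ) / p`. -/
noncomputable def powClass (r : ℕ) : Cohomology ℤ := degreeClass ℤ 2 (powCocycle p r)

theorem powClass_mem (r : ℕ) : powClass p r ∈ cohomologyDegree ℤ 2 ⊓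
    (nsmulAddMonoidHom (α := Cohomology ℤ) (p : ℕ)).ker := by
  refine ⟨mem_cohomologyDegree.2 ⟨_, rfl⟩, ?_⟩
  change (p : ℕ) • powClass p r = 0
  rw [powClass, ← map_nsmul, degreeClass_eq_zero_iff]
  refine ⟨X 0 ^ (p : ℕ) ^ r, ?_⟩
  rw [← smul_powCocycle, natCast_zsmul]
  rfl

/-- If two classes agree, x^{p^{r+1}} - x^{p^{s+1}} - p h is additive for some h, hence a multiple
of x. Its coefficient at x^{p^{r+1}} must vanish, making 1 divisible by p. The shift to r + 1 keeps
the exponent different from 1. -/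
theorem powClass_injective : Function.Injective fun r => powClass p (r + 1) := by
  intro r s hrs
  by_contra hne
  obtain ⟨h, hh⟩ := degreeClass_eq_zero_iff.1
    ((map_sub (degreeClass ℤ 2) _ _).trans (sub_eq_zero.2 hrs))
  have hcl : diff 1 (X 0 ^ (p : ℕ) ^ (r + 1) - X 0 ^ (p : ℕ) ^ (s + 1) - (p : ℤ) • h : Cochain ℤ 1) = 0 := by
    rw [map_sub, map_sub, map_zsmul, hh, ← smul_powCocycle, ← smul_powCocycle, ← smul_sub]
    exact sub_self _
  have hc := congrArg (coeff (Finsupp.single 0 ((p : ℕ) ^ (r + 1)))) (eq_smul_X_of_closed hcl)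
  have hinj : ∀ m m' : ℕ, (Finsupp.single (0 : Fin 1) m = Finsupp.single 0 m') ↔ m = m' :=
    fun m m' => (Finsupp.single_injective 0).eq_iff
  have h1 : 1 ≠ (p : ℕ) ^ (r + 1) := (Nat.one_lt_pow (Nat.succ_ne_zero r) p.2.one_lt).ne
  have h2 : (p : ℕ) ^ (s + 1) ≠ (p : ℕ) ^ (r + 1) := fun e =>
    hne (Nat.succ_injective (Nat.pow_right_injective p.2.two_le e)).symm
  rw [coeff_sub, coeff_sub, coeff_X_pow, coeff_X_pow, coeff_smul, coeff_smul, coeff_X, if_pos rfl,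
    if_neg (mt (hinj _ _).1 h2), if_neg (mt (hinj _ _).1 h1), smul_zero, sub_zero, smul_eq_mul,
    sub_eq_zero] at hc
  exact (Nat.prime_iff_prime_int.1 p.2).not_isUnit (IsUnit.of_mul_eq_one _ hc.symm)

/-- A finitely generated abelian group of exponent p is finite, whereas the classes of
d(x^{p^{r+1}}) / p are infinitely many. -/
theorem not_fg_torsion : ¬ (cohomologyDegree ℤ 2 ⊓
    (nsmulAddMonoidHom (α := Cohomology ℤ) (p : ℕ)).ker).FG := by
  intro hfg
  have h1 := (AddGroup.fg_iff_addSubgroup_fg _).2 hfg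
  have h2 := AddCommGroup.finite_of_fg_isAddTorsion _ fun x :
      ↥(cohomologyDegree ℤ 2 ⊓ (nsmulAddMonoidHom (α := Cohomology ℤ) (p : ℕ)).ker) =>
    isOfFinAddOrder_iff_nsmul_eq_zero.2 ⟨p, p.2.pos, Subtype.ext x.2.2⟩
  exact not_injective_infinite_finite
    (fun r => (⟨powClass p (r + 1), powClass_mem p (r + 1)⟩ : ↥(cohomologyDegree ℤ 2 ⊓
      (nsmulAddMonoidHom (α := Cohomology ℤ) (p : ℕ)).ker)))
    fun r s h => powClass_injective p (congrArg Subtype.val h)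

end secondCohomology

end BGa

theorem mainTheorem12 :
    -- `H^*(B𝔾ₐ, 𝒪) ≃ (ℤ[v₁] ⊕ ⨁_p Im β_p) / (v₁² = v₂)` as graded rings, with `v₁` corresponding to
    -- `v₁` and with the identification of `Im β_p` inverse to reduction modulo `p`
    (∃ φ : BGa.Cohomology ℤ ≃+* BGa.Target,
      (∀ n : ℕ, (BGa.cohomologyDegree ℤ n).map φ.toAddEquiv.toAddMonoidHom = BGa.Target.degree n) ∧
      φ BGa.v₁ = BGa.Target.mk BGa.PreRing.genV₁ ∧
      ∀ (p : Nat.Primes) (b : BGa.imBockstein p),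
        BGa.reduction p (φ.symm (BGa.Target.mk (BGa.PreRing.ofImBockstein p b))) = b) ∧
    -- all `p`-primary torsion is elementary
    (∀ (p : Nat.Primes) (m : ℕ) (x : BGa.Cohomology ℤ),
      (p : ℕ) ^ m • x = 0 → (p : ℕ) • x = 0) ∧
    -- the `p`-torsion of `H²` is not finitely generated
    (∀ p : Nat.Primes,
      ¬ (BGa.cohomologyDegree ℤ 2 ⊓
        (nsmulAddMonoidHom (α := BGa.Cohomology ℤ) (p : ℕ)).ker).FG) := by
  refine ⟨⟨BGa.cohomologyEquiv, BGa.map_cohomologyDegree, ?_, fun p b => ?_⟩,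
    fun p m x => BGa.smul_eq_zero_of_pow_smul_eq_zero p.2 m, BGa.not_fg_torsion⟩
  · rw [← BGa.comparison_genV₁, BGa.cohomologyEquiv_comparison]
  · rw [BGa.cohomologyEquiv_symm_mk, BGa.comparison_ofImBockstein, BGa.reduction_torsionLift]
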